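/- **Setting.** Let $A\in\mathbb{R}^{n\times d}$ with $d\ge 1$ have full column rank $d$, let $b\in\mathbb{R}^n$, let $\mathcal C\subseteq\mathbb{R}^d$ be non-empty, closed and convex, let $\epsilon\in(0,0.09)$, and let $x^\ast=\operatorname{argmin}_{x\in\mathcal C}\|Ax-b\|_2$. Let $\operatorname{nnz}(A)$ be the number of non-zero entries of $A$. A Count-Sketch matrix $S\in\mathbb{R}^{m\times n}$ is a matrix whose $j$-th column vanishes outside one position $p_j\in[m]$, where it has the value $v_j\in\mathbb{R}$. A learned Count-Sketch matrix $S_1$ is an arbitrary such matrix, given by its positions and values, with $m\le\mathrm{poly}(d/\epsilon)$ rows. For $S\in\mathbb{R}^{m\times n}$ put $$Z_1(S)=\inf_{v\in\mathrm{col}(A),\ \|v\|_2=1}\|Sv\|_2^2,\qquad Z_2(S)=\sup_{u,v\in\mathrm{col}(A),\ \|u\|_2=\|v\|_2=1}\langle u,(S^\top S-I_n)v\rangle .$$ **Theorem.** There is a randomized algorithm which, given $A$ (as a list of its non-zero entries), $b$, $\epsilon$ and $S_1$, returns $\hat x$ such that, with probability at least $0.98$, $$\|A(\hat x-x^\ast)\|_2\le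 O\Big(\min\Big\{\frac{Z_2(S_1)}{Z_1(S_1)},\ \epsilon\Big\}\Big)\,\|Ax^\ast\|_2$$ (the quotient is read as $\infty$ if $Z_1(S_1)=0$), and such that $\hat x$ is a minimizer of the sketched problem $$\min_{x\in\mathcal C}\Big\{\tfrac12\|SAx\|_2^2-\langle A^\top b,x\rangle\Big\}$$ for $S=S_1$ or for $S=S_2$, where $S_2$ is a Count-Sketch matrix with values $\pm1$ and $\Theta(d^2/\epsilon^2)$ rows. The algorithm always halts after $$O\big(\operatorname{nnz}(A)\log(1/\epsilon)+\mathrm{poly}(d/\epsilon)\big)$$ steps of a randomized real RAM (unit-cost exact real arithmetic and comparisons, unit-cost uniform random integers), plus at most one call of a solver for strictly convex quadratic programs $\min_{x\in\mathcal C}\{\frac12x^\top Hx-\langle g,x\rangle\}$ in $d$ variables over the constraint set $\mathcal C$. If $\mathcal C=\mathbb{R}^d$, the same holds (for a suitable algorithm) without any solver call. The algorithms are fixed programs, and the constants in the error bound and in $\Theta(\cdot)$ are absolute. The constant and the polynomial in the running time depend only on the polynomial that bounds the number of rows of $S_1$. -/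

import Mathlib

/-! ## A randomized real RAM with a step count

Programs are finite first-order texts over integer and real scalars and integer and real
two-dimensional arrays of unbounded size.  They are uniform (one text for all inputs), may mention
only natural and rational literals, and pay one step for every arithmetic operation, comparison,
memory access and loop iteration.  Loops have the form "for `x < e`".  A program may draw a uniform
random integer, and it may call an external solver `O`; such calls are counted separately.
All memory is initially zero, except for the input. -/

namespace RealRAM

/-- Integer expressions. There is no multiplication and no division of integers, so that no
large integers can be produced quickly. `get a i j` reads the cell `(i, j)` of integer array `a`. -/
inductive NExp : Type where
  | lit (c : ℕ)
  | var (x : ℕ)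
  | get (a : ℕ) (i j : NExp)
  | add (e f : NExp)
  | sub (e f : NExp)

/-- Real expressions. -/
inductive RExp : Type where
  | lit (q : ℚ)
  | var (x : ℕ)
  | get (a : ℕ) (i j : NExp)
  | ofNat (e : NExp)
  | add (e f : RExp)
  | sub (e f : RExp)
  | mul (e f : RExp)
  | div (e f : RExp)

/-- Tests. -/
inductive BExp : Type where
  | nlt (e f : NExp)
  | rlt (e f : RExp)
  | not (t : BExp)
  | and (t u : BExp)

/-- Commands. -/
inductive Cmd : Type where
  | skip
  /-- integer variable `x` := `e` -/
  | nset (x : ℕ) (e : NExp)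
  /-- real variable `x` := `e` -/
  | rset (x : ℕ) (e : RExp)
  /-- cell `(i, j)` of integer array `a` := `e` -/
  | nput (a : ℕ) (i j : NExp) (e : NExp)
  /-- cell `(i, j)` of real array `a` := `e` -/
  | rput (a : ℕ) (i j : NExp) (e : RExp)
  /-- integer variable `x` := least natural number that is at least `e` (found by counting up) -/
  | ceil (x : ℕ) (e : RExp)
  /-- integer variable `x` := uniform random element of `{0, …, max e 1 - 1}` -/
  | rand (x : ℕ) (e : NExp)
  | seq (c c' : Cmd)
  | ite (t : BExp) (c c' : Cmd)
  /-- for `x = 0, …, e - 1` do `c`, where `e` is evaluated once, at the start -/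
  | loop (x : ℕ) (e : NExp) (c : Cmd)
  /-- column `0` of real array `r` := answer of the external solver to the query whose matrix is
  real array `h` and whose vector is column `0` of real array `g` -/
  | solve (h g r : ℕ)

/-- A memory state, with the number of steps and the number of solver calls made so far. -/
structure State : Type where
  nvar : ℕ → ℕ
  rvar : ℕ → ℝ
  narr : ℕ → ℕ → ℕ → ℕ
  rarr : ℕ → ℕ → ℕ → ℝ
  time : ℕ
  calls : ℕ

/-- An external solver: it maps a matrix and a vector to a vector. -/
abbrev Solver : Type := (ℕ → ℕ → ℝ) → (ℕ → ℝ) → ℕ → ℝ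

/-- Let `k` steps pass. -/
def State.tick (s : State) (k : ℕ) : State := { s with time := s.time + k }

def State.setN (s : State) (x v : ℕ) : State :=
  { s with nvar := Function.update s.nvar x v }

def State.setR (s : State) (x : ℕ) (v : ℝ) : State :=
  { s with rvar := Function.update s.rvar x v }

def State.putN (s : State) (a i j v : ℕ) : State :=
  { s with
      narr := Function.update s.narr a
        (Function.update (s.narr a) i (Function.update (s.narr a i) j v)) }

def State.putR (s : State) (a i j : ℕ) (v : ℝ) : State :=
  { s with
      rarr := Function.update s.rarr a
        (Function.update (s.rarr a) i (Function.update (s.rarr a i) j v)) }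

/-- Ask the solver once. -/
def State.ask (s : State) (O : Solver) (h g r : ℕ) : State :=
  { s with
      rarr := Function.update s.rarr r
        (fun i j => if j = 0 then O (s.rarr h) (fun i => s.rarr g i 0) i else s.rarr r i j)
      calls := s.calls + 1 }

def NExp.eval (s : State) : NExp → ℕ
  | .lit c => c
  | .var x => s.nvar x
  | .get a i j => s.narr a (i.eval s) (j.eval s)
  | .add e f => e.eval s + f.eval s
  | .sub e f => e.eval s - f.eval s

def NExp.cost : NExp → ℕ
  | .lit _ => 1
  | .var _ => 1
  | .get _ i j => i.cost + j.cost + 1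
  | .add e f => e.cost + f.cost + 1
  | .sub e f => e.cost + f.cost + 1

noncomputable def RExp.eval (s : State) : RExp → ℝ
  | .lit q => (q : ℝ)
  | .var x => s.rvar x
  | .get a i j => s.rarr a (i.eval s) (j.eval s)
  | .ofNat e => (e.eval s : ℝ)
  | .add e f => e.eval s + f.eval s
  | .sub e f => e.eval s - f.eval s
  | .mul e f => e.eval s * f.eval s
  | .div e f => e.eval s / f.eval s

def RExp.cost : RExp → ℕ
  | .lit _ => 1
  | .var _ => 1
  | .get _ i j => i.cost + j.cost + 1
  | .ofNat e => e.cost + 1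
  | .add e f => e.cost + f.cost + 1
  | .sub e f => e.cost + f.cost + 1
  | .mul e f => e.cost + f.cost + 1
  | .div e f => e.cost + f.cost + 1

def BExp.eval (s : State) : BExp → Prop
  | .nlt e f => e.eval s < f.eval s
  | .rlt e f => e.eval s < f.eval s
  | .not t => ¬ t.eval s
  | .and t u => t.eval s ∧ u.eval s

def BExp.cost : BExp → ℕ
  | .nlt e f => e.cost + f.cost + 1
  | .rlt e f => e.cost + f.cost + 1
  | .not t => t.cost + 1
  | .and t u => t.cost + u.cost + 1

/-- Run `body 0`, then `body 1`, …, then `body (k - 1)`. -/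
noncomputable def forLoop (body : ℕ → State → PMF State) : ℕ → State → PMF State
  | 0, s => PMF.pure s
  | k + 1, s => (forLoop body k s).bind (body k)

open Classical in
/-- The distribution of the final state of a program, over the program's random draws. -/
noncomputable def exec (O : Solver) : Cmd → State → PMF State
  | .skip, s => PMF.pure (s.tick 1)
  | .nset x e, s => PMF.pure ((s.setN x (e.eval s)).tick (e.cost + 1))
  | .rset x e, s => PMF.pure ((s.setR x (e.eval s)).tick (e.cost + 1))
  | .nput a i j e, s =>
      PMF.pure ((s.putN a (i.eval s) (j.eval s) (e.eval s)).tick (i.cost + j.cost + e.cost + 1))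
  | .rput a i j e, s =>
      PMF.pure ((s.putR a (i.eval s) (j.eval s) (e.eval s)).tick (i.cost + j.cost + e.cost + 1))
  | .ceil x e, s =>
      PMF.pure ((s.setN x ⌈e.eval s⌉₊).tick (e.cost + ⌈e.eval s⌉₊ + 1))
  | .rand x e, s =>
      (PMF.uniformOfFintype (Fin (e.eval s - 1 + 1))).map
        (fun i : Fin (e.eval s - 1 + 1) => (s.setN x i.val).tick (e.cost + 1))
  | .seq c c', s => (exec O c s).bind (exec O c')
  | .ite t c c', s =>
      if t.eval s then exec O c (s.tick (t.cost + 1)) else exec O c' (s.tick (t.cost + 1))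
  | .loop x e c, s =>
      forLoop (fun i s' => exec O c ((s'.setN x i).tick 1)) (e.eval s) (s.tick (e.cost + 1))
  | .solve h g r, s => PMF.pure ((s.ask O h g r).tick 1)

end RealRAM

/-! ## Sketches and constrained least squares -/

namespace Sketch

open Matrix

/-- The Euclidean norm. -/
noncomputable def l2 {n : ℕ} (v : Fin n → ℝ) : ℝ := ‖WithLp.toLp 2 v‖

/-- The Count-Sketch matrix with positions `p` and values `v`: the entry of column `j` in row `p j`
is `v j`, and all other entries are zero. -/
def countSketch {m n : ℕ} (p : Fin n → Fin m) (v : Fin n → ℝ) : Matrix (Fin m) (Fin n) ℝ :=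
  Matrix.of fun i j => if p j = i then v j else 0

/-- `Z₁(S)`, the infimum of `‖S v‖₂²` over the unit vectors `v` in the column space of `A`. -/
noncomputable def Z₁ {n d m : ℕ} (A : Matrix (Fin n) (Fin d) ℝ) (S : Matrix (Fin m) (Fin n) ℝ) :
    ℝ :=
  sInf {r | ∃ v ∈ LinearMap.range A.mulVecLin, l2 v = 1 ∧ r = l2 (S *ᵥ v) ^ 2}

/-- `Z₂(S)`, the supremum of `⟨u, (Sᵀ S - I) v⟩` over the unit vectors `u, v` in the column space
of `A`. -/
noncomputable def Z₂ {n d m : ℕ} (A : Matrix (Fin n) (Fin d) ℝ) (S : Matrix (Fin m) (Fin n) ℝ) :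
    ℝ :=
  sSup {r | ∃ u ∈ LinearMap.range A.mulVecLin, ∃ v ∈ LinearMap.range A.mulVecLin,
    l2 u = 1 ∧ l2 v = 1 ∧ r = u ⬝ᵥ ((Sᵀ * S - 1) *ᵥ v)}

open Classical in
/-- `min {Z₂(S) / Z₁(S), ε}`, where the quotient is infinite if `Z₁(S) = 0`. -/
noncomputable def rate {n d m : ℕ} (A : Matrix (Fin n) (Fin d) ℝ) (S : Matrix (Fin m) (Fin n) ℝ)
    (ε : ℝ) : ℝ :=
  if Z₁ A S = 0 then ε else min (Z₂ A S / Z₁ A S) ε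

/-- `x` minimizes `‖A x - b‖₂` over `C`. -/
def IsLeastSquares {n d : ℕ} (A : Matrix (Fin n) (Fin d) ℝ) (b : Fin n → ℝ)
    (C : Set (Fin d → ℝ)) (x : Fin d → ℝ) : Prop :=
  x ∈ C ∧ IsMinOn (fun z => l2 (A *ᵥ z - b)) C x

/-- `x` minimizes the sketched objective `‖S A x‖₂² / 2 - ⟨Aᵀ b, x⟩` over `C`. -/
def IsSketchedSolution {n d m : ℕ} (A : Matrix (Fin n) (Fin d) ℝ) (b : Fin n → ℝ)
    (C : Set (Fin d → ℝ)) (S : Matrix (Fin m) (Fin n) ℝ) (x : Fin d → ℝ) : Prop :=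
  x ∈ C ∧ IsMinOn (fun z => 1 / 2 * l2 ((S * A) *ᵥ z) ^ 2 - (Aᵀ *ᵥ b) ⬝ᵥ z) C x

/-- `O` solves the strictly convex quadratic programs `min_{x ∈ C} xᵀ H x / 2 - ⟨g, x⟩` in `d`
variables. -/
def SolvesQP {d : ℕ} (C : Set (Fin d → ℝ)) (O : RealRAM.Solver) : Prop :=
  ∀ (H : Matrix (Fin d) (Fin d) ℝ), H.PosDef → ∀ (g : Fin d → ℝ) (H' : ℕ → ℕ → ℝ) (g' : ℕ → ℝ),
    (∀ i j : Fin d, H' i j = H i j) → (∀ i : Fin d, g' i = g i) →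
    (fun i : Fin d => O H' g' i) ∈ C ∧
      IsMinOn (fun z => 1 / 2 * (z ⬝ᵥ (H *ᵥ z)) - g ⬝ᵥ z) C (fun i : Fin d => O H' g' i)

/-- The set of positions of the non-zero entries of `A`. -/
abbrev Support {n d : ℕ} (A : Matrix (Fin n) (Fin d) ℝ) : Type :=
  {q : Fin n × Fin d // A q.1 q.2 ≠ 0}

/-- The number of non-zero entries of `A`. -/
noncomputable def nnz {n d : ℕ} (A : Matrix (Fin n) (Fin d) ℝ) : ℕ := Nat.card (Support A)

/-- Extension of a finite sequence by zero. -/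
def pad {α : Type} [Zero α] {n : ℕ} (f : Fin n → α) (i : ℕ) : α :=
  if h : i < n then f ⟨i, h⟩ else 0

/-- The input of the program.
* Integer variables `0, 1, 2, 3` hold `n`, `d`, `nnz(A)` and the number `m` of rows of the learned
  sketch; real variable `0` holds `ε`.
* `A` is given as the list of its non-zero entries in the order `e`: the row, the column and the
  value of the `k`-th one are in cells `(k, 0)`, `(k, 1)` of integer array `0` and in cell `(k, 0)`
  of real array `0`.
* `b` is in column `0` of real array `1`.
* The positions and values of the learned sketch are in column `0` of integer array `1` and in
  column `0` of real array `2`. -/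
noncomputable def input {n d m : ℕ} (A : Matrix (Fin n) (Fin d) ℝ)
    (e : Fin (nnz A) ≃ Support A) (b : Fin n → ℝ) (p : Fin n → Fin m) (v : Fin n → ℝ) (ε : ℝ) :
    RealRAM.State where
  nvar x := if x = 0 then n else if x = 1 then d else if x = 2 then nnz A else
    if x = 3 then m else 0
  rvar x := if x = 0 then ε else 0
  narr a i j :=
    if a = 0 ∧ j = 0 then pad (fun k => ((e k).1.1 : ℕ)) i
    else if a = 0 ∧ j = 1 then pad (fun k => ((e k).1.2 : ℕ)) i
    else if a = 1 ∧ j = 0 then pad (fun k => (p k : ℕ)) i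
    else 0
  rarr a i j :=
    if a = 0 ∧ j = 0 then pad (fun k => A (e k).1.1 (e k).1.2) i
    else if a = 1 ∧ j = 0 then pad b i
    else if a = 2 ∧ j = 0 then pad v i
    else 0
  time := 0
  calls := 0

/-- The output `x̂` is read off column `0` of real array `3`. -/
def output (d : ℕ) (s : RealRAM.State) : Fin d → ℝ := fun i => s.rarr 3 i 0

/-- On one instance, the program `P` always halts after at most
`k (nnz(A) log(1/ε) + (d/ε)^k)` steps and at most `q` solver calls. -/
def RunsInTime (P : RealRAM.Cmd) (q k : ℕ) {n d m : ℕ} (A : Matrix (Fin n) (Fin d) ℝ)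
    (e : Fin (nnz A) ≃ Support A) (b : Fin n → ℝ) (p : Fin n → Fin m) (v : Fin n → ℝ) (ε : ℝ)
    (O : RealRAM.Solver) : Prop :=
  ∀ s ∈ (RealRAM.exec O P (input A e b p v ε)).support,
    (s.time : ℝ) ≤ k * (nnz A * Real.log (1 / ε) + ((d : ℝ) / ε) ^ k) ∧ s.calls ≤ q

/-- On one instance, with probability at least `0.98`, the output `x̂` of the program `P` solves the
sketched problem for the learned sketch or for some Count-Sketch with values `±1` and `Θ(d²/ε²)`
rows, and `‖A (x̂ - x*)‖₂ ≤ κ min {Z₂(S₁) / Z₁(S₁), ε} ‖A x*‖₂`. -/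
def IsAccurate (P : RealRAM.Cmd) (κ : ℝ) {n d m : ℕ} (A : Matrix (Fin n) (Fin d) ℝ)
    (e : Fin (nnz A) ≃ Support A) (b : Fin n → ℝ) (p : Fin n → Fin m) (v : Fin n → ℝ) (ε : ℝ)
    (C : Set (Fin d → ℝ)) (O : RealRAM.Solver) : Prop :=
  ∀ xs : Fin d → ℝ, IsLeastSquares A b C xs →
    98 / 100 ≤ (RealRAM.exec O P (input A e b p v ε)).toOuterMeasure
      {s | l2 (A *ᵥ (output d s - xs)) ≤ κ * rate A (countSketch p v) ε * l2 (A *ᵥ xs) ∧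
        (IsSketchedSolution A b C (countSketch p v) (output d s) ∨
          ∃ (m₂ : ℕ) (h : Fin n → Fin m₂) (σ : Fin n → ℝ),
            (d : ℝ) ^ 2 / ε ^ 2 ≤ κ * m₂ ∧ (m₂ : ℝ) ≤ κ * ((d : ℝ) ^ 2 / ε ^ 2) ∧
            (∀ i, σ i = 1 ∨ σ i = -1) ∧
            IsSketchedSolution A b C (countSketch h σ) (output d s))}

end Sketch

/-! Write S for the learned sketch and T for a random Count-Sketch with m₂ = ⌈100 d²/ε²⌉ rows. The
algorithm forms the Gram matrices G₁ and G₂ of SA and TA, and keeps S exactly when (1 - 3ε) G₂ ≺ G₁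
≺ (1 + 3ε) G₂; otherwise it uses T.

Error of a sketch. With v = x̂ - x*, adding the first-order conditions of the true and of the
sketched problem cancels b and leaves ‖SAv‖² ≤ -⟨Ax*, (SᵀS - I)Av⟩ (`sketch_error_sq`). Dividing by
‖Av‖ gives the factor Z₂/Z₁ and the norm ‖Ax*‖ (`sketch_error`).

Decision. Let T preserve inner products on col(A) up to relative error ε. If the test passes, then
Z₁(S) ≥ 1 - 4ε and Z₂(S) ≤ 5ε, so Z₂/Z₁ ≤ 8ε and the error of S is within a factor 8 of the minimum
(`le_rate_of_pass`). If it fails, S distorts some vector by at least ε, so Z₂(S) ≥ ε; as Z₁ ≤ 1 +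
Z₂, the minimum is at least ε/2, and the error ε/(1 - ε) of T is good enough (`le_rate_of_fail`).

Probability. For unit vectors u, w the mean square of ⟨Tu, Tw⟩ - ⟨u, w⟩ is at most 2/m₂
(`sum_sq_distortion`). Summed over the pairs of an orthonormal basis of col(A), this bounds the
squared Frobenius norm, hence the operator norm, of the distortion. Its mean is at most 2d²/m₂ ≤
ε²/50, and Markov's inequality leaves a failure probability of 1/50 (`exists_good_draws`).

Cost. Zero rows may make n much larger than nnz(A), so no loop runs over the rows of A. A hash is
drawn for every non-zero entry, and the last draw in a row is the one that counts. Definiteness is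
decided exactly from the signs of elimination pivots (`posFrom_iff`), and the same elimination
solves the problem without constraints (`solve_eq`). All of the program except the draws is
deterministic (`exec_eq_run`), and its loop bounds are fixed in advance, so that the running time
can be read off the text (`static_exec`). -/

namespace RealRAM

/-! ### Program logic: deterministic runs, frames, running time, independent draws. -/

/-- Iterate a deterministic loop body with the counter `0, …, k - 1`. -/
def iter (body : ℕ → State → State) : ℕ → State → State
  | 0, s => s
  | k + 1, s => body k (iter body k s)

open Classical in
/-- The final state of a program that makes no random draws. -/
noncomputable def run (O : Solver) : Cmd → State → State
  | .skip, s => s.tick 1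
  | .nset x e, s => (s.setN x (e.eval s)).tick (e.cost + 1)
  | .rset x e, s => (s.setR x (e.eval s)).tick (e.cost + 1)
  | .nput a i j e, s =>
      (s.putN a (i.eval s) (j.eval s) (e.eval s)).tick (i.cost + j.cost + e.cost + 1)
  | .rput a i j e, s =>
      (s.putR a (i.eval s) (j.eval s) (e.eval s)).tick (i.cost + j.cost + e.cost + 1)
  | .ceil x e, s => (s.setN x ⌈e.eval s⌉₊).tick (e.cost + ⌈e.eval s⌉₊ + 1)
  | .rand _ _, s => s
  | .seq c c', s => run O c' (run O c s)
  | .ite t c c', s =>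
      if t.eval s then run O c (s.tick (t.cost + 1)) else run O c' (s.tick (t.cost + 1))
  | .loop x e c, s =>
      iter (fun i s' => run O c ((s'.setN x i).tick 1)) (e.eval s) (s.tick (e.cost + 1))
  | .solve h g r, s => (s.ask O h g r).tick 1

/-- The program makes no random draws. -/
def Cmd.IsDet : Cmd → Prop
  | .rand _ _ => False
  | .seq c c' => c.IsDet ∧ c'.IsDet
  | .ite _ c c' => c.IsDet ∧ c'.IsDet
  | .loop _ _ c => c.IsDet
  | _ => True

theorem forLoop_pure (body : ℕ → State → State) (k : ℕ) (s : State) :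
    forLoop (fun i s' => PMF.pure (body i s')) k s = PMF.pure (iter body k s) := by
  induction k with
  | zero => rfl
  | succ k ih => simp [forLoop, iter, ih]

/-- Only the hashes are random, so the rest of the program can be reasoned about as a function on
states. The value of `run` at a draw is a dummy, which `IsDet` rules out. -/
theorem exec_eq_run (O : Solver) (c : Cmd) (hc : c.IsDet) (s : State) :
    exec O c s = PMF.pure (run O c s) := by
  induction c generalizing s with
  | seq c c' ih ih' => simp [exec, run, ih hc.1, ih' hc.2]
  | ite t c c' ih ih' =>
    simp only [exec, run]
    split_ifs
    · exact ih hc.1 _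
    · exact ih' hc.2 _
  | loop x e c ih =>
    simp only [exec, run, ← forLoop_pure, ih hc]
  | rand x e => exact hc.elim
  | _ => simp [exec, run]

theorem iter_inv (body : ℕ → State → State) (I : ℕ → State → Prop) (k : ℕ) (s : State)
    (h0 : I 0 s) (hstep : ∀ i < k, ∀ s', I i s' → I (i + 1) (body i s')) :
    I k (iter body k s) := by
  induction k with
  | zero => exact h0
  | succ k ih =>
    exact hstep k (Nat.lt_succ_self k) _ (ih fun i hi => hstep i (Nat.lt_succ_of_lt hi))

/-- The invariant rule for loops of deterministic programs. -/
theorem run_loop_inv (O : Solver) (x : ℕ) (e : NExp) (c : Cmd) (s : State)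
    (I : ℕ → State → Prop) (h0 : I 0 (s.tick (e.cost + 1)))
    (hstep : ∀ i < e.eval s, ∀ s', I i s' → I (i + 1) (run O c ((s'.setN x i).tick 1))) :
    I (e.eval s) (run O (.loop x e c) s) :=
  iter_inv _ I _ _ h0 hstep

theorem forLoop_support (body : ℕ → State → PMF State) (I : ℕ → State → Prop) (k : ℕ) (s : State)
    (h0 : I 0 s) (hstep : ∀ i < k, ∀ s', I i s' → ∀ t ∈ (body i s').support, I (i + 1) t) :
    ∀ t ∈ (forLoop body k s).support, I k t := by
  induction k with
  | zero =>
    intro t ht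
    simp only [forLoop, PMF.support_pure, Set.mem_singleton_iff] at ht
    exact ht ▸ h0
  | succ k ih =>
    intro t ht
    simp only [forLoop, PMF.mem_support_bind_iff] at ht
    obtain ⟨s', hs', ht⟩ := ht
    exact hstep k (Nat.lt_succ_self k) s'
      (ih (fun i hi => hstep i (Nat.lt_succ_of_lt hi)) s' hs') t ht

/-- The integer variables that a program may write. -/
def Cmd.wN : Cmd → List ℕ
  | .nset x _ => [x]
  | .ceil x _ => [x]
  | .rand x _ => [x]
  | .seq c c' => c.wN ++ c'.wN
  | .ite _ c c' => c.wN ++ c'.wN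
  | .loop x _ c => x :: c.wN
  | _ => []

/-- The real variables that a program may write. -/
def Cmd.wV : Cmd → List ℕ
  | .rset x _ => [x]
  | .seq c c' => c.wV ++ c'.wV
  | .ite _ c c' => c.wV ++ c'.wV
  | .loop _ _ c => c.wV
  | _ => []

/-- The integer arrays that a program may write. -/
def Cmd.wA : Cmd → List ℕ
  | .nput a _ _ _ => [a]
  | .seq c c' => c.wA ++ c'.wA
  | .ite _ c c' => c.wA ++ c'.wA
  | .loop _ _ c => c.wA
  | _ => []

/-- The real arrays that a program may write. -/
def Cmd.wR : Cmd → List ℕ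
  | .rput a _ _ _ => [a]
  | .solve _ _ r => [r]
  | .seq c c' => c.wR ++ c'.wR
  | .ite _ c c' => c.wR ++ c'.wR
  | .loop _ _ c => c.wR
  | _ => []

/-- `s'` agrees with `s` on everything that `c` does not write. -/
structure Frame (c : Cmd) (s s' : State) : Prop where
  nvar : ∀ x, x ∉ c.wN → s'.nvar x = s.nvar x
  rvar : ∀ x, x ∉ c.wV → s'.rvar x = s.rvar x
  narr : ∀ a, a ∉ c.wA → s'.narr a = s.narr a
  rarr : ∀ a, a ∉ c.wR → s'.rarr a = s.rarr a

/-- The write sets are syntactic overestimates, with loop counters included. Thanks to them, loop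
invariants need only speak of what the loop changes. -/
theorem frame_exec (O : Solver) (c : Cmd) (s : State) :
    ∀ s' ∈ (exec O c s).support, Frame c s s' := by
  induction c generalizing s with
  | seq c c' ih ih' =>
    intro s' hs'
    simp only [exec, PMF.mem_support_bind_iff] at hs'
    obtain ⟨u, hu, hs'⟩ := hs'
    have h1 := ih s u hu
    have h2 := ih' u s' hs'
    constructor <;> intro x hx <;>
      simp only [Cmd.wN, Cmd.wV, Cmd.wA, Cmd.wR, List.mem_append, not_or] at hx
    · rw [h2.nvar x hx.2, h1.nvar x hx.1]
    · rw [h2.rvar x hx.2, h1.rvar x hx.1]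
    · rw [h2.narr x hx.2, h1.narr x hx.1]
    · rw [h2.rarr x hx.2, h1.rarr x hx.1]
  | ite t c c' ih ih' =>
    intro s' hs'
    simp only [exec] at hs'
    split_ifs at hs'
    · have h := ih _ s' hs'
      constructor <;> intro x hx <;>
        simp only [Cmd.wN, Cmd.wV, Cmd.wA, Cmd.wR, List.mem_append, not_or] at hx
      exacts [h.nvar x hx.1, h.rvar x hx.1, h.narr x hx.1, h.rarr x hx.1]
    · have h := ih' _ s' hs'
      constructor <;> intro x hx <;>
        simp only [Cmd.wN, Cmd.wV, Cmd.wA, Cmd.wR, List.mem_append, not_or] at hx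
      exacts [h.nvar x hx.2, h.rvar x hx.2, h.narr x hx.2, h.rarr x hx.2]
  | loop y e c ih =>
    refine forLoop_support _ (fun _ t => Frame (.loop y e c) s t) _ _ ⟨?_, ?_, ?_, ?_⟩ ?_
    · exact fun _ _ => rfl
    · exact fun _ _ => rfl
    · exact fun _ _ => rfl
    · exact fun _ _ => rfl
    · intro i _ s' hs' t ht
      have h := ih _ t ht
      constructor
      · intro x hx
        have hx' := hx
        simp only [Cmd.wN, List.mem_cons, not_or] at hx'
        rw [h.nvar x hx'.2, ← hs'.nvar x hx]
        simp [State.tick, State.setN, hx'.1]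
      · exact fun x hx => (h.rvar x hx).trans (hs'.rvar x hx)
      · exact fun x hx => (h.narr x hx).trans (hs'.narr x hx)
      · exact fun x hx => (h.rarr x hx).trans (hs'.rarr x hx)
  | rand y e =>
    intro s' hs'
    simp only [exec, PMF.support_map, Set.mem_image] at hs'
    obtain ⟨i, -, rfl⟩ := hs'
    constructor <;> intro x hx <;>
      simp_all [Cmd.wN, Cmd.wV, Cmd.wA, Cmd.wR, State.tick, State.setN]
  | _ =>
    intro s' hs'
    simp only [exec, PMF.support_pure, Set.mem_singleton_iff] at hs'
    subst hs'
    constructor <;> intro x hx <;>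
      simp_all [Cmd.wN, Cmd.wV, Cmd.wA, Cmd.wR, State.tick, State.setN, State.setR, State.putN,
        State.putR, State.ask]

theorem frame_run (O : Solver) (c : Cmd) (hc : c.IsDet) (s : State) : Frame c s (run O c s) :=
  frame_exec O c s _ (by simp [exec_eq_run O c hc])

/-- The number of solver calls of a program without calls in loops. -/
def Cmd.asks : Cmd → ℕ
  | .seq c c' => c.asks + c'.asks
  | .ite _ c c' => max c.asks c'.asks
  | .loop _ _ c => c.asks
  | .solve _ _ _ => 1
  | _ => 0

/-- The integer variables below `L` are never written, all loop bounds are such variables, no loop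
calls the solver, and there is no `ceil`. -/
def Cmd.Static (L : ℕ) : Cmd → Prop
  | .nset x _ => L ≤ x
  | .ceil _ _ => False
  | .rand x _ => L ≤ x
  | .seq c c' => c.Static L ∧ c'.Static L
  | .ite _ c c' => c.Static L ∧ c'.Static L
  | .loop x e c => L ≤ x ∧ (∃ y < L, e = .var y) ∧ c.Static L ∧ c.asks = 0
  | _ => True

/-- The value of a loop bound when the integer variables have the values `ρ`. -/
def NExp.static (ρ : ℕ → ℕ) : NExp → ℕ
  | .var y => ρ y
  | _ => 0

/-- A bound for the running time of a `Static` program when the integer variables that occur as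
loop bounds have the values `ρ`. -/
def Cmd.bound (ρ : ℕ → ℕ) : Cmd → ℕ
  | .skip => 1
  | .nset _ e => e.cost + 1
  | .rset _ e => e.cost + 1
  | .nput _ i j e => i.cost + j.cost + e.cost + 1
  | .rput _ i j e => i.cost + j.cost + e.cost + 1
  | .ceil _ e => e.cost
  | .rand _ e => e.cost + 1
  | .seq c c' => c.bound ρ + c'.bound ρ
  | .ite t c c' => t.cost + 1 + (c.bound ρ + c'.bound ρ)
  | .loop _ e c => e.cost + 1 + e.static ρ * (c.bound ρ + 1)
  | .solve _ _ _ => 1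

/-- Loop bounds are variables that are never written, so every execution path makes at most the same
number of rounds, known from the initial state. A branch is charged for both of its sides, and calls
inside loops are forbidden, so that `asks` needs no multiplication. -/
theorem static_exec (O : Solver) (L : ℕ) (ρ : ℕ → ℕ) (c : Cmd) (hc : c.Static L) (s : State)
    (hs : ∀ y < L, s.nvar y = ρ y) :
    ∀ s' ∈ (exec O c s).support, (∀ y < L, s'.nvar y = ρ y) ∧
      s'.time ≤ s.time + c.bound ρ ∧ s'.calls ≤ s.calls + c.asks := by
  induction c generalizing s with
  | seq c c' ih ih' =>
    intro s' hs'
    simp only [exec, PMF.mem_support_bind_iff] at hs'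
    obtain ⟨u, hu, hs'⟩ := hs'
    obtain ⟨h1, h2, h3⟩ := ih hc.1 s hs u hu
    obtain ⟨h4, h5, h6⟩ := ih' hc.2 u h1 s' hs'
    refine ⟨h4, ?_, ?_⟩ <;> simp only [Cmd.bound, Cmd.asks] <;> omega
  | ite t c c' ih ih' =>
    intro s' hs'
    simp only [exec] at hs'
    split_ifs at hs'
    · obtain ⟨h1, h2, h3⟩ := ih hc.1 (s.tick (t.cost + 1)) hs s' hs'
      refine ⟨h1, ?_, ?_⟩ <;> simp only [Cmd.bound, Cmd.asks, State.tick] at * <;> omega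
    · obtain ⟨h1, h2, h3⟩ := ih' hc.2 (s.tick (t.cost + 1)) hs s' hs'
      refine ⟨h1, ?_, ?_⟩ <;> simp only [Cmd.bound, Cmd.asks, State.tick] at * <;> omega
  | loop x e c ih =>
    obtain ⟨hx, ⟨y, hy, rfl⟩, hc1, hc2⟩ := hc
    have key := forLoop_support (fun i s' => exec O c ((s'.setN x i).tick 1))
      (fun i t => (∀ y < L, t.nvar y = ρ y) ∧
        t.time ≤ s.time + ((NExp.var y).cost + 1 + i * (c.bound ρ + 1)) ∧ t.calls ≤ s.calls)
      (s.nvar y) (s.tick ((NExp.var y).cost + 1)) ⟨hs, by simp [State.tick], le_rfl⟩ (by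
        rintro i - s' ⟨h1, h2, h3⟩ t ht
        obtain ⟨h4, h5, h6⟩ := ih hc1 _ (fun y hy => by
          have : y ≠ x := by omega
          simp [State.tick, State.setN, this, h1 y hy]) t ht
        simp only [State.tick, State.setN] at h5 h6
        refine ⟨h4, ?_, ?_⟩
        · rw [add_mul]; omega
        · omega)
    intro s' hs'
    obtain ⟨h1, h2, h3⟩ := key s' hs'
    refine ⟨h1, ?_, ?_⟩
    · simpa [Cmd.bound, NExp.static, hs y hy] using h2
    · omega
  | rand x e =>
    intro s' hs'
    simp only [exec, PMF.support_map, Set.mem_image] at hs'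
    obtain ⟨i, -, rfl⟩ := hs'
    simp only [Cmd.Static] at hc
    refine ⟨fun y hy => ?_, ?_, ?_⟩
    · have : y ≠ x := by omega
      simp [State.tick, State.setN, this, hs y hy]
    · simp [State.tick, State.setN, Cmd.bound]
    · simp [State.tick, State.setN]
  | nset x e =>
    intro s' hs'
    simp only [exec, PMF.support_pure, Set.mem_singleton_iff] at hs'
    subst hs'
    simp only [Cmd.Static] at hc
    refine ⟨fun y hy => ?_, ?_, ?_⟩
    · have : y ≠ x := by omega
      simp [State.tick, State.setN, this, hs y hy]
    · simp [State.tick, State.setN, Cmd.bound]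
    · simp [State.tick, State.setN]
  | ceil x e => exact hc.elim
  | _ =>
    intro s' hs'
    simp only [exec, PMF.support_pure, Set.mem_singleton_iff] at hs'
    subst hs'
    refine ⟨fun y hy => hs y hy, ?_, ?_⟩ <;>
      simp [State.tick, State.setR, State.putN, State.putR, State.ask, Cmd.bound, Cmd.asks]

/-- Two independent uniform draws are one uniform draw from the product, and a bijection preserves
uniformity. This is the inductive step for a loop of draws. -/
theorem uniform_bind_map {α β γ δ : Type*} [Fintype α] [Nonempty α] [Fintype β] [Nonempty β]
    [Fintype γ] [Nonempty γ] (e : α × β ≃ γ) (G : γ → δ) :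
    ((PMF.uniformOfFintype α).bind fun a => (PMF.uniformOfFintype β).map fun b => G (e (a, b))) =
      (PMF.uniformOfFintype γ).map G := by
  classical
  have h : PMF.uniformOfFintype γ =
      (PMF.uniformOfFintype α).bind fun a => (PMF.uniformOfFintype β).map fun b => e (a, b) := by
    ext c
    have hcard : Fintype.card γ = Fintype.card α * Fintype.card β := by
      rw [← Fintype.card_prod]; exact (Fintype.card_congr e).symm
    have hsum : ∀ a, (∑' b, if c = e (a, b) then (Fintype.card β : ENNReal)⁻¹ else 0) =
        if (e.symm c).1 = a then (Fintype.card β : ENNReal)⁻¹ else 0 := by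
      intro a
      rw [tsum_eq_single (e.symm c).2]
      · congr 1
        rw [← Equiv.symm_apply_eq, Prod.ext_iff]
        simp
      · intro b hb
        rw [if_neg]
        rintro rfl
        simp at hb
    simp only [PMF.bind_apply, PMF.map_apply, PMF.uniformOfFintype_apply, hsum, hcard]
    rw [tsum_eq_single (e.symm c).1 (by
      intro a ha
      rw [if_neg (Ne.symm ha), mul_zero])]
    rw [if_pos rfl, Nat.cast_mul, ENNReal.mul_inv]
    · exact Or.inr (ENNReal.natCast_ne_top _)
    · exact Or.inl (ENNReal.natCast_ne_top _)
  rw [h, PMF.map_bind]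
  simp only [PMF.map_comp, Function.comp_def]

theorem iter_congr (b b' : ℕ → State → State) (k : ℕ) (s : State)
    (h : ∀ i < k, b i = b' i) : iter b k s = iter b' k s := by
  induction k with
  | zero => rfl
  | succ k ih =>
    rw [iter, iter, h k (Nat.lt_succ_self k), ih fun i hi => h i (Nat.lt_succ_of_lt hi)]

/-- A loop that draws one random number per round and is otherwise deterministic: its final state
is a function of a uniformly distributed sequence of draws. -/
theorem forLoop_rand {α : Type} [Fintype α] [Nonempty α] (N : ℕ) (body : ℕ → State → PMF State)
    (f : ℕ → α → State → State) (I : State → Prop) (s : State) (hs : I s)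
    (hI : ∀ i a s', I s' → I (f i a s'))
    (hbody : ∀ i s', I s' → body i s' = (PMF.uniformOfFintype α).map fun a => f i a s') :
    forLoop body N s = (PMF.uniformOfFintype (Fin N → α)).map fun w =>
      iter (fun i s' => if h : i < N then f i (w ⟨i, h⟩) s' else s') N s := by
  induction N with
  | zero =>
    ext t
    simp [forLoop, iter, PMF.map_apply]
  | succ N ih =>
    have hiter : ∀ w : Fin N → α,
        I (iter (fun i s' => if h : i < N then f i (w ⟨i, h⟩) s' else s') N s) := by
      intro w
      refine iter_inv _ (fun _ t => I t) N s hs fun i hi t ht => ?_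
      simp only [hi, dite_true]
      exact hI _ _ _ ht
    rw [forLoop, ih, PMF.bind_map]
    let e : (Fin N → α) × α ≃ (Fin (N + 1) → α) :=
      (Equiv.prodComm _ _).trans (Fin.snocEquiv fun _ => α)
    rw [← uniform_bind_map e]
    congr 1
    funext w
    simp only [Function.comp]
    rw [hbody _ _ (hiter w)]
    congr 1
    funext a
    rw [iter]
    have h1 : e (w, a) ⟨N, N.lt_succ_self⟩ = a := by
      change (Fin.snoc w a : Fin (N + 1) → α) (Fin.last N) = a
      simp
    simp only [N.lt_succ_self, dite_true, h1]
    congr 1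
    refine iter_congr _ _ _ _ fun i hi => ?_
    have h2 : e (w, a) ⟨i, Nat.lt_succ_of_lt hi⟩ = w ⟨i, hi⟩ := by
      change (Fin.snoc w a : Fin (N + 1) → α) (Fin.castSucc ⟨i, hi⟩) = _
      rw [Fin.snoc_castSucc]
    funext t
    simp only [hi, Nat.lt_succ_of_lt hi, dite_true, h2]

end RealRAM

/-! ### Second moments of a random Count-Sketch. -/

namespace Sketch

/-- Coordinate `r` of the Count-Sketch of `x`, with hash values `h (w k)` and signs `s (w k)`. -/
def sk {α : Type} {m N : ℕ} (h : α → Fin m) (s : α → ℝ) (w : Fin N → α) (x : Fin N → ℝ)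
    (r : Fin m) : ℝ := ∑ k, if h (w k) = r then s (w k) * x k else 0

section moments

variable {α : Type} {m : ℕ} (h : α → Fin m) (s : α → ℝ)

theorem sk_cons {N : ℕ} (a : α) (w : Fin N → α) (x : Fin (N + 1) → ℝ) (r : Fin m) :
    sk h s (Fin.cons a w : Fin (N + 1) → α) x r =
      (if h a = r then s a * x 0 else 0) + sk h s w (fun k => x k.succ) r := by
  simp [sk, Fin.sum_univ_succ]

/-- Adding one coordinate changes only its own bucket, and the square of the sign is 1. The new sign
thus occurs linearly, which makes induction on the dimension possible. -/
theorem sum_sk_mul_cons (hs : ∀ a, s a ^ 2 = 1) {N : ℕ} (a : α) (w : Fin N → α)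
    (x y : Fin (N + 1) → ℝ) :
    ∑ r, sk h s (Fin.cons a w : Fin (N + 1) → α) x r *
        sk h s (Fin.cons a w : Fin (N + 1) → α) y r =
      x 0 * y 0 + s a * (x 0 * sk h s w (fun k => y k.succ) (h a) +
        y 0 * sk h s w (fun k => x k.succ) (h a)) +
      ∑ r, sk h s w (fun k => x k.succ) r * sk h s w (fun k => y k.succ) r := by
  have : ∀ r, sk h s (Fin.cons a w : Fin (N + 1) → α) x r *
        sk h s (Fin.cons a w : Fin (N + 1) → α) y r =
      (if h a = r then x 0 * y 0 + s a * (x 0 * sk h s w (fun k => y k.succ) r +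
        y 0 * sk h s w (fun k => x k.succ) r) else 0) +
      sk h s w (fun k => x k.succ) r * sk h s w (fun k => y k.succ) r := by
    intro r
    rw [sk_cons, sk_cons]
    split_ifs
    · linear_combination (x 0 * y 0) * hs a
    · ring
  rw [Finset.sum_congr rfl fun r _ => this r, Finset.sum_add_distrib]
  simp

variable [Fintype α]

theorem sum_cons {N : ℕ} (F : (Fin (N + 1) → α) → ℝ) :
    ∑ w, F w = ∑ w : Fin N → α, ∑ a, F (Fin.cons a w : Fin (N + 1) → α) := by
  rw [← (Fin.consEquiv fun _ : Fin (N + 1) => α).sum_comp, Fintype.sum_prod_type,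
    Finset.sum_comm]
  rfl

/-- The cross term is linear in the newest sign and averages to zero by `h0`, which says that the
sign has mean zero jointly with any function of the bucket. -/
theorem sum_sq_sk (hs : ∀ a, s a ^ 2 = 1) (h0 : ∀ f : Fin m → ℝ, ∑ a, s a * f (h a) = 0)
    (N : ℕ) (x : Fin N → ℝ) :
    ∑ w : Fin N → α, ∑ r, sk h s w x r ^ 2 = (Fintype.card α : ℝ) ^ N * ∑ k, x k ^ 2 := by
  induction N with
  | zero => simp [sk]
  | succ N ih =>
    rw [sum_cons]
    have : ∀ w : Fin N → α, ∑ a, ∑ r, sk h s (Fin.cons a w : Fin (N + 1) → α) x r ^ 2 =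
        Fintype.card α * x 0 ^ 2 +
          Fintype.card α * ∑ r, sk h s w (fun k => x k.succ) r ^ 2 := by
      intro w
      simp only [pow_two, sum_sk_mul_cons h s hs, Finset.sum_add_distrib]
      rw [h0 fun r => x 0 * sk h s w (fun k => x k.succ) r + x 0 * sk h s w (fun k => x k.succ) r]
      simp
    rw [Finset.sum_congr rfl fun w _ => this w, Finset.sum_add_distrib, ← Finset.mul_sum,
      ← Finset.mul_sum, ih, Fin.sum_univ_succ]
    simp
    ring

/-- The second moment of the distortion of inner products by a random Count-Sketch. -/
theorem sum_sq_distortion (hs : ∀ a, s a ^ 2 = 1)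
    (h0 : ∀ f : Fin m → ℝ, ∑ a, s a * f (h a) = 0)
    (h1 : ∀ f : Fin m → ℝ, m * ∑ a, f (h a) = Fintype.card α * ∑ r, f r)
    (N : ℕ) (x y : Fin N → ℝ) :
    m * ∑ w : Fin N → α, (∑ r, sk h s w x r * sk h s w y r - ∑ k, x k * y k) ^ 2 ≤
      2 * (Fintype.card α : ℝ) ^ N * ((∑ k, x k ^ 2) * ∑ k, y k ^ 2) := by
  induction N with
  | zero => simp [sk]
  | succ N ih =>
    set q : ℝ := (Fintype.card α : ℝ) with hq
    have hq0 : 0 ≤ q := Nat.cast_nonneg _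
    set x' : Fin N → ℝ := fun k => x k.succ
    set y' : Fin N → ℝ := fun k => y k.succ
    have hx' : 0 ≤ ∑ k, x' k ^ 2 := Finset.sum_nonneg fun _ _ => sq_nonneg _
    have hy' : 0 ≤ ∑ k, y' k ^ 2 := Finset.sum_nonneg fun _ _ => sq_nonneg _
    have key : ∀ w : Fin N → α, m * ∑ a, (∑ r, sk h s (Fin.cons a w : Fin (N + 1) → α) x r *
          sk h s (Fin.cons a w : Fin (N + 1) → α) y r - ∑ k, x k * y k) ^ 2 ≤
        q * (m * (∑ r, sk h s w x' r * sk h s w y' r - ∑ k, x' k * y' k) ^ 2) +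
          q * (2 * x 0 ^ 2 * ∑ r, sk h s w y' r ^ 2 + 2 * y 0 ^ 2 * ∑ r, sk h s w x' r ^ 2) := by
      intro w
      set D := ∑ r, sk h s w x' r * sk h s w y' r - ∑ k, x' k * y' k with hD
      -- For fixed older draws the distortion is D + s·X, where X depends only on the new bucket.
      -- The term 2sDX averages to zero by `h0`, and the mean of X² is computed from `h1`,
      -- uniformity of the bucket.
      have e1 : ∀ a, (∑ r, sk h s (Fin.cons a w : Fin (N + 1) → α) x r *
          sk h s (Fin.cons a w : Fin (N + 1) → α) y r - ∑ k, x k * y k) ^ 2 =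
          D ^ 2 + s a * (2 * D * (x 0 * sk h s w y' (h a) + y 0 * sk h s w x' (h a))) +
            (x 0 * sk h s w y' (h a) + y 0 * sk h s w x' (h a)) ^ 2 := by
        intro a
        rw [sum_sk_mul_cons h s hs, Fin.sum_univ_succ]
        linear_combination (x 0 * sk h s w y' (h a) + y 0 * sk h s w x' (h a)) ^ 2 * hs a
      rw [Finset.sum_congr rfl fun a _ => e1 a, Finset.sum_add_distrib, Finset.sum_add_distrib,
        h0 fun r => 2 * D * (x 0 * sk h s w y' r + y 0 * sk h s w x' r), mul_add,
        h1 fun r => (x 0 * sk h s w y' r + y 0 * sk h s w x' r) ^ 2]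
      have e2 : ∑ r, (x 0 * sk h s w y' r + y 0 * sk h s w x' r) ^ 2 ≤
          2 * x 0 ^ 2 * ∑ r, sk h s w y' r ^ 2 + 2 * y 0 ^ 2 * ∑ r, sk h s w x' r ^ 2 := by
        rw [Finset.mul_sum, Finset.mul_sum, ← Finset.sum_add_distrib]
        refine Finset.sum_le_sum fun r _ => ?_
        nlinarith [sq_nonneg (x 0 * sk h s w y' r - y 0 * sk h s w x' r)]
      have e3 := mul_le_mul_of_nonneg_left e2 hq0
      simp only [Finset.sum_const, Finset.card_univ, nsmul_eq_mul, ← hq]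
      linarith
    rw [sum_cons, Finset.mul_sum]
    refine (Finset.sum_le_sum fun w _ => key w).trans ?_
    rw [Finset.sum_add_distrib, ← Finset.mul_sum, ← Finset.mul_sum, ← Finset.mul_sum,
      Finset.sum_add_distrib, ← Finset.mul_sum, ← Finset.mul_sum, sum_sq_sk h s hs h0,
      sum_sq_sk h s hs h0, Fin.sum_univ_succ, Fin.sum_univ_succ]
    have e4 := mul_le_mul_of_nonneg_left (ih x' y') hq0
    -- This is the only term of the expanded right-hand side that the left-hand side lacks.
    have e5 : 0 ≤ q ^ (N + 1) * (x 0 ^ 2 * y 0 ^ 2) := by positivity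
    rw [← hq]
    change _ ≤ 2 * q ^ (N + 1) * ((x 0 ^ 2 + ∑ k, x' k ^ 2) * (y 0 ^ 2 + ∑ k, y' k ^ 2))
    rw [pow_succ q] at e5 ⊢
    linarith

end moments

end Sketch

/-! ### Gauss-Jordan elimination, pivots and positive definiteness. -/

namespace GaussJordan

open Finset

/-- One round of Gauss-Jordan elimination with pivot `(k, k)`. -/
noncomputable def step (d k : ℕ) (M : ℕ → ℕ → ℝ) (i j : ℕ) : ℝ :=
  if i ≠ k ∧ i < d ∧ j < d then M i j - M i k / M k k * M k j else M i j

/-- The effect of one round on the right-hand side. -/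
noncomputable def stepRhs (d k : ℕ) (M : ℕ → ℕ → ℝ) (r : ℕ → ℝ) (i : ℕ) : ℝ :=
  if i ≠ k ∧ i < d then r i - M i k / M k k * r k else r i

/-- The matrix after `k` rounds. -/
noncomputable def mat (d : ℕ) (M : ℕ → ℕ → ℝ) : ℕ → ℕ → ℕ → ℝ
  | 0 => M
  | k + 1 => step d k (mat d M k)

/-- The right-hand side after `k` rounds. -/
noncomputable def rhs (d : ℕ) (M : ℕ → ℕ → ℝ) (r : ℕ → ℝ) : ℕ → ℕ → ℝ
  | 0 => r
  | k + 1 => stepRhs d k (mat d M k) (rhs d M r k)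

/-- The quadratic form of the trailing block. -/
def quad (k d : ℕ) (M : ℕ → ℕ → ℝ) (x : ℕ → ℝ) : ℝ :=
  ∑ i ∈ Ico k d, ∑ j ∈ Ico k d, M i j * (x i * x j)

/-- The trailing block is positive definite. -/
def PosFrom (k d : ℕ) (M : ℕ → ℕ → ℝ) : Prop :=
  ∀ x : ℕ → ℝ, (∃ i, k ≤ i ∧ i < d ∧ x i ≠ 0) → 0 < quad k d M x

/-- Completing the square in x k leaves the quadratic form of the Schur complement, and this is what
one elimination round puts in the trailing block. -/
theorem quad_succ (k d : ℕ) (hk : k < d) (M : ℕ → ℕ → ℝ) (x : ℕ → ℝ)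
    (hM : ∀ i < d, ∀ j < d, k ≤ i → k ≤ j → M i j = M j i) (h0 : M k k ≠ 0) :
    quad k d M x = M k k * (x k + (∑ j ∈ Ico (k + 1) d, M k j * x j) / M k k) ^ 2 +
      quad (k + 1) d (step d k M) x := by
  set L := ∑ j ∈ Ico (k + 1) d, M k j * x j with hL
  have e1 : quad (k + 1) d (step d k M) x = quad (k + 1) d M x - L ^ 2 / M k k := by
    rw [pow_two, hL, sum_mul_sum, sum_div, quad, quad, ← sum_sub_distrib]
    refine sum_congr rfl fun i hi => ?_
    rw [sum_div, ← sum_sub_distrib]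
    refine sum_congr rfl fun j hj => ?_
    rw [mem_Ico] at hi hj
    rw [step, if_pos ⟨by omega, hi.2, hj.2⟩, hM i hi.2 k hk (by omega) le_rfl]
    field_simp
  have e2 : quad k d M x = M k k * x k ^ 2 + 2 * x k * L + quad (k + 1) d M x := by
    rw [quad, sum_eq_sum_Ico_succ_bot hk]
    have : ∀ i ∈ Ico (k + 1) d, ∑ j ∈ Ico k d, M i j * (x i * x j) =
        x k * (M k i * x i) + ∑ j ∈ Ico (k + 1) d, M i j * (x i * x j) := by
      intro i hi
      rw [mem_Ico] at hi
      rw [sum_eq_sum_Ico_succ_bot hk, hM i hi.2 k hk (by omega) le_rfl]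
      ring
    rw [sum_congr rfl this, sum_add_distrib, ← mul_sum, sum_eq_sum_Ico_succ_bot hk, ← hL, quad]
    have : ∑ j ∈ Ico (k + 1) d, M k j * (x k * x j) = x k * L := by
      rw [hL, mul_sum]
      exact sum_congr rfl fun j _ => by ring
    rw [this]
    ring
  rw [e1, e2]
  field_simp
  ring

theorem quad_congr {k d : ℕ} {M : ℕ → ℕ → ℝ} {x y : ℕ → ℝ} (h : ∀ i, k ≤ i → i < d → x i = y i) :
    quad k d M x = quad k d M y := by
  refine sum_congr rfl fun i hi => sum_congr rfl fun j hj => ?_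
  rw [mem_Ico] at hi hj
  rw [h i hi.1 hi.2, h j hj.1 hj.2]

theorem quad_zero {k d : ℕ} {M : ℕ → ℕ → ℝ} {x : ℕ → ℝ} (h : ∀ i, k ≤ i → i < d → x i = 0) :
    quad k d M x = 0 := by
  rw [quad_congr h]
  simp [quad]

theorem posFrom_succ (k d : ℕ) (hk : k < d) (M : ℕ → ℕ → ℝ)
    (hM : ∀ i < d, ∀ j < d, k ≤ i → k ≤ j → M i j = M j i) :
    PosFrom k d M ↔ 0 < M k k ∧ PosFrom (k + 1) d (step d k M) := by
  constructor
  · intro h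
    have hpiv : 0 < M k k := by
      have := h (Pi.single k 1) ⟨k, le_rfl, hk, by simp⟩
      rw [quad, sum_eq_single_of_mem k (by simp [hk])
        (fun b _ hb => by simp [Pi.single_apply, hb]), sum_eq_single_of_mem k (by simp [hk])
        (fun b _ hb => by simp [hb])] at this
      simpa using this
    refine ⟨hpiv, ?_⟩
    rintro x ⟨i, hi, hid, hxi⟩
    -- The value of coordinate k that makes the completed square vanish, so that only the Schur
    -- complement remains.
    set c := -(∑ j ∈ Ico (k + 1) d, M k j * x j) / M k k with hc
    have h1 := h (Function.update x k c)
      ⟨i, by omega, hid, by rwa [Function.update_of_ne (by omega)]⟩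
    rw [quad_succ k d hk M _ hM hpiv.ne'] at h1
    have h2 : ∑ j ∈ Ico (k + 1) d, M k j * Function.update x k c j =
        ∑ j ∈ Ico (k + 1) d, M k j * x j := by
      refine sum_congr rfl fun j hj => ?_
      rw [mem_Ico] at hj
      rw [Function.update_of_ne (by omega)]
    rw [h2, Function.update_self, hc, neg_div, neg_add_cancel,
      quad_congr (y := x) fun j hj _ => Function.update_of_ne (by omega) _ _] at h1
    simpa using h1
  · rintro ⟨hpiv, h⟩ x ⟨i, hi, hid, hxi⟩
    rw [quad_succ k d hk M _ hM hpiv.ne']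
    by_cases hex : ∃ j, k + 1 ≤ j ∧ j < d ∧ x j ≠ 0
    · have := h x hex
      positivity
    · push Not at hex
      have hik : i = k := by
        by_contra hne
        exact hxi (hex i (by omega) hid)
      subst hik
      rw [quad_zero hex, sum_eq_zero fun j hj => by
        rw [mem_Ico] at hj
        rw [hex j hj.1 hj.2, mul_zero]]
      simp only [zero_div, add_zero]
      positivity

theorem mat_symm (d : ℕ) (M : ℕ → ℕ → ℝ) (hM : ∀ i < d, ∀ j < d, M i j = M j i) (k : ℕ)
    (hk : k ≤ d) : ∀ i < d, ∀ j < d, k ≤ i → k ≤ j → mat d M k i j = mat d M k j i := by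
  induction k with
  | zero => exact fun i hi j hj _ _ => hM i hi j hj
  | succ k ih =>
    intro i hi j hj hki hkj
    have ih' := ih (by omega)
    rw [mat, step, step, if_pos ⟨by omega, hi, hj⟩, if_pos ⟨by omega, hj, hi⟩,
      ih' i hi j hj (by omega) (by omega), ih' i hi k hk (by omega) le_rfl,
      ih' k hk j hj le_rfl (by omega)]
    ring

/-- Each round splits off one square whose coefficient is the pivot. The equivalence needs no
assumption on the pivots: after a bad pivot the later rounds may compute anything, since both sides
are already false. Elimination without row exchanges is therefore an exact test. -/
theorem posFrom_iff (d : ℕ) (M : ℕ → ℕ → ℝ) (hM : ∀ i < d, ∀ j < d, M i j = M j i) :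
    PosFrom 0 d M ↔ ∀ k < d, 0 < mat d M k k k := by
  have : ∀ k ≤ d, PosFrom 0 d M ↔ (∀ l < k, 0 < mat d M l l l) ∧ PosFrom k d (mat d M k) := by
    intro k
    induction k with
    | zero => simp [mat]
    | succ k ih =>
      intro hk
      rw [ih (by omega), posFrom_succ k d hk _ (mat_symm d M hM k (by omega)), ← and_assoc,
        Nat.forall_lt_succ_right]
      rfl
  rw [this d le_rfl, and_iff_left]
  rintro x ⟨i, hi, hi', -⟩
  omega

/-- Subtracting a multiple of one equation from another keeps every solution, whatever the
multiplier is; zero pivots do no harm here. -/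
theorem sum_mat (d : ℕ) (M : ℕ → ℕ → ℝ) (r x : ℕ → ℝ)
    (h : ∀ i < d, ∑ j ∈ range d, M i j * x j = r i) (k : ℕ) (hk : k ≤ d) :
    ∀ i < d, ∑ j ∈ range d, mat d M k i j * x j = rhs d M r k i := by
  induction k with
  | zero => exact h
  | succ k ih =>
    intro i hi
    rw [mat, rhs, stepRhs]
    by_cases hik : i = k
    · rw [if_neg (by tauto), ← ih (by omega) i hi]
      exact sum_congr rfl fun j _ => by rw [step, if_neg (by tauto)]
    · rw [if_pos ⟨hik, hi⟩, ← ih (by omega) i hi, ← ih (by omega) k hk, mul_sum,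
        ← sum_sub_distrib]
      refine sum_congr rfl fun j hj => ?_
      rw [step, if_pos ⟨hik, hi, mem_range.1 hj⟩]
      ring

/-- A cleared column stays cleared, because every later pivot row already has a zero in it. -/
theorem mat_off_diag (d : ℕ) (M : ℕ → ℕ → ℝ) (hp : ∀ k < d, mat d M k k k ≠ 0) (k : ℕ)
    (hk : k ≤ d) : ∀ j < k, ∀ i < d, i ≠ j → mat d M k i j = 0 := by
  induction k with
  | zero => intro j hj; omega
  | succ k ih =>
    intro j hj i hi hij
    have ih' := ih (by omega)
    have hkk := hp k hk
    rw [mat, step]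
    rcases Nat.lt_succ_iff_lt_or_eq.1 hj with hjk | rfl
    · split_ifs
      · rw [ih' j hjk i hi hij, ih' j hjk k hk (by omega)]
        simp
      · exact ih' j hjk i hi hij
    · rw [if_pos ⟨hij, hi, by omega⟩]
      field_simp
      ring

theorem mat_diag (d : ℕ) (M : ℕ → ℕ → ℝ) (hp : ∀ k < d, mat d M k k k ≠ 0) (i : ℕ)
    (k : ℕ) (hik : i ≤ k) (hk : k ≤ d) : mat d M k i i = mat d M i i i := by
  induction k, hik using Nat.le_induction with
  | base => rfl
  | succ k hik ih =>
    rw [mat, step]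
    split_ifs with h
    · rw [mat_off_diag d M hp k (by omega) i (by omega) k hk (by omega), ih (by omega)]
      simp
    · exact ih (by omega)

/-- Gauss-Jordan elimination without row exchanges solves linear systems whose pivots do not
vanish. -/
theorem solve_eq (d : ℕ) (M : ℕ → ℕ → ℝ) (hp : ∀ k < d, mat d M k k k ≠ 0) (r x : ℕ → ℝ)
    (h : ∀ i < d, ∑ j ∈ range d, M i j * x j = r i) (i : ℕ) (hi : i < d) :
    rhs d M r d i / mat d M d i i = x i := by
  rw [← sum_mat d M r x h d le_rfl i hi, sum_eq_single_of_mem i (mem_range.2 hi)]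
  · rw [mul_comm, mul_div_cancel_right₀]
    rw [mat_diag d M hp i d hi.le le_rfl]
    exact hp i hi
  · intro j hj hji
    rw [mat_off_diag d M hp d le_rfl j (mem_range.1 hj) i hi (Ne.symm hji), zero_mul]

end GaussJordan

/-! ### The quantities Z₁ and Z₂ and the distortion form. -/

namespace Sketch

open Matrix

section geometry

variable {n d m : ℕ}

theorem l2_sq (v : Fin n → ℝ) : l2 v ^ 2 = v ⬝ᵥ v := by
  rw [l2, EuclideanSpace.real_norm_sq_eq, dotProduct]
  exact Finset.sum_congr rfl fun i _ => pow_two _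

theorem l2_nonneg (v : Fin n → ℝ) : 0 ≤ l2 v := norm_nonneg _

theorem l2_smul (c : ℝ) (v : Fin n → ℝ) : l2 (c • v) = |c| * l2 v := by
  rw [l2, WithLp.toLp_smul, norm_smul, Real.norm_eq_abs, l2]

theorem l2_eq_zero {v : Fin n → ℝ} : l2 v = 0 ↔ v = 0 := by
  simp [l2]

/-- The form `⟨u, (Sᵀ S - I) w⟩ = ⟨S u, S w⟩ - ⟨u, w⟩`. -/
def distortion (S : Matrix (Fin m) (Fin n) ℝ) (u w : Fin n → ℝ) : ℝ :=
  u ⬝ᵥ ((Sᵀ * S - 1) *ᵥ w)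

theorem distortion_eq (S : Matrix (Fin m) (Fin n) ℝ) (u w : Fin n → ℝ) :
    distortion S u w = (S *ᵥ u) ⬝ᵥ (S *ᵥ w) - u ⬝ᵥ w := by
  rw [distortion, sub_mulVec, dotProduct_sub, one_mulVec, ← mulVec_mulVec, mulVec_transpose,
    dotProduct_comm u, ← dotProduct_mulVec, dotProduct_comm]

theorem distortion_self (S : Matrix (Fin m) (Fin n) ℝ) (w : Fin n → ℝ) :
    distortion S w w = l2 (S *ᵥ w) ^ 2 - l2 w ^ 2 := by
  rw [distortion_eq, l2_sq, l2_sq]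

theorem distortion_smul (S : Matrix (Fin m) (Fin n) ℝ) (a b : ℝ) (u w : Fin n → ℝ) :
    distortion S (a • u) (b • w) = a * b * distortion S u w := by
  rw [distortion, mulVec_smul, dotProduct_smul, smul_dotProduct, distortion, smul_eq_mul,
    smul_eq_mul]
  ring

theorem distortion_polarization (S : Matrix (Fin m) (Fin n) ℝ) (u w : Fin n → ℝ) :
    4 * distortion S u w = distortion S (u + w) (u + w) - distortion S (u - w) (u - w) := by
  simp only [distortion_eq, mulVec_add, mulVec_sub, dotProduct_add, dotProduct_sub,
    add_dotProduct, sub_dotProduct]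
  rw [dotProduct_comm w u, dotProduct_comm (S *ᵥ w) (S *ᵥ u)]
  ring

theorem l2_parallelogram (u w : Fin n → ℝ) :
    l2 (u + w) ^ 2 + l2 (u - w) ^ 2 = 2 * (l2 u ^ 2 + l2 w ^ 2) := by
  simp only [l2_sq, dotProduct_add, dotProduct_sub, add_dotProduct, sub_dotProduct]
  ring

theorem abs_le_l2 (u : Fin n → ℝ) (i : Fin n) : |u i| ≤ l2 u := by
  have := PiLp.norm_apply_le (p := 2) (WithLp.toLp 2 u) i
  rw [l2]
  simpa using this

theorem exists_unit {w : Fin n → ℝ} (hw : w ≠ 0) :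
    ∃ u, l2 u = 1 ∧ w = l2 w • u := by
  have h : l2 w ≠ 0 := fun h => hw (l2_eq_zero.1 h)
  refine ⟨(l2 w)⁻¹ • w, ?_, ?_⟩
  · rw [l2_smul, abs_of_nonneg (inv_nonneg.2 (l2_nonneg w)), inv_mul_cancel₀ h]
  · rw [smul_smul, mul_inv_cancel₀ h, one_smul]

variable (A : Matrix (Fin n) (Fin d) ℝ) (S : Matrix (Fin m) (Fin n) ℝ)

/-- The bound by absolute entries is crude. It is needed only because a real supremum dominates the
members of its set when that set is bounded. -/
theorem bddAbove_Z₂ : BddAbove {r | ∃ u ∈ LinearMap.range A.mulVecLin,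
    ∃ v ∈ LinearMap.range A.mulVecLin,
      l2 u = 1 ∧ l2 v = 1 ∧ r = u ⬝ᵥ ((Sᵀ * S - 1) *ᵥ v)} := by
  refine ⟨∑ i, ∑ j, |(Sᵀ * S - 1 : Matrix (Fin n) (Fin n) ℝ) i j|, ?_⟩
  rintro r ⟨u, -, v, -, hu, hv, rfl⟩
  refine (le_abs_self _).trans ?_
  rw [dotProduct]
  refine (Finset.abs_sum_le_sum_abs _ _).trans (Finset.sum_le_sum fun i _ => ?_)
  rw [abs_mul]
  have h1 : |((Sᵀ * S - 1) *ᵥ v) i| ≤ ∑ j, |(Sᵀ * S - 1 : Matrix (Fin n) (Fin n) ℝ) i j| := by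
    rw [mulVec, dotProduct]
    refine (Finset.abs_sum_le_sum_abs _ _).trans (Finset.sum_le_sum fun j _ => ?_)
    rw [abs_mul]
    exact mul_le_of_le_one_right (abs_nonneg _) (hv ▸ abs_le_l2 v j)
  exact (mul_le_of_le_one_left (abs_nonneg _) (hu ▸ abs_le_l2 u i)).trans h1

theorem Z₁_mul_le {w : Fin n → ℝ} (hw : w ∈ LinearMap.range A.mulVecLin) :
    Z₁ A S * l2 w ^ 2 ≤ l2 (S *ᵥ w) ^ 2 := by
  by_cases h0 : w = 0
  · subst h0
    simp [l2]
  obtain ⟨u, hu, hwu⟩ := exists_unit h0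
  have hl : l2 w ≠ 0 := fun h => h0 (l2_eq_zero.1 h)
  have hmem : u ∈ LinearMap.range A.mulVecLin := by
    rw [hwu] at hw
    exact (Submodule.smul_mem_iff _ hl).1 hw
  have h1 : Z₁ A S ≤ l2 (S *ᵥ u) ^ 2 :=
    csInf_le ⟨0, by rintro r ⟨v, -, -, rfl⟩; positivity⟩ ⟨u, hmem, hu, rfl⟩
  have h2 : l2 (S *ᵥ w) ^ 2 = l2 w ^ 2 * l2 (S *ᵥ u) ^ 2 := by
    conv_lhs => rw [hwu, mulVec_smul, l2_smul, mul_pow, sq_abs]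
  rw [h2, mul_comm]
  exact mul_le_mul_of_nonneg_left h1 (sq_nonneg _)

/-- The absolute value comes for free: replacing u by -u flips the sign of the form and stays inside
the supremum. Homogeneity then removes the normalization. -/
theorem abs_distortion_le_Z₂ {u w : Fin n → ℝ} (hu : u ∈ LinearMap.range A.mulVecLin)
    (hw : w ∈ LinearMap.range A.mulVecLin) :
    |distortion S u w| ≤ Z₂ A S * (l2 u * l2 w) := by
  by_cases hu0 : u = 0
  · subst hu0
    simp [l2, distortion]
  by_cases hw0 : w = 0
  · subst hw0
    simp [l2, distortion]
  obtain ⟨u', hu1, huu⟩ := exists_unit hu0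
  obtain ⟨w', hw1, hww⟩ := exists_unit hw0
  have hu' : u' ∈ LinearMap.range A.mulVecLin := by
    rw [huu] at hu
    exact (Submodule.smul_mem_iff _ fun h => hu0 (l2_eq_zero.1 h)).1 hu
  have hw' : w' ∈ LinearMap.range A.mulVecLin := by
    rw [hww] at hw
    exact (Submodule.smul_mem_iff _ fun h => hw0 (l2_eq_zero.1 h)).1 hw
  have h1 : distortion S u' w' ≤ Z₂ A S :=
    le_csSup (bddAbove_Z₂ A S) ⟨u', hu', w', hw', hu1, hw1, rfl⟩
  have h2 : -distortion S u' w' ≤ Z₂ A S := by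
    refine le_csSup (bddAbove_Z₂ A S)
      ⟨(-1 : ℝ) • u', Submodule.smul_mem _ _ hu', w', hw', ?_, hw1, ?_⟩
    · rw [l2_smul, hu1]; norm_num
    · have := distortion_smul S (-1) 1 u' w'
      rw [one_smul] at this
      rw [← distortion, this]
      ring
  have h3 : distortion S u w = l2 u * l2 w * distortion S u' w' := by
    conv_lhs => rw [huu, hww, distortion_smul]
  rw [h3, abs_mul, abs_of_nonneg (mul_nonneg (l2_nonneg u) (l2_nonneg w)), mul_comm]
  exact mul_le_mul_of_nonneg_right (abs_le.2 ⟨by linarith, h1⟩)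
    (mul_nonneg (l2_nonneg u) (l2_nonneg w))

theorem mulVec_ne_zero (hA : A.rank = d) {x : Fin d → ℝ} (hx : x ≠ 0) : A *ᵥ x ≠ 0 := by
  have h1 := LinearMap.finrank_range_add_finrank_ker A.mulVecLin
  rw [Module.finrank_fin_fun, ← Matrix.rank, hA] at h1
  have h2 : LinearMap.ker A.mulVecLin = ⊥ := Submodule.finrank_eq_zero.1 (by omega)
  intro h
  exact hx (LinearMap.ker_eq_bot'.1 h2 x h)

/-- This keeps the sets that define Z₁ and Z₂ non-empty, which the bounds `le_Z₁` and `Z₂_le`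
require. -/
theorem exists_unit_range (hd : 0 < d) (hA : A.rank = d) :
    ∃ u ∈ LinearMap.range A.mulVecLin, l2 u = 1 := by
  have hx : (Pi.single ⟨0, hd⟩ 1 : Fin d → ℝ) ≠ 0 := by simp
  have hw := mulVec_ne_zero A hA hx
  obtain ⟨u, hu, hwu⟩ := exists_unit hw
  refine ⟨u, ?_, hu⟩
  rw [← Submodule.smul_mem_iff _ fun h => hw (l2_eq_zero.1 h), ← hwu]
  exact ⟨_, rfl⟩

theorem le_Z₁ (hd : 0 < d) (hA : A.rank = d) {a : ℝ}
    (h : ∀ w ∈ LinearMap.range A.mulVecLin, a * l2 w ^ 2 ≤ l2 (S *ᵥ w) ^ 2) : a ≤ Z₁ A S := by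
  obtain ⟨u, hu, hu1⟩ := exists_unit_range A hd hA
  refine le_csInf ⟨_, u, hu, hu1, rfl⟩ ?_
  rintro r ⟨v, hv, hv1, rfl⟩
  have := h v hv
  rwa [hv1, one_pow, mul_one] at this

/-- The form is symmetric, so polarization and the parallelogram law reduce the bilinear supremum to
diagonal values, which a comparison of norms can control. -/
theorem Z₂_le (hd : 0 < d) (hA : A.rank = d) {c : ℝ}
    (h : ∀ w ∈ LinearMap.range A.mulVecLin, |distortion S w w| ≤ c * l2 w ^ 2) :
    Z₂ A S ≤ c := by
  obtain ⟨u, hu, hu1⟩ := exists_unit_range A hd hA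
  refine csSup_le ⟨_, u, hu, u, hu, hu1, hu1, rfl⟩ ?_
  rintro r ⟨u, hu, v, hv, hu1, hv1, rfl⟩
  have h1 := abs_le.1 (h _ (Submodule.add_mem _ hu hv))
  have h2 := abs_le.1 (h _ (Submodule.sub_mem _ hu hv))
  have h3 := distortion_polarization S u v
  have h4 := l2_parallelogram u v
  rw [hu1, hv1] at h4
  have h5 : c * l2 (u + v) ^ 2 + c * l2 (u - v) ^ 2 = 4 * c := by rw [← mul_add, h4]; ring
  change distortion S u v ≤ c
  linarith

theorem Z₁_nonneg (hd : 0 < d) (hA : A.rank = d) : 0 ≤ Z₁ A S :=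
  le_Z₁ A S hd hA fun w _ => by rw [zero_mul]; positivity

theorem Z₂_nonneg (hd : 0 < d) (hA : A.rank = d) : 0 ≤ Z₂ A S := by
  obtain ⟨u, hu, hu1⟩ := exists_unit_range A hd hA
  have := (abs_nonneg _).trans (abs_distortion_le_Z₂ A S hu hu)
  rwa [hu1, mul_one, mul_one] at this

theorem Z₁_le_one_add_Z₂ (hd : 0 < d) (hA : A.rank = d) : Z₁ A S ≤ 1 + Z₂ A S := by
  obtain ⟨u, hu, hu1⟩ := exists_unit_range A hd hA
  have h1 := Z₁_mul_le A S hu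
  have h2 := (abs_le.1 (abs_distortion_le_Z₂ A S hu hu)).2
  rw [distortion_self] at h2
  rw [hu1] at h1 h2
  linarith

end geometry

/-! ### First-order conditions and the error of a sketched minimizer. -/

section optimality

variable {n d m : ℕ}

/-- The first-order optimality condition of a convex quadratic program. -/
theorem variational_inequality (B : Matrix (Fin m) (Fin d) ℝ) (g : Fin d → ℝ)
    {C : Set (Fin d → ℝ)} (hC : Convex ℝ C) {x y : Fin d → ℝ} (hx : x ∈ C) (hy : y ∈ C)
    (hmin : IsMinOn (fun z => 1 / 2 * l2 (B *ᵥ z) ^ 2 - g ⬝ᵥ z) C x) :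
    0 ≤ (B *ᵥ x) ⬝ᵥ (B *ᵥ (y - x)) - g ⬝ᵥ (y - x) := by
  set a := (B *ᵥ x) ⬝ᵥ (B *ᵥ (y - x)) - g ⬝ᵥ (y - x) with ha
  set q := 1 / 2 * l2 (B *ᵥ (y - x)) ^ 2 with hq
  have hq0 : 0 ≤ q := by positivity
  have key : ∀ t : ℝ, 0 ≤ t → t ≤ 1 → 0 ≤ t * a + t ^ 2 * q := by
    intro t ht0 ht1
    have hmem : x + t • (y - x) ∈ C := hC.add_smul_sub_mem hx hy ⟨ht0, ht1⟩
    have h := hmin hmem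
    simp only [Set.mem_ofPred_eq] at h
    have h1 : l2 (B *ᵥ (x + t • (y - x))) ^ 2 = l2 (B *ᵥ x) ^ 2 +
        2 * t * ((B *ᵥ x) ⬝ᵥ (B *ᵥ (y - x))) + t ^ 2 * l2 (B *ᵥ (y - x)) ^ 2 := by
      simp only [l2_sq, mulVec_add, mulVec_smul, dotProduct_add, add_dotProduct, dotProduct_smul,
        smul_dotProduct, smul_eq_mul]
      rw [dotProduct_comm (B *ᵥ (y - x)) (B *ᵥ x)]
      ring
    rw [h1, dotProduct_add, dotProduct_smul, smul_eq_mul] at h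
    rw [ha, hq]
    linarith
  by_contra hneg
  push Not at hneg
  have hqa : 0 < q - a := by linarith
  -- If a < 0, this t lies in [0, 1] even when q = 0, where the unconstrained minimizer -a / (2q)
  -- would be undefined. The value there is a³ / (q - a)², which is negative.
  have h := key (-a / (q - a)) (div_nonneg (by linarith) hqa.le) ((div_le_one hqa).2 (by linarith))
  have h2 : -a / (q - a) * a + (-a / (q - a)) ^ 2 * q = a ^ 3 / (q - a) ^ 2 := by
    field_simp
    ring
  rw [h2] at h
  have h3 : a ^ 3 / (q - a) ^ 2 < 0 := div_neg_of_neg_of_pos (by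
    have : a ^ 3 = a * a ^ 2 := by ring
    rw [this]
    have := hneg.ne
    exact mul_neg_of_neg_of_pos hneg (by positivity)) (by positivity)
  linarith

variable {A : Matrix (Fin n) (Fin d) ℝ} {b : Fin n → ℝ} {C : Set (Fin d → ℝ)}
  {S : Matrix (Fin m) (Fin n) ℝ} {xs xh : Fin d → ℝ}

/-- Half the squared residual differs from this objective by the constant ‖b‖²/2. In this form the
true problem has the same linear term as the sketched one. -/
theorem IsLeastSquares.isMinOn (h : IsLeastSquares A b C xs) :
    IsMinOn (fun z => 1 / 2 * l2 (A *ᵥ z) ^ 2 - (Aᵀ *ᵥ b) ⬝ᵥ z) C xs := by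
  have e : ∀ z, 1 / 2 * l2 (A *ᵥ z) ^ 2 - (Aᵀ *ᵥ b) ⬝ᵥ z =
      1 / 2 * l2 (A *ᵥ z - b) ^ 2 - 1 / 2 * l2 b ^ 2 := by
    intro z
    simp only [l2_sq, dotProduct_sub, sub_dotProduct]
    rw [mulVec_transpose, ← dotProduct_mulVec, dotProduct_comm (A *ᵥ z) b]
    ring
  intro z hz
  have h1 : l2 (A *ᵥ xs - b) ≤ l2 (A *ᵥ z - b) := h.2 hz
  simp only [Set.mem_ofPred_eq, e]
  have h2 := l2_nonneg (A *ᵥ xs - b)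
  have h3 : l2 (A *ᵥ xs - b) ^ 2 ≤ l2 (A *ᵥ z - b) ^ 2 := by gcongr
  linarith

/-- Each minimizer is tested against the other. In the sum of the two variational inequalities the
linear terms cancel, and b disappears. -/
theorem sketch_error_sq (hC : Convex ℝ C) (hs : IsLeastSquares A b C xs)
    (hh : IsSketchedSolution A b C S xh) :
    l2 (S *ᵥ (A *ᵥ (xh - xs))) ^ 2 ≤ -distortion S (A *ᵥ xs) (A *ᵥ (xh - xs)) := by
  have h1 := variational_inequality A _ hC hs.1 hh.1 hs.isMinOn
  have h2 := variational_inequality (S * A) _ hC hh.1 hs.1 hh.2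
  have e : xs - xh = -(xh - xs) := by abel
  have e2 : xh = xs + (xh - xs) := by abel
  set v := xh - xs with hv
  rw [e, e2] at h2
  simp only [← mulVec_mulVec, mulVec_neg, mulVec_add, dotProduct_neg, add_dotProduct] at h2
  rw [distortion_eq, l2_sq]
  linarith

/-- The quadratic bound has one factor ‖A(x̂ - x*)‖ too many on both sides; it is cancelled unless
it is zero. The constants are kept free, so that this serves both Z₁, Z₂ of the learned sketch and 1
- ε, ε of the random one. -/
theorem sketch_error (hC : Convex ℝ C) (hs : IsLeastSquares A b C xs)
    (hh : IsSketchedSolution A b C S xh) {a c : ℝ} (ha : 0 < a)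
    (h1 : ∀ w ∈ LinearMap.range A.mulVecLin, a * l2 w ^ 2 ≤ l2 (S *ᵥ w) ^ 2)
    (h2 : ∀ u ∈ LinearMap.range A.mulVecLin, ∀ w ∈ LinearMap.range A.mulVecLin,
      |distortion S u w| ≤ c * (l2 u * l2 w)) :
    l2 (A *ᵥ (xh - xs)) ≤ c / a * l2 (A *ᵥ xs) := by
  have hw : A *ᵥ (xh - xs) ∈ LinearMap.range A.mulVecLin := ⟨_, rfl⟩
  have hu : A *ᵥ xs ∈ LinearMap.range A.mulVecLin := ⟨_, rfl⟩
  have h3 := sketch_error_sq hC hs hh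
  have h4 := h1 _ hw
  have h5 := (abs_le.1 (h2 _ hu _ hw)).1
  rw [div_mul_eq_mul_div, le_div_iff₀ ha]
  rcases (l2_nonneg (A *ᵥ (xh - xs))).eq_or_lt with h0 | h0
  · rw [← h0, zero_mul]
    rcases (l2_nonneg (A *ᵥ xs)).eq_or_lt with h0' | h0'
    · rw [← h0', mul_zero]
    · have := (abs_nonneg _).trans (h2 _ hu _ hu)
      have h6 : 0 < l2 (A *ᵥ xs) * l2 (A *ᵥ xs) := mul_pos h0' h0'
      exact mul_nonneg (nonneg_of_mul_nonneg_left this h6) h0'.le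
  · refine le_of_mul_le_mul_right ?_ h0
    linarith

end optimality

/-! ### Why comparing the two Gram matrices selects the right sketch. -/

section decision

variable {n d m m' : ℕ} {A : Matrix (Fin n) (Fin d) ℝ} {S : Matrix (Fin m) (Fin n) ℝ}
  {T : Matrix (Fin m') (Fin n) ℝ} {ε : ℝ}

/-- T is within ε of an isometry and S within 3ε of T. Since (1 - 3ε)(1 - ε) ≥ 1 - 4ε and (1 + 3ε)(1
+ ε) ≤ 1 + 5ε, the sketch S is itself a good embedding. -/
theorem le_rate_of_pass (hd : 0 < d) (hA : A.rank = d) (hε : 0 < ε) (hε' : ε < 0.09)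
    (hT : ∀ u ∈ LinearMap.range A.mulVecLin, ∀ w ∈ LinearMap.range A.mulVecLin,
      |distortion T u w| ≤ ε * (l2 u * l2 w))
    (h1 : ∀ x, (1 - 3 * ε) * l2 ((T * A) *ᵥ x) ^ 2 ≤ l2 ((S * A) *ᵥ x) ^ 2)
    (h2 : ∀ x, l2 ((S * A) *ᵥ x) ^ 2 ≤ (1 + 3 * ε) * l2 ((T * A) *ᵥ x) ^ 2) :
    0 < Z₁ A S ∧ Z₂ A S / Z₁ A S ≤ 8 * rate A S ε := by
  have hlow : ∀ w ∈ LinearMap.range A.mulVecLin, (1 - 4 * ε) * l2 w ^ 2 ≤ l2 (S *ᵥ w) ^ 2 := by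
    rintro w ⟨x, rfl⟩
    have hw := (abs_le.1 (hT _ ⟨x, rfl⟩ _ ⟨x, rfl⟩)).1
    rw [distortion_self, ← pow_two] at hw
    have := h1 x
    rw [← mulVec_mulVec, ← mulVec_mulVec] at this
    rw [mulVecLin_apply] at hw ⊢
    have h3 : 0 ≤ l2 (A *ᵥ x) ^ 2 := sq_nonneg _
    have h4 : (1 - 3 * ε) * ((1 - ε) * l2 (A *ᵥ x) ^ 2) ≤
        (1 - 3 * ε) * l2 (T *ᵥ A *ᵥ x) ^ 2 :=
      mul_le_mul_of_nonneg_left (by linarith) (by linarith)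
    have h5 : 0 ≤ ε * ε * l2 (A *ᵥ x) ^ 2 := by positivity
    linarith
  have hup : ∀ w ∈ LinearMap.range A.mulVecLin, l2 (S *ᵥ w) ^ 2 ≤ (1 + 5 * ε) * l2 w ^ 2 := by
    rintro w ⟨x, rfl⟩
    have hw := (abs_le.1 (hT _ ⟨x, rfl⟩ _ ⟨x, rfl⟩)).2
    rw [distortion_self, ← pow_two] at hw
    have := h2 x
    rw [← mulVec_mulVec, ← mulVec_mulVec] at this
    rw [mulVecLin_apply] at hw ⊢
    have h3 : 0 ≤ l2 (A *ᵥ x) ^ 2 := sq_nonneg _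
    have h4 : (1 + 3 * ε) * l2 (T *ᵥ A *ᵥ x) ^ 2 ≤
        (1 + 3 * ε) * ((1 + ε) * l2 (A *ᵥ x) ^ 2) :=
      mul_le_mul_of_nonneg_left (by linarith) (by linarith)
    have h5 : 0 ≤ ε * (1 - 3 * ε) * l2 (A *ᵥ x) ^ 2 :=
      mul_nonneg (mul_nonneg hε.le (by linarith)) h3
    linarith
  have hZ1 : 1 - 4 * ε ≤ Z₁ A S := le_Z₁ A S hd hA hlow
  have hZ2 : Z₂ A S ≤ 5 * ε := by
    refine Z₂_le A S hd hA fun w hw => ?_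
    rw [distortion_self]
    have e1 := hlow w hw
    have e2 := hup w hw
    have e3 : 0 ≤ ε * l2 w ^ 2 := by positivity
    exact abs_le.2 ⟨by linarith, by linarith⟩
  have hZ2' := Z₂_nonneg A S hd hA
  have hpos : 0 < Z₁ A S := by linarith
  refine ⟨hpos, ?_⟩
  -- The inequality 5ε ≤ 8ε(1 - 4ε) amounts to ε ≤ 3/32, which is where the assumption ε < 0.09 fits
  -- in.
  have hq : Z₂ A S / Z₁ A S ≤ 8 * ε := by
    rw [div_le_iff₀ hpos]
    have : 8 * ε * (1 - 4 * ε) ≤ 8 * ε * Z₁ A S := mul_le_mul_of_nonneg_left hZ1 (by linarith)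
    have h3 : 0 ≤ ε * (0.09 - ε) := mul_nonneg hε.le (by linarith)
    linarith
  have hq0 : 0 ≤ Z₂ A S / Z₁ A S := div_nonneg hZ2' hpos.le
  rw [rate, if_neg hpos.ne']
  rcases min_choice (Z₂ A S / Z₁ A S) ε with h | h <;> rw [h] <;> linarith

/-- A vector on which S and T differ by 3ε is distorted by S by at least ε, because (1 - 3ε)(1 + ε)
≤ 1 - ε and (1 + 3ε)(1 - ε) ≥ 1 + ε. As t/(1 + t) is increasing, Z₂/Z₁ ≥ Z₂/(1 + Z₂) is then at
least ε/2. -/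
theorem le_rate_of_fail (hd : 0 < d) (hA : A.rank = d) (hε : 0 < ε) (hε' : ε < 0.09)
    (hT : ∀ u ∈ LinearMap.range A.mulVecLin, ∀ w ∈ LinearMap.range A.mulVecLin,
      |distortion T u w| ≤ ε * (l2 u * l2 w))
    (h : ∃ x : Fin d → ℝ, x ≠ 0 ∧ (l2 ((S * A) *ᵥ x) ^ 2 ≤ (1 - 3 * ε) * l2 ((T * A) *ᵥ x) ^ 2 ∨
      (1 + 3 * ε) * l2 ((T * A) *ᵥ x) ^ 2 ≤ l2 ((S * A) *ᵥ x) ^ 2)) :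
    ε ≤ 2 * rate A S ε := by
  obtain ⟨x, hx, h⟩ := h
  have hw0 := mulVec_ne_zero A hA hx
  have hmem : A *ᵥ x ∈ LinearMap.range A.mulVecLin := ⟨x, rfl⟩
  have hl : 0 < l2 (A *ᵥ x) ^ 2 :=
    pow_pos (lt_of_le_of_ne (l2_nonneg _) fun h => hw0 (l2_eq_zero.1 h.symm)) 2
  have hTx := abs_le.1 (hT _ hmem _ hmem)
  have hSx := abs_le.1 (abs_distortion_le_Z₂ A S hmem hmem)
  rw [distortion_self, ← pow_two] at hTx hSx
  rw [← mulVec_mulVec, ← mulVec_mulVec] at h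
  have hZ2 : ε ≤ Z₂ A S := by
    refine le_of_mul_le_mul_right ?_ hl
    have h5 : 0 ≤ ε * (1 - 3 * ε) * l2 (A *ᵥ x) ^ 2 :=
      mul_nonneg (mul_nonneg hε.le (by linarith)) hl.le
    have h6 : 0 ≤ ε * l2 (A *ᵥ x) ^ 2 := by positivity
    rcases h with h | h
    · have h4 : (1 - 3 * ε) * l2 (T *ᵥ A *ᵥ x) ^ 2 ≤
          (1 - 3 * ε) * ((1 + ε) * l2 (A *ᵥ x) ^ 2) :=
        mul_le_mul_of_nonneg_left (by linarith) (by linarith)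
      have h7 : 0 ≤ ε * ε * l2 (A *ᵥ x) ^ 2 := by positivity
      linarith
    · have h4 : (1 + 3 * ε) * ((1 - ε) * l2 (A *ᵥ x) ^ 2) ≤
          (1 + 3 * ε) * l2 (T *ᵥ A *ᵥ x) ^ 2 :=
        mul_le_mul_of_nonneg_left (by linarith) (by linarith)
      linarith
  rw [rate]
  split_ifs with h0
  · linarith
  · have hpos : 0 < Z₁ A S := lt_of_le_of_ne (Z₁_nonneg A S hd hA) (Ne.symm h0)
    have h1 := Z₁_le_one_add_Z₂ A S hd hA
    have hq : ε / 2 ≤ Z₂ A S / Z₁ A S := by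
      rw [le_div_iff₀ hpos]
      have h2 : ε / 2 * Z₁ A S ≤ ε / 2 * (1 + Z₂ A S) :=
        mul_le_mul_of_nonneg_left h1 (by linarith)
      have h3 : 0 ≤ Z₂ A S * (0.09 - ε) := mul_nonneg (by linarith) (by linarith)
      linarith
    rcases min_choice (Z₂ A S / Z₁ A S) ε with h | h <;> rw [h] <;> linarith

/-- Both ways of choosing the sketch give an error of the order of the rate. -/
theorem error_of_pass {b : Fin n → ℝ} {C : Set (Fin d → ℝ)} {xs xh : Fin d → ℝ}
    (hd : 0 < d) (hA : A.rank = d) (hε : 0 < ε) (hε' : ε < 0.09) (hC : Convex ℝ C)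
    (hT : ∀ u ∈ LinearMap.range A.mulVecLin, ∀ w ∈ LinearMap.range A.mulVecLin,
      |distortion T u w| ≤ ε * (l2 u * l2 w))
    (h1 : ∀ x, (1 - 3 * ε) * l2 ((T * A) *ᵥ x) ^ 2 ≤ l2 ((S * A) *ᵥ x) ^ 2)
    (h2 : ∀ x, l2 ((S * A) *ᵥ x) ^ 2 ≤ (1 + 3 * ε) * l2 ((T * A) *ᵥ x) ^ 2)
    (hs : IsLeastSquares A b C xs) (hh : IsSketchedSolution A b C S xh) :
    l2 (A *ᵥ (xh - xs)) ≤ 8 * rate A S ε * l2 (A *ᵥ xs) := by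
  obtain ⟨hpos, hq⟩ := le_rate_of_pass hd hA hε hε' hT h1 h2
  refine (sketch_error hC hs hh hpos (fun w hw => Z₁_mul_le A S hw)
    fun u hu w hw => abs_distortion_le_Z₂ A S hu hw).trans ?_
  exact mul_le_mul_of_nonneg_right hq (l2_nonneg _)

theorem error_of_fail {b : Fin n → ℝ} {C : Set (Fin d → ℝ)} {xs xh : Fin d → ℝ}
    (hd : 0 < d) (hA : A.rank = d) (hε : 0 < ε) (hε' : ε < 0.09) (hC : Convex ℝ C)
    (hT : ∀ u ∈ LinearMap.range A.mulVecLin, ∀ w ∈ LinearMap.range A.mulVecLin,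
      |distortion T u w| ≤ ε * (l2 u * l2 w))
    (h : ∃ x : Fin d → ℝ, x ≠ 0 ∧ (l2 ((S * A) *ᵥ x) ^ 2 ≤ (1 - 3 * ε) * l2 ((T * A) *ᵥ x) ^ 2 ∨
      (1 + 3 * ε) * l2 ((T * A) *ᵥ x) ^ 2 ≤ l2 ((S * A) *ᵥ x) ^ 2))
    (hs : IsLeastSquares A b C xs) (hh : IsSketchedSolution A b C T xh) :
    l2 (A *ᵥ (xh - xs)) ≤ 8 * rate A S ε * l2 (A *ᵥ xs) := by
  have hr := le_rate_of_fail hd hA hε hε' hT h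
  have h1 : ε / (1 - ε) ≤ 8 * rate A S ε := by
    rw [div_le_iff₀ (by linarith)]
    have h2 : ε ≤ rate A S ε * 2 := by linarith
    have h3 : 0 ≤ rate A S ε * (0.09 - ε) := mul_nonneg (by linarith) (by linarith)
    linarith
  refine (sketch_error hC hs hh (a := 1 - ε) (by linarith) (fun w hw => ?_) hT).trans
    (mul_le_mul_of_nonneg_right h1 (l2_nonneg _))
  have := (abs_le.1 (hT w hw w hw)).1
  rw [distortion_self, ← pow_two] at this
  linarith

end decision

/-! ### From an orthonormal basis to all of the column space. -/

section embedding

variable {n d m : ℕ}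

/-- Only unit length and Parseval's identity are extracted from an orthonormal basis; the later
arguments use nothing else. -/
theorem exists_orthonormal (A : Matrix (Fin n) (Fin d) ℝ) (hA : A.rank = d) :
    ∃ u : Fin d → Fin n → ℝ, (∀ a, u a ∈ LinearMap.range A.mulVecLin) ∧ (∀ a, l2 (u a) = 1) ∧
      ∀ w ∈ LinearMap.range A.mulVecLin, ∃ α : Fin d → ℝ, w = ∑ a, α a • u a ∧
        l2 w ^ 2 = ∑ a, α a ^ 2 := by
  let E := (WithLp.linearEquiv 2 ℝ (Fin n → ℝ)).symm
  let V : Submodule ℝ (EuclideanSpace ℝ (Fin n)) :=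
    (LinearMap.range A.mulVecLin).map E.toLinearMap
  have hV : Module.finrank ℝ V = d := by
    rw [LinearEquiv.finrank_map_eq, ← Matrix.rank, hA]
  let B := (stdOrthonormalBasis ℝ V).reindex (finCongr hV)
  refine ⟨fun a => E.symm (B a : EuclideanSpace ℝ (Fin n)), fun a => ?_, fun a => ?_, ?_⟩
  · obtain ⟨w, hw, hwa⟩ := (B a).2
    change E.symm (B a : EuclideanSpace ℝ (Fin n)) ∈ _
    rw [← hwa]
    simpa using hw
  · have := B.orthonormal.1 a
    exact this
  · intro w hw
    let v : V := ⟨E w, Submodule.mem_map_of_mem hw⟩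
    refine ⟨fun a => B.repr v a, ?_, ?_⟩
    · have h := congrArg (fun z : V => E.symm (z : EuclideanSpace ℝ (Fin n))) (B.sum_repr v)
      simp only [Submodule.coe_sum, Submodule.coe_smul, map_sum, map_smul] at h
      rw [h]
      exact (E.symm_apply_apply w).symm
    · have h : ‖B.repr v‖ = ‖v‖ := B.repr.norm_map v
      have h2 : l2 w = ‖v‖ := rfl
      rw [h2, ← h, EuclideanSpace.real_norm_sq_eq]

/-- The operator norm of the form is at most its Frobenius norm in an orthonormal basis, by
Cauchy-Schwarz over pairs of basis indices. -/
theorem abs_distortion_le_of_sum_sq {A : Matrix (Fin n) (Fin d) ℝ} {u : Fin d → Fin n → ℝ}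
    (hu : ∀ w ∈ LinearMap.range A.mulVecLin, ∃ α : Fin d → ℝ, w = ∑ a, α a • u a ∧
      l2 w ^ 2 = ∑ a, α a ^ 2)
    (S : Matrix (Fin m) (Fin n) ℝ) {ε : ℝ} (hε : 0 ≤ ε)
    (h : ∑ q : Fin d × Fin d, distortion S (u q.1) (u q.2) ^ 2 ≤ ε ^ 2)
    {x y : Fin n → ℝ} (hx : x ∈ LinearMap.range A.mulVecLin)
    (hy : y ∈ LinearMap.range A.mulVecLin) :
    |distortion S x y| ≤ ε * (l2 x * l2 y) := by
  obtain ⟨α, hα, hα2⟩ := hu x hx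
  obtain ⟨β, hβ, hβ2⟩ := hu y hy
  have h1 : distortion S x y =
      ∑ q : Fin d × Fin d, (α q.1 * β q.2) * distortion S (u q.1) (u q.2) := by
    rw [Fintype.sum_prod_type, distortion, hα, sum_dotProduct]
    refine Finset.sum_congr rfl fun a _ => ?_
    rw [hβ, mulVec_sum, dotProduct_sum]
    refine Finset.sum_congr rfl fun c _ => ?_
    rw [← distortion, distortion_smul]
  have h2 : distortion S x y ^ 2 ≤ (ε * (l2 x * l2 y)) ^ 2 := by
    rw [h1]
    refine (Finset.sum_mul_sq_le_sq_mul_sq _ _ _).trans ?_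
    have h3 : ∑ q : Fin d × Fin d, (α q.1 * β q.2) ^ 2 = l2 x ^ 2 * l2 y ^ 2 := by
      rw [hα2, hβ2, Finset.sum_mul_sum, Fintype.sum_prod_type]
      simp only [mul_pow]
    rw [h3, mul_pow, mul_pow, mul_comm]
    exact mul_le_mul_of_nonneg_right h (by positivity)
  exact abs_le_of_sq_le_sq h2 (mul_nonneg hε (mul_nonneg (l2_nonneg _) (l2_nonneg _)))

end embedding

end Sketch

/-! ### Programs for Gram matrices and for elimination. -/

namespace RealRAM

section projections

variable (s : State) (k x v a i j : ℕ) (u : ℝ)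

@[simp] theorem State.tick_nvar : (s.tick k).nvar = s.nvar := rfl
@[simp] theorem State.tick_rvar : (s.tick k).rvar = s.rvar := rfl
@[simp] theorem State.tick_narr : (s.tick k).narr = s.narr := rfl
@[simp] theorem State.tick_rarr : (s.tick k).rarr = s.rarr := rfl
@[simp] theorem State.setN_rvar : (s.setN x v).rvar = s.rvar := rfl
@[simp] theorem State.setN_narr : (s.setN x v).narr = s.narr := rfl
@[simp] theorem State.setN_rarr : (s.setN x v).rarr = s.rarr := rfl
@[simp] theorem State.setR_nvar : (s.setR x u).nvar = s.nvar := rfl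
@[simp] theorem State.setR_rarr : (s.setR x u).rarr = s.rarr := rfl
@[simp] theorem State.putN_nvar : (s.putN a i j v).nvar = s.nvar := rfl
@[simp] theorem State.putR_nvar : (s.putR a i j u).nvar = s.nvar := rfl
@[simp] theorem State.putR_rvar : (s.putR a i j u).rvar = s.rvar := rfl
@[simp] theorem State.putR_narr : (s.putR a i j u).narr = s.narr := rfl

@[simp] theorem State.setN_nvar (y : ℕ) :
    (s.setN x v).nvar y = if y = x then v else s.nvar y := by
  simp [State.setN, Function.update_apply]

@[simp] theorem State.setR_rvar (y : ℕ) :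
    (s.setR x u).rvar y = if y = x then u else s.rvar y := by
  simp [State.setR, Function.update_apply]

@[simp] theorem State.putN_narr_self (i' j' : ℕ) :
    (s.putN a i j v).narr a i' j' = if i' = i ∧ j' = j then v else s.narr a i' j' := by
  by_cases h : i' = i <;> simp [State.putN, Function.update_apply, h]

@[simp] theorem State.putR_rarr_self (i' j' : ℕ) :
    (s.putR a i j u).rarr a i' j' = if i' = i ∧ j' = j then u else s.rarr a i' j' := by
  by_cases h : i' = i <;> simp [State.putR, Function.update_apply, h]

theorem State.putN_narr_ne {b : ℕ} (h : b ≠ a) : (s.putN a i j v).narr b = s.narr b := by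
  simp [State.putN, h]

theorem State.putR_rarr_ne {b : ℕ} (h : b ≠ a) : (s.putR a i j u).rarr b = s.rarr b := by
  simp [State.putR, h]

end projections

/-- The invariant rule for loops of deterministic programs, with the frame condition built in. -/
theorem run_loop_frame (O : Solver) (x : ℕ) (e : NExp) (c : Cmd) (hc : c.IsDet) (s : State)
    (I : ℕ → State → Prop) (h0 : I 0 (s.tick (e.cost + 1)))
    (hstep : ∀ i < e.eval s, ∀ s', Frame (.loop x e c) s s' → I i s' →
      I (i + 1) (run O c ((s'.setN x i).tick 1))) :
    I (e.eval s) (run O (.loop x e c) s) := by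
  refine (run_loop_inv O x e c s (fun i t => Frame (.loop x e c) s t ∧ I i t)
    ⟨⟨fun _ _ => rfl, fun _ _ => rfl, fun _ _ => rfl, fun _ _ => rfl⟩, h0⟩ ?_).2
  rintro i hi s' ⟨hF, hI⟩
  refine ⟨?_, hstep i hi s' hF hI⟩
  have h := frame_run O c hc ((s'.setN x i).tick 1)
  constructor
  · intro y hy
    have hy' := hy
    simp only [Cmd.wN, List.mem_cons, not_or] at hy'
    rw [h.nvar y hy'.2, ← hF.nvar y hy]
    simp [hy'.1]
  · exact fun y hy => (h.rvar y hy).trans (hF.rvar y hy)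
  · exact fun y hy => (h.narr y hy).trans (hF.narr y hy)
  · exact fun y hy => (h.rarr y hy).trans (hF.rarr y hy)

/-- `a[i, j] := a[i, j] + e` -/
def accumulate (a : ℕ) (i j : NExp) (e : RExp) : Cmd := .rput a i j (.add (.get a i j) e)

/-- Add the Gram matrix of the `nvar y` rows of array `B`, of length `nvar 1`, to array `G`. -/
def gramRow (B G : ℕ) : Cmd :=
  .loop 7 (.var 1) (accumulate G (.var 6) (.var 7)
    (.mul (.get B (.var 5) (.var 6)) (.get B (.var 5) (.var 7))))

def gram (B G y : ℕ) : Cmd := .loop 5 (.var y) (.loop 6 (.var 1) (gramRow B G))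

theorem gramRow_spec (O : Solver) (B G : ℕ) (h : B ≠ G) (s : State) (i j : ℕ) :
    (run O (gramRow B G) s).rarr G i j =
      s.rarr G i j + if i = s.nvar 6 ∧ j < s.nvar 1 then
        s.rarr B (s.nvar 5) i * s.rarr B (s.nvar 5) j else 0 := by
  unfold gramRow
  refine run_loop_frame O _ _ _ (by exact trivial) s (fun l t => ∀ i j, t.rarr G i j =
    s.rarr G i j + if i = s.nvar 6 ∧ j < l then
        s.rarr B (s.nvar 5) i * s.rarr B (s.nvar 5) j else 0) ?_ ?_ i j
  · simp
  · intro l hl t hF hI i j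
    have h5 := hF.nvar 5 (by simp [Cmd.wN, accumulate])
    have h6 := hF.nvar 6 (by simp [Cmd.wN, accumulate])
    have hB := hF.rarr B (by simp [Cmd.wR, accumulate, h])
    simp only [accumulate, run, State.tick_rarr, State.putR_rarr_self, NExp.eval, RExp.eval,
      State.tick_nvar, State.setN_nvar, State.setN_rarr, hI, h5, h6, hB]
    by_cases hi : i = s.nvar 6
    · rcases lt_trichotomy j l with hj | hj | hj
      · simp [hi, hj.ne, hj, Nat.lt_succ_of_lt hj]
      · simp [hi, hj]
      · simp [hi, hj.ne', not_lt.2 hj.le, not_lt.2 (Nat.succ_le_of_lt hj)]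
    · simp [hi]

theorem gram_spec (O : Solver) (B G y : ℕ) (h : B ≠ G) (s : State) (i j : ℕ) :
    (run O (gram B G y) s).rarr G i j =
      s.rarr G i j + if i < s.nvar 1 ∧ j < s.nvar 1 then
        ∑ r ∈ Finset.range (s.nvar y), s.rarr B r i * s.rarr B r j else 0 := by
  unfold gram
  refine run_loop_frame O _ _ _ (by exact trivial) s (fun l t => ∀ i j, t.rarr G i j =
    s.rarr G i j + if i < s.nvar 1 ∧ j < s.nvar 1 then
      ∑ r ∈ Finset.range l, s.rarr B r i * s.rarr B r j else 0) ?_ ?_ i j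
  · simp
  · intro l hl t hF hI i j
    have h1 := hF.nvar 1 (by simp [Cmd.wN, accumulate, gramRow])
    have hB := hF.rarr B (by simp [Cmd.wR, accumulate, gramRow, h])
    have key : ∀ t' : State, t'.nvar 1 = s.nvar 1 → t'.nvar 5 = l → t'.rarr B = s.rarr B →
        ∀ i j, (run O (.loop 6 (.var 1) (gramRow B G)) t').rarr G i j = t'.rarr G i j +
          if i < s.nvar 1 ∧ j < s.nvar 1 then s.rarr B l i * s.rarr B l j else 0 := by
      intro t' h1' h5' hB' i j
      rw [← h1']
      refine run_loop_frame O _ _ _ (by exact trivial) t' (fun q u => ∀ i j, u.rarr G i j =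
        t'.rarr G i j + if i < q ∧ j < t'.nvar 1 then s.rarr B l i * s.rarr B l j else 0)
        ?_ ?_ i j
      · simp
      · intro q hq u hFu hIu i j
        have h1u := hFu.nvar 1 (by simp [Cmd.wN, accumulate, gramRow])
        have h5u := hFu.nvar 5 (by simp [Cmd.wN, accumulate, gramRow])
        have hBu := hFu.rarr B (by simp [Cmd.wR, accumulate, gramRow, h])
        rw [gramRow_spec O B G h]
        simp only [State.tick_rarr, State.tick_nvar, State.setN_nvar, State.setN_rarr, hIu, h1u,
          h5u, hBu, hB', h5']
        rcases lt_trichotomy i q with hi | hi | hi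
        · simp [hi.ne, hi, Nat.lt_succ_of_lt hi]
        · simp [hi]
        · simp [hi.ne', not_lt.2 hi.le, not_lt.2 (Nat.succ_le_of_lt hi)]
    rw [key _ (by simpa using h1) (by simp) (by simpa using hB)]
    simp only [State.tick_rarr, State.setN_rarr, hI, Finset.sum_range_succ]
    split_ifs <;> ring

/-- One row operation of Gauss-Jordan elimination: subtract `rvar 1` times row `nvar 5` from row
`nvar 6` in array `T`. -/
def rowOp (T : ℕ) : Cmd :=
  .loop 7 (.var 1) (.rput T (.var 6) (.var 7) (.sub (.get T (.var 6) (.var 7))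
    (.mul (.var 1) (.get T (.var 5) (.var 7)))))

/-- Eliminate column `nvar 5` from row `nvar 6` of array `T`, unless the two indices are equal. -/
def elimRow (T R : ℕ) : Cmd :=
  .ite (.and (.not (.nlt (.var 5) (.var 6))) (.not (.nlt (.var 6) (.var 5))))
    .skip
    -- The multiplier is saved in a variable, because the row operation overwrites the entry from
    -- which it is computed.
    (.seq (.rset 1 (.div (.get T (.var 6) (.var 5)) (.get T (.var 5) (.var 5))))
      (.seq (rowOp T)
        (.rput R (.var 6) (.lit 0) (.sub (.get R (.var 6) (.lit 0))
          (.mul (.var 1) (.get R (.var 5) (.lit 0)))))))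

/-- One round of Gauss-Jordan elimination, with pivot `nvar 5`, of array `T`, with right-hand side
in column `0` of array `R`. -/
def elimRound (T R : ℕ) : Cmd := .loop 6 (.var 1) (elimRow T R)

/-- Clear integer variable `11` if the pivot is not positive. -/
def pivotTest (T : ℕ) : Cmd :=
  .ite (.rlt (.lit 0) (.get T (.var 5) (.var 5))) .skip (.nset 11 (.lit 0))

/-- Gauss-Jordan elimination; integer variable `11` becomes `1` if all pivots are positive, and
`0` otherwise. -/
def gaussJordan (T R : ℕ) : Cmd :=
  .seq (.nset 11 (.lit 1)) (.loop 5 (.var 1) (.seq (pivotTest T) (elimRound T R)))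

theorem rowOp_spec (O : Solver) (T : ℕ) (s : State) (hne : s.nvar 6 ≠ s.nvar 5) (i j : ℕ) :
    (run O (rowOp T) s).rarr T i j =
      if i = s.nvar 6 ∧ j < s.nvar 1 then s.rarr T i j - s.rvar 1 * s.rarr T (s.nvar 5) j
        else s.rarr T i j := by
  unfold rowOp
  refine run_loop_frame O _ _ _ (by exact trivial) s (fun l t => ∀ i j, t.rarr T i j =
    if i = s.nvar 6 ∧ j < l then s.rarr T i j - s.rvar 1 * s.rarr T (s.nvar 5) j
        else s.rarr T i j) ?_ ?_ i j
  · simp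
  · intro l hl t hF hI i j
    have h5 := hF.nvar 5 (by simp [Cmd.wN])
    have h6 := hF.nvar 6 (by simp [Cmd.wN])
    have hv := hF.rvar 1 (by simp [Cmd.wV])
    simp only [run, State.tick_rarr, State.putR_rarr_self, NExp.eval, RExp.eval,
      State.tick_nvar, State.setN_nvar, State.setN_rarr, State.tick_rvar, State.setN_rvar,
      hI, h5, h6, hv]
    by_cases hi : i = s.nvar 6
    · rcases lt_trichotomy j l with hj | hj | hj
      · simp [hi, hj.ne, hj, Nat.lt_succ_of_lt hj]
      · simp [hi, hj, Ne.symm hne]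
      · simp [hi, hj.ne', not_lt.2 hj.le, not_lt.2 (Nat.succ_le_of_lt hj)]
    · simp [hi]

theorem rowOp_isDet (T : ℕ) : (rowOp T).IsDet := trivial

theorem elimRow_isDet (T R : ℕ) : (elimRow T R).IsDet := by
  simp [elimRow, rowOp, Cmd.IsDet]

theorem elimRound_isDet (T R : ℕ) : (elimRound T R).IsDet := elimRow_isDet T R

theorem pivotTest_isDet (T : ℕ) : (pivotTest T).IsDet := by
  simp [pivotTest, Cmd.IsDet]

theorem gaussJordan_isDet (T R : ℕ) : (gaussJordan T R).IsDet := by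
  simp [gaussJordan, elimRound_isDet, pivotTest_isDet, Cmd.IsDet]

-- Working in place agrees with the simultaneous update `step`: the pivot row is untouched during
-- its round, and every other row changes only in its own iteration.
open GaussJordan in
theorem elimRound_spec (O : Solver) (T R : ℕ) (hTR : T ≠ R) (s : State) :
    (run O (elimRound T R) s).rarr T = step (s.nvar 1) (s.nvar 5) (s.rarr T) ∧
      ∀ i, (run O (elimRound T R) s).rarr R i 0 =
        stepRhs (s.nvar 1) (s.nvar 5) (s.rarr T) (fun i => s.rarr R i 0) i := by
  set k := s.nvar 5 with hk
  set d := s.nvar 1 with hd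
  have key := run_loop_frame O 6 (.var 1) _ (elimRow_isDet T R) s (fun l t =>
    (∀ i j, t.rarr T i j = if i ≠ k ∧ i < l ∧ j < d then
      s.rarr T i j - s.rarr T i k / s.rarr T k k * s.rarr T k j else s.rarr T i j) ∧
    ∀ i, t.rarr R i 0 = if i ≠ k ∧ i < l then
      s.rarr R i 0 - s.rarr T i k / s.rarr T k k * s.rarr R k 0 else s.rarr R i 0) (by simp) (by
    rintro l hl t hF ⟨hI1, hI2⟩
    have h5 := hF.nvar 5 (by simp [Cmd.wN, elimRow, rowOp])
    have h1 := hF.nvar 1 (by simp [Cmd.wN, elimRow, rowOp])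
    simp only [elimRow, run]
    by_cases hlk : l = k
    · rw [if_pos (by simp [BExp.eval, NExp.eval, h5, hlk, ← hk])]
      simp only [State.tick_rarr, State.setN_rarr]
      constructor
      · intro i j
        rw [hI1]
        congr 1
        simp only [eq_iff_iff]
        constructor
        · rintro ⟨h1, h2, h3⟩; exact ⟨h1, by omega, h3⟩
        · rintro ⟨h1, h2, h3⟩; exact ⟨h1, by omega, h3⟩
      · intro i
        rw [hI2]
        congr 1
        simp only [eq_iff_iff]
        constructor
        · rintro ⟨h1, h2⟩; exact ⟨h1, by omega⟩
        · rintro ⟨h1, h2⟩; exact ⟨h1, by omega⟩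
    · rw [if_neg (by simp [BExp.eval, NExp.eval, h5, ← hk]; omega)]
      set u := ((t.setN 6 l).tick 1).tick (BExp.cost (.and (.not (.nlt (.var 5) (.var 6)))
        (.not (.nlt (.var 6) (.var 5)))) + 1) with hu
      set u' := (u.setR 1 (RExp.eval u (.div (.get T (.var 6) (.var 5))
        (.get T (.var 5) (.var 5))))).tick
          (RExp.cost (.div (.get T (.var 6) (.var 5)) (.get T (.var 5) (.var 5))) + 1) with hu'
      have e5 : u'.nvar 5 = k := by simp [hu', hu, h5, ← hk]
      have e6 : u'.nvar 6 = l := by simp [hu', hu]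
      have e1 : u'.nvar 1 = d := by simp [hu', hu, h1, ← hd]
      have eA : u'.rarr = t.rarr := by simp [hu', hu]
      have ev : u'.rvar 1 = s.rarr T l k / s.rarr T k k := by
        simp [hu', hu, RExp.eval, NExp.eval, h5, ← hk, hI1]
      have hF' := frame_run O (rowOp T) (rowOp_isDet T) u'
      have f5 := hF'.nvar 5 (by simp [Cmd.wN, rowOp])
      have f6 := hF'.nvar 6 (by simp [Cmd.wN, rowOp])
      have fv := hF'.rvar 1 (by simp [Cmd.wV, rowOp])
      have fR := hF'.rarr R (by simp [Cmd.wR, rowOp, Ne.symm hTR])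
      have hT := rowOp_spec O T u' (by rw [e5, e6]; exact hlk)
      constructor
      · intro i j
        rw [State.tick_rarr, State.putR_rarr_ne _ _ _ _ _ hTR, hT, e6, e1, ev, e5, eA, hI1, hI1]
        by_cases hi : i = l
        · subst hi
          simp [hlk]
        · have : i < l + 1 ↔ i < l := by omega
          simp [hi, this]
      · intro i
        simp only [State.tick_rarr, State.putR_rarr_self, NExp.eval, RExp.eval, f6, f5, fv, fR,
          e6, e5, ev, eA, hI2]
        by_cases hi : i = l
        · subst hi
          simp [hlk]
        · have : i < l + 1 ↔ i < l := by omega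
          simp [hi, this])
  refine ⟨?_, ?_⟩
  · funext i j
    exact key.1 i j
  · intro i
    exact key.2 i

open GaussJordan in
theorem gaussJordan_spec (O : Solver) (T R : ℕ) (hTR : T ≠ R) (s : State) :
    (run O (gaussJordan T R) s).rarr T = mat (s.nvar 1) (s.rarr T) (s.nvar 1) ∧
      (∀ i, (run O (gaussJordan T R) s).rarr R i 0 =
        rhs (s.nvar 1) (s.rarr T) (fun i => s.rarr R i 0) (s.nvar 1) i) ∧
      (0 < (run O (gaussJordan T R) s).nvar 11 ↔
        ∀ k < s.nvar 1, 0 < mat (s.nvar 1) (s.rarr T) k k k) := by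
  set d := s.nvar 1 with hd
  have key := run_loop_frame O 5 (.var 1) (.seq (pivotTest T) (elimRound T R))
    ⟨pivotTest_isDet T, elimRound_isDet T R⟩
    ((s.setN 11 1).tick 2) (fun l t => t.rarr T = mat d (s.rarr T) l ∧
      (∀ i, t.rarr R i 0 = rhs d (s.rarr T) (fun i => s.rarr R i 0) l i) ∧
      (0 < t.nvar 11 ↔ ∀ k < l, 0 < mat d (s.rarr T) k k k)) (by simp [mat, rhs]) (by
    rintro l hl t hF ⟨hI1, hI2, hI3⟩
    have h1 : t.nvar 1 = d := by
      rw [hF.nvar 1 (by simp [Cmd.wN, pivotTest, rowOp, elimRow, elimRound])]; simp [← hd]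
    set u := run O (pivotTest T) ((t.setN 5 l).tick 1) with hu
    have hFu := frame_run O (pivotTest T) (pivotTest_isDet T) ((t.setN 5 l).tick 1)
    have uA : ∀ a, u.rarr a = t.rarr a := fun a => hFu.rarr a (by simp [Cmd.wR, pivotTest])
    have u1 : u.nvar 1 = d := (hFu.nvar 1 (by simp [Cmd.wN, pivotTest])).trans (by simp [h1])
    have u5 : u.nvar 5 = l := (hFu.nvar 5 (by simp [Cmd.wN, pivotTest])).trans (by simp)
    have u11 : 0 < u.nvar 11 ↔ 0 < t.nvar 11 ∧ 0 < t.rarr T l l := by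
      rw [hu]
      simp only [pivotTest, run, BExp.eval, RExp.eval, NExp.eval, State.tick_rarr,
        State.setN_rarr, State.tick_nvar, State.setN_nvar, if_true]
      split_ifs with hp <;> simp at hp <;> simp [hp]
    have hF' := frame_run O (elimRound T R) (elimRound_isDet T R) u
    obtain ⟨g1, g2⟩ := elimRound_spec O T R hTR u
    rw [run, ← hu]
    refine ⟨?_, ?_, ?_⟩
    · rw [g1, u1, u5, uA, hI1, mat]
    · intro i
      rw [g2, u1, u5, uA, uA, hI1, rhs]
      congr 1
      funext i
      exact hI2 i
    · rw [hF'.nvar 11 (by simp [Cmd.wN, rowOp, elimRow, elimRound]), Nat.forall_lt_succ_right,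
        ← hI3, u11, hI1])
  exact key

end RealRAM

/-! ### Drawing hashes, sketching, and the matrices of the test. -/

namespace RealRAM

/-- The type of the draw depends on the state. Naming the bound gives all rounds of a loop the same
sample space. -/
theorem exec_rand (O : Solver) (x : ℕ) (e : NExp) (s : State) (M : ℕ) (h : e.eval s = M) :
    exec O (.rand x e) s = (PMF.uniformOfFintype (Fin (M - 1 + 1))).map
      (fun i : Fin (M - 1 + 1) => (s.setN x i.val).tick (e.cost + 1)) := by
  subst h
  rfl

/-- Draw a hash value and a sign for every non-zero entry, coded as one number below
`2 * nvar 4`, and store it for the row of the entry, in column `0` of integer array `2`. -/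
def drawHashes : Cmd :=
  .loop 5 (.var 2) (.seq (.rand 6 (.add (.var 4) (.var 4)))
    (.nput 2 (.get 0 (.var 5) (.lit 0)) (.lit 0) (.var 6)))

/-- One draw is made per non-zero entry, so a row may be drawn for repeatedly. The last draw
overwrites the others, hence distinct non-zero rows end up with distinct coordinates of `w`, that
is, with independent hashes. Rows without entries keep their initial value. -/
theorem drawHashes_spec (O : Solver) (s : State) (N M : ℕ) (hN : s.nvar 2 = N)
    (hM : s.nvar 4 + s.nvar 4 = M) :
    ∃ W : (Fin N → Fin (M - 1 + 1)) → State,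
      exec O drawHashes s = (PMF.uniformOfFintype (Fin N → Fin (M - 1 + 1))).map W ∧
      ∀ w, Frame drawHashes s (W w) ∧ ∀ i,
        (∀ l (hl : l < N), s.narr 0 l 0 = i → (∀ l' < N, l < l' → s.narr 0 l' 0 ≠ i) →
          (W w).narr 2 i 0 = w ⟨l, hl⟩) ∧
        ((∀ l < N, s.narr 0 l 0 ≠ i) → (W w).narr 2 i 0 = s.narr 2 i 0) := by
  subst hN
  let c : Cmd := .nput 2 (.get 0 (.var 5) (.lit 0)) (.lit 0) (.var 6)
  let f : ℕ → Fin (M - 1 + 1) → State → State := fun i a t =>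
    run O c ((((t.setN 5 i).tick 1).setN 6 a).tick ((NExp.add (.var 4) (.var 4)).cost + 1))
  have hf2 : ∀ i a t j, (f i a t).narr 2 j 0 = if j = t.narr 0 i 0 then a.val else
      t.narr 2 j 0 := by
    intro i a t j
    simp [f, c, run, NExp.eval]
  have hf0 : ∀ i a t, (f i a t).narr 0 = t.narr 0 := by
    intro i a t
    simp only [f, c, run, State.tick_narr]
    rw [State.putN_narr_ne _ _ _ _ _ (by decide)]
    simp
  have hf4 : ∀ i a t, (f i a t).nvar 4 = t.nvar 4 := by
    intro i a t
    simp [f, c, run]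
  have hexec : exec O drawHashes s = (PMF.uniformOfFintype _).map _ :=
    forLoop_rand (α := Fin (M - 1 + 1)) (s.nvar 2) _ f (fun t => t.nvar 4 = s.nvar 4)
      (s.tick ((NExp.var 2).cost + 1)) rfl (fun i a t ht => (hf4 i a t).trans ht) (by
        intro i t ht
        rw [exec, exec_rand O 6 _ _ M (by simp [NExp.eval, ht, hM]), PMF.bind_map]
        rfl)
  refine ⟨_, hexec, fun w => ⟨?_, ?_⟩⟩
  · apply frame_exec O drawHashes s
    rw [hexec, PMF.support_map]
    exact ⟨w, by simp, rfl⟩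
  · have key := iter_inv (fun i s' => if h : i < s.nvar 2 then f i (w ⟨i, h⟩) s' else s')
      (fun k t => t.narr 0 = s.narr 0 ∧ ∀ i,
      (∀ l (hl : l < s.nvar 2), l < k → s.narr 0 l 0 = i →
        (∀ l' < k, l < l' → s.narr 0 l' 0 ≠ i) → t.narr 2 i 0 = w ⟨l, hl⟩) ∧
      ((∀ l < k, s.narr 0 l 0 ≠ i) → t.narr 2 i 0 = s.narr 2 i 0)) (s.nvar 2)
      (s.tick ((NExp.var 2).cost + 1)) (by simp) (by
      rintro k hk t ⟨h0, hI⟩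
      simp only [hk, dite_true]
      refine ⟨(hf0 _ _ _).trans h0, fun i => ⟨?_, ?_⟩⟩
      · intro l hl hlk hli hlast
        rw [hf2, h0]
        rcases Nat.lt_succ_iff_lt_or_eq.1 hlk with hlk | rfl
        · rw [if_neg (Ne.symm (hlast k k.lt_succ_self hlk))]
          exact (hI i).1 l hl hlk hli fun l' hl' => hlast l' (Nat.lt_succ_of_lt hl')
        · rw [if_pos hli.symm]
      · intro hne
        rw [hf2, h0, if_neg (Ne.symm (hne k k.lt_succ_self))]
        exact (hI i).2 fun l hl => hne l (Nat.lt_succ_of_lt hl))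
    exact fun i => ⟨fun l hl => (key.2 i).1 l hl hl, (key.2 i).2⟩

/-- The row of the entry number `nvar 5`. -/
def rowE : NExp := .get 0 (.var 5) (.lit 0)

/-- The column of the entry number `nvar 5`. -/
def colE : NExp := .get 0 (.var 5) (.lit 1)

/-- The value of the entry number `nvar 5`. -/
def valE : RExp := .get 0 (.var 5) (.lit 0)

/-- The draw for the row of the entry number `nvar 5`. -/
def drawE : NExp := .get 2 rowE (.lit 0)

/-- Accumulate the learned sketch of the matrix in array `4`, its random sketch in array `5`, and
`Aᵀ b` in array `6`. -/
def scatter : Cmd :=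
  .loop 5 (.var 2)
    (.seq (accumulate 4 (.get 1 rowE (.lit 0)) colE (.mul (.get 2 rowE (.lit 0)) valE))
      (.seq (.ite (.nlt drawE (.var 4)) (accumulate 5 drawE colE valE)
          (accumulate 5 (.sub drawE (.var 4)) colE (.sub (.lit 0) valE)))
        (accumulate 6 colE (.lit 0) (.mul valE (.get 1 rowE (.lit 0))))))

theorem scatter_isDet : scatter.IsDet := by
  simp [scatter, accumulate, Cmd.IsDet]

/-- The hash value coded by the number `D`. -/
def decode (m D : ℕ) : ℕ := if D < m then D else D - m

/-- The sign coded by the number `D`. -/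
noncomputable def sign (m D : ℕ) : ℝ := if D < m then 1 else -1

theorem scatter_spec (O : Solver) (s : State) :
    (∀ i j, (run O scatter s).rarr 4 i j = s.rarr 4 i j + ∑ k ∈ Finset.range (s.nvar 2),
      if i = s.narr 1 (s.narr 0 k 0) 0 ∧ j = s.narr 0 k 1 then
        s.rarr 2 (s.narr 0 k 0) 0 * s.rarr 0 k 0 else 0) ∧
    (∀ i j, (run O scatter s).rarr 5 i j = s.rarr 5 i j + ∑ k ∈ Finset.range (s.nvar 2),
      if i = decode (s.nvar 4) (s.narr 2 (s.narr 0 k 0) 0) ∧ j = s.narr 0 k 1 then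
        sign (s.nvar 4) (s.narr 2 (s.narr 0 k 0) 0) * s.rarr 0 k 0 else 0) ∧
    (∀ j, (run O scatter s).rarr 6 j 0 = s.rarr 6 j 0 + ∑ k ∈ Finset.range (s.nvar 2),
      if j = s.narr 0 k 1 then s.rarr 0 k 0 * s.rarr 1 (s.narr 0 k 0) 0 else 0) := by
  refine run_loop_frame O 5 (.var 2) _ (by simp [accumulate, Cmd.IsDet]) s (fun l t =>
    (∀ i j, t.rarr 4 i j = s.rarr 4 i j + ∑ k ∈ Finset.range l,
      if i = s.narr 1 (s.narr 0 k 0) 0 ∧ j = s.narr 0 k 1 then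
        s.rarr 2 (s.narr 0 k 0) 0 * s.rarr 0 k 0 else 0) ∧
    (∀ i j, t.rarr 5 i j = s.rarr 5 i j + ∑ k ∈ Finset.range l,
      if i = decode (s.nvar 4) (s.narr 2 (s.narr 0 k 0) 0) ∧ j = s.narr 0 k 1 then
        sign (s.nvar 4) (s.narr 2 (s.narr 0 k 0) 0) * s.rarr 0 k 0 else 0) ∧
    (∀ j, t.rarr 6 j 0 = s.rarr 6 j 0 + ∑ k ∈ Finset.range l,
      if j = s.narr 0 k 1 then s.rarr 0 k 0 * s.rarr 1 (s.narr 0 k 0) 0 else 0)) (by simp) ?_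
  rintro l hl t hF ⟨hI4, hI5, hI6⟩
  have h4 := hF.nvar 4 (by simp [Cmd.wN, accumulate])
  have n0 := hF.narr 0 (by simp [Cmd.wA, accumulate])
  have n1 := hF.narr 1 (by simp [Cmd.wA, accumulate])
  have n2 := hF.narr 2 (by simp [Cmd.wA, accumulate])
  have r0 := hF.rarr 0 (by simp [Cmd.wR, accumulate])
  have r1 := hF.rarr 1 (by simp [Cmd.wR, accumulate])
  have r2 := hF.rarr 2 (by simp [Cmd.wR, accumulate])
  have ne : ∀ (u : State) (a b i j : ℕ) (x : ℝ), b ≠ a → (u.putR a i j x).rarr b = u.rarr b :=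
    fun u a b i j x h => State.putR_rarr_ne _ _ _ _ _ h
  simp only [run, accumulate, BExp.eval, NExp.eval, RExp.eval, rowE, colE, valE, drawE,
    State.tick_nvar, State.putR_nvar, State.setN_nvar, State.tick_narr, State.putR_narr,
    State.setN_narr, if_true, n0, n1, n2, h4, Nat.reduceEqDiff, if_false]
  refine ⟨fun i j => ?_, fun i j => ?_, fun j => ?_⟩
  · rw [Finset.sum_range_succ, ← add_assoc, ← hI4]
    split_ifs <;>
      simp only [State.tick_rarr, ne _ 6 4 _ _ _ (by decide), ne _ 5 4 _ _ _ (by decide),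
        State.putR_rarr_self, State.setN_rarr, *] <;>
      simp_all
  · rw [Finset.sum_range_succ, ← add_assoc, ← hI5]
    by_cases hD : s.narr 2 (s.narr 0 l 0) 0 < s.nvar 4
    · simp only [decode, sign, hD, if_true, State.tick_rarr, ne _ 6 5 _ _ _ (by decide),
        ne _ 4 5 _ _ _ (by decide), State.putR_rarr_self, State.setN_rarr,
        ne _ 4 0 _ _ _ (by decide), r0]
      split_ifs with h <;> simp_all
    · simp only [decode, sign, hD, if_false, State.tick_rarr, ne _ 6 5 _ _ _ (by decide),
        ne _ 4 5 _ _ _ (by decide), State.putR_rarr_self, State.setN_rarr,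
        ne _ 4 0 _ _ _ (by decide), r0]
      split_ifs with h <;> simp_all
  · rw [Finset.sum_range_succ, ← add_assoc, ← hI6]
    split_ifs <;>
      simp only [State.tick_rarr, ne _ 5 6 _ _ _ (by decide), ne _ 4 6 _ _ _ (by decide),
        ne _ 5 0 _ _ _ (by decide), ne _ 4 0 _ _ _ (by decide), ne _ 5 1 _ _ _ (by decide),
        ne _ 4 1 _ _ _ (by decide),
        State.putR_rarr_self, State.setN_rarr, r0, r1] <;>
      split_ifs <;> simp_all

/-- Store `G₁ - (1 - 3 ε) G₂` in array `9` and `(1 + 3 ε) G₂ - G₁` in array `10`, where `G₁`, `G₂`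
are arrays `7`, `8` and `ε` is real variable `0`. -/
def testRow : Cmd :=
  .loop 6 (.var 1)
    (.seq (.rput 9 (.var 5) (.var 6) (.sub (.get 7 (.var 5) (.var 6))
        (.mul (.sub (.lit 1) (.mul (.lit 3) (.var 0))) (.get 8 (.var 5) (.var 6)))))
      (.rput 10 (.var 5) (.var 6) (.sub
        (.mul (.add (.lit 1) (.mul (.lit 3) (.var 0))) (.get 8 (.var 5) (.var 6)))
          (.get 7 (.var 5) (.var 6)))))

def testMatrices : Cmd := .loop 5 (.var 1) testRow

theorem testRow_spec (O : Solver) (s : State) (i j : ℕ) :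
    (run O testRow s).rarr 9 i j = (if i = s.nvar 5 ∧ j < s.nvar 1 then
      s.rarr 7 i j - (1 - 3 * s.rvar 0) * s.rarr 8 i j else s.rarr 9 i j) ∧
    (run O testRow s).rarr 10 i j = (if i = s.nvar 5 ∧ j < s.nvar 1 then
      (1 + 3 * s.rvar 0) * s.rarr 8 i j - s.rarr 7 i j else s.rarr 10 i j) := by
  refine run_loop_frame O 6 (.var 1) _ (by simp [Cmd.IsDet]) s (fun l t => ∀ i j,
    t.rarr 9 i j = (if i = s.nvar 5 ∧ j < l then
      s.rarr 7 i j - (1 - 3 * s.rvar 0) * s.rarr 8 i j else s.rarr 9 i j) ∧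
    t.rarr 10 i j = (if i = s.nvar 5 ∧ j < l then
      (1 + 3 * s.rvar 0) * s.rarr 8 i j - s.rarr 7 i j else s.rarr 10 i j)) (by simp) ?_ i j
  intro l hl t hF hI i j
  have h5 := hF.nvar 5 (by simp [Cmd.wN])
  have hv := hF.rvar 0 (by simp [Cmd.wV])
  have r7 := hF.rarr 7 (by simp [Cmd.wR])
  have r8 := hF.rarr 8 (by simp [Cmd.wR])
  have ne : ∀ (u : State) (a b i j : ℕ) (x : ℝ), b ≠ a → (u.putR a i j x).rarr b = u.rarr b :=
    fun u a b i j x h => State.putR_rarr_ne _ _ _ _ _ h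
  obtain ⟨hI9, hI10⟩ := hI i j
  simp only [run, NExp.eval, RExp.eval, State.tick_nvar, State.putR_nvar, State.setN_nvar,
    State.tick_rvar, State.putR_rvar, State.setN_rvar, State.tick_rarr, State.setN_rarr,
    State.putR_rarr_self, ne _ 10 9 _ _ _ (by decide), ne _ 9 10 _ _ _ (by decide),
    ne _ 9 8 _ _ _ (by decide), ne _ 9 7 _ _ _ (by decide), if_true, Nat.reduceEqDiff, if_false,
    h5, hv, r7, r8, hI9, hI10]
  by_cases hi : i = s.nvar 5
  · rcases lt_trichotomy j l with hj | hj | hj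
    · simp [hi, hj.ne, hj, Nat.lt_succ_of_lt hj]
    · simp [hi, hj]
    · simp [hi, hj.ne', not_lt.2 hj.le, not_lt.2 (Nat.succ_le_of_lt hj)]
  · simp [hi]

theorem testRow_isDet : testRow.IsDet := by simp [testRow, Cmd.IsDet]

theorem testMatrices_spec (O : Solver) (s : State) (i j : ℕ) (hi : i < s.nvar 1)
    (hj : j < s.nvar 1) :
    (run O testMatrices s).rarr 9 i j = s.rarr 7 i j - (1 - 3 * s.rvar 0) * s.rarr 8 i j ∧
    (run O testMatrices s).rarr 10 i j = (1 + 3 * s.rvar 0) * s.rarr 8 i j - s.rarr 7 i j := by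
  refine run_loop_frame O 5 (.var 1) _ testRow_isDet s (fun l t => ∀ i < l, ∀ j < s.nvar 1,
    t.rarr 9 i j = s.rarr 7 i j - (1 - 3 * s.rvar 0) * s.rarr 8 i j ∧
    t.rarr 10 i j = (1 + 3 * s.rvar 0) * s.rarr 8 i j - s.rarr 7 i j) (by simp) ?_ i hi j hj
  intro l hl t hF hI i hi j hj
  have h1 := hF.nvar 1 (by simp [Cmd.wN, testRow])
  have hv := hF.rvar 0 (by simp [Cmd.wV, testRow])
  have r7 := hF.rarr 7 (by simp [Cmd.wR, testRow])
  have r8 := hF.rarr 8 (by simp [Cmd.wR, testRow])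
  obtain ⟨e1, e2⟩ := testRow_spec O ((t.setN 5 l).tick 1) i j
  rw [e1, e2]
  simp only [State.tick_nvar, State.setN_nvar, State.tick_rarr, State.setN_rarr, State.tick_rvar,
    State.setN_rvar, if_true, Nat.reduceEqDiff, if_false, h1, hj, and_true, hv, r7, r8]
  by_cases hil : i = l
  · simp [hil]
  · have := hI i (by omega) j hj
    simp [hil, this]

/-- Divide column `0` of array `R` by the diagonal of array `T`; the result goes to array `3`. -/
def divideDiag (T R : ℕ) : Cmd :=
  .loop 5 (.var 1) (.rput 3 (.var 5) (.lit 0)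
    (.div (.get R (.var 5) (.lit 0)) (.get T (.var 5) (.var 5))))

theorem divideDiag_spec (O : Solver) (T R : ℕ) (hT : T ≠ 3) (hR : R ≠ 3) (s : State) (i : ℕ)
    (hi : i < s.nvar 1) :
    (run O (divideDiag T R) s).rarr 3 i 0 = s.rarr R i 0 / s.rarr T i i := by
  refine run_loop_frame O 5 (.var 1) _ (by simp [Cmd.IsDet]) s (fun l t => ∀ i < l,
    t.rarr 3 i 0 = s.rarr R i 0 / s.rarr T i i) (by simp) ?_ i hi
  intro l hl t hF hI i hi
  have rT := hF.rarr T (by simp [Cmd.wR, hT])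
  have rR := hF.rarr R (by simp [Cmd.wR, hR])
  simp only [run, NExp.eval, RExp.eval, State.tick_nvar, State.setN_nvar, State.tick_rarr,
    State.setN_rarr, State.putR_rarr_self, if_true, rT, rR]
  by_cases hil : i = l
  · simp [hil]
  · simp [hil, hI i (by omega)]

end RealRAM

/-! ### The deterministic core: sketches, Gram matrices, tests. -/

namespace RealRAM

/-- Sketch, form the Gram matrices, and test how close they are. -/
def core : Cmd :=
  .seq scatter (.seq (gram 4 7 3) (.seq (gram 5 8 4) (.seq testMatrices
    -- The first verdict is copied to variable 12, because the second elimination overwrites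
    -- variable 11. Array 11 is a dummy right-hand side.
    (.seq (gaussJordan 9 11) (.seq (.nset 12 (.var 11)) (gaussJordan 10 11))))))

theorem gram_isDet (B G y : ℕ) : (gram B G y).IsDet := by
  simp [gram, gramRow, accumulate, Cmd.IsDet]

theorem testMatrices_isDet : testMatrices.IsDet := testRow_isDet

theorem core_isDet : core.IsDet := by
  simp [core, Cmd.IsDet, scatter_isDet, gram_isDet, testMatrices_isDet, gaussJordan_isDet]

open GaussJordan in
theorem posFrom_congr {d : ℕ} {M M' : ℕ → ℕ → ℝ} (h : ∀ i < d, ∀ j < d, M i j = M' i j) :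
    PosFrom 0 d M ↔ PosFrom 0 d M' := by
  have : ∀ x, quad 0 d M x = quad 0 d M' x := fun x =>
    Finset.sum_congr rfl fun i hi => Finset.sum_congr rfl fun j hj => by
      rw [h i (Finset.mem_Ico.1 hi).2 j (Finset.mem_Ico.1 hj).2]
  simp only [PosFrom, this]

-- Sketches and Gram matrices are accumulated, so their arrays must start at zero. The eliminations
-- destroy only arrays 9, 10 and 11, so both Gram matrices survive for the final solve.
open GaussJordan in
theorem core_spec (O : Solver) (s : State) (hz : ∀ a, 4 ≤ a → s.rarr a = fun _ _ => 0) :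
    (run O core s).nvar 1 = s.nvar 1 ∧
    (∀ i < s.nvar 1, ∀ j < s.nvar 1, (run O core s).rarr 7 i j = ∑ r ∈ Finset.range (s.nvar 3),
      (run O scatter s).rarr 4 r i * (run O scatter s).rarr 4 r j) ∧
    (∀ i < s.nvar 1, ∀ j < s.nvar 1, (run O core s).rarr 8 i j = ∑ r ∈ Finset.range (s.nvar 4),
      (run O scatter s).rarr 5 r i * (run O scatter s).rarr 5 r j) ∧
    (∀ i, (run O core s).rarr 6 i 0 = (run O scatter s).rarr 6 i 0) ∧
    (0 < (run O core s).nvar 12 ↔ PosFrom 0 (s.nvar 1) fun i j =>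
      (run O core s).rarr 7 i j - (1 - 3 * s.rvar 0) * (run O core s).rarr 8 i j) ∧
    (0 < (run O core s).nvar 11 ↔ PosFrom 0 (s.nvar 1) fun i j =>
      (1 + 3 * s.rvar 0) * (run O core s).rarr 8 i j - (run O core s).rarr 7 i j) := by
  have e : run O core s = run O (gaussJordan 10 11) ((run O (gaussJordan 9 11) (run O testMatrices
    (run O (gram 5 8 4) (run O (gram 4 7 3) (run O scatter s))))).setN 12
      ((run O (gaussJordan 9 11) (run O testMatrices
    (run O (gram 5 8 4) (run O (gram 4 7 3) (run O scatter s))))).nvar 11) |>.tick 2) := rfl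
  set s1 := run O scatter s with h1
  set s2 := run O (gram 4 7 3) s1 with h2
  set s3 := run O (gram 5 8 4) s2 with h3
  set s4 := run O testMatrices s3 with h4
  set s5 := run O (gaussJordan 9 11) s4 with h5
  set s6 := (s5.setN 12 (s5.nvar 11)).tick 2 with h6
  have F1 := frame_run O scatter scatter_isDet s
  have F2 := frame_run O (gram 4 7 3) (gram_isDet _ _ _) s1
  have F3 := frame_run O (gram 5 8 4) (gram_isDet _ _ _) s2
  have F4 := frame_run O testMatrices testMatrices_isDet s3
  have F5 := frame_run O (gaussJordan 9 11) (gaussJordan_isDet _ _) s4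
  have F7 := frame_run O (gaussJordan 10 11) (gaussJordan_isDet _ _) s6
  rw [← e] at F7
  rw [← h1] at F1
  rw [← h2] at F2
  rw [← h3] at F3
  rw [← h4] at F4
  rw [← h5] at F5
  have a1 : ∀ y < 5, s1.nvar y = s.nvar y := fun y hy =>
    F1.nvar y (by simp [Cmd.wN, scatter, accumulate]; omega)
  have a2 : ∀ y < 5, s2.nvar y = s.nvar y := fun y hy =>
    (F2.nvar y (by simp [Cmd.wN, gram, gramRow, accumulate]; omega)).trans (a1 y hy)
  have a3 : ∀ y < 5, s3.nvar y = s.nvar y := fun y hy =>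
    (F3.nvar y (by simp [Cmd.wN, gram, gramRow, accumulate]; omega)).trans (a2 y hy)
  have a4 : ∀ y < 5, s4.nvar y = s.nvar y := fun y hy =>
    (F4.nvar y (by simp [Cmd.wN, testMatrices, testRow]; omega)).trans (a3 y hy)
  have a5 : ∀ y < 5, s5.nvar y = s.nvar y := fun y hy =>
    (F5.nvar y (by
      simp [Cmd.wN, gaussJordan, pivotTest, elimRound, elimRow, rowOp]; omega)).trans (a4 y hy)
  have a6 : s6.nvar 1 = s.nvar 1 := by rw [h6]; simpa using a5 1 (by decide)
  have v3 : s3.rvar 0 = s.rvar 0 := by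
    rw [F3.rvar 0 (by simp [Cmd.wV, gram, gramRow, accumulate]),
      F2.rvar 0 (by simp [Cmd.wV, gram, gramRow, accumulate]),
      F1.rvar 0 (by simp [Cmd.wV, scatter, accumulate])]
  have s6A : s6.rarr = s5.rarr := rfl
  have keep : ∀ a, a = 6 ∨ a = 7 ∨ a = 8 → (run O core s).rarr a = s3.rarr a := by
    intro a ha
    have : a ≠ 9 ∧ a ≠ 10 ∧ a ≠ 11 := by omega
    rw [F7.rarr a (by simp [Cmd.wR, gaussJordan, pivotTest, elimRound, elimRow, rowOp, this]), s6A,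
      F5.rarr a (by simp [Cmd.wR, gaussJordan, pivotTest, elimRound, elimRow, rowOp, this]),
      F4.rarr a (by simp [Cmd.wR, testMatrices, testRow, this])]
  have g7 : ∀ i j, s3.rarr 7 i j = if i < s.nvar 1 ∧ j < s.nvar 1 then
      ∑ r ∈ Finset.range (s.nvar 3), s1.rarr 4 r i * s1.rarr 4 r j else 0 := by
    intro i j
    rw [F3.rarr 7 (by simp [Cmd.wR, gram, gramRow, accumulate]), h2,
      gram_spec O 4 7 3 (by decide), F1.rarr 7 (by simp [Cmd.wR, scatter, accumulate]),
      hz 7 (by decide), a1 1 (by decide), a1 3 (by decide), zero_add]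
  have g8 : ∀ i j, s3.rarr 8 i j = if i < s.nvar 1 ∧ j < s.nvar 1 then
      ∑ r ∈ Finset.range (s.nvar 4), s1.rarr 5 r i * s1.rarr 5 r j else 0 := by
    intro i j
    rw [h3, gram_spec O 5 8 4 (by decide), F2.rarr 8 (by simp [Cmd.wR, gram, gramRow, accumulate]),
      F2.rarr 5 (by simp [Cmd.wR, gram, gramRow, accumulate]),
      F1.rarr 8 (by simp [Cmd.wR, scatter, accumulate]),
      hz 8 (by decide), a2 1 (by decide), a2 4 (by decide), zero_add]
  have sym7 : ∀ i j, s3.rarr 7 i j = s3.rarr 7 j i := by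
    intro i j
    rw [g7, g7]
    congr 1
    · rw [and_comm]
    · exact Finset.sum_congr rfl fun _ _ => mul_comm _ _
  have sym8 : ∀ i j, s3.rarr 8 i j = s3.rarr 8 j i := by
    intro i j
    rw [g8, g8]
    congr 1
    · rw [and_comm]
    · exact Finset.sum_congr rfl fun _ _ => mul_comm _ _
  have t4 := testMatrices_spec O s3
  rw [← h4, a3 1 (by decide), v3] at t4
  have t10 : s6.rarr 10 = s4.rarr 10 := by
    rw [s6A, F5.rarr 10 (by simp [Cmd.wR, gaussJordan, pivotTest, elimRound, elimRow, rowOp])]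
  refine ⟨?_, ?_, ?_, ?_, ?_, ?_⟩
  · rw [F7.nvar 1 (by simp [Cmd.wN, gaussJordan, pivotTest, elimRound, elimRow, rowOp]), a6]
  · intro i hi j hj
    rw [keep 7 (by simp), g7, if_pos ⟨hi, hj⟩]
  · intro i hi j hj
    rw [keep 8 (by simp), g8, if_pos ⟨hi, hj⟩]
  · intro i
    rw [keep 6 (by simp), F3.rarr 6 (by simp [Cmd.wR, gram, gramRow, accumulate]),
      F2.rarr 6 (by simp [Cmd.wR, gram, gramRow, accumulate])]
  · rw [keep 7 (by simp), keep 8 (by simp),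
      F7.nvar 12 (by simp [Cmd.wN, gaussJordan, pivotTest, elimRound, elimRow, rowOp])]
    have : s6.nvar 12 = s5.nvar 11 := by simp [h6]
    rw [this, h5, (gaussJordan_spec O 9 11 (by decide) s4).2.2, a4 1 (by decide),
      ← posFrom_iff _ _ fun i hi j hj => by
        rw [(t4 i j hi hj).1, (t4 j i hj hi).1, sym7, sym8]]
    exact posFrom_congr fun i hi j hj => (t4 i j hi hj).1
  · rw [keep 7 (by simp), keep 8 (by simp), e,
      (gaussJordan_spec O 10 11 (by decide) s6).2.2, a6, t10,
      ← posFrom_iff _ _ fun i hi j hj => by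
        rw [(t4 i j hi hj).2, (t4 j i hj hi).2, sym7, sym8]]
    exact posFrom_congr fun i hi j hj => (t4 i j hi hj).2

end RealRAM

/-! ### From memory cells to matrices. -/

namespace Sketch

open Matrix RealRAM

section linking

variable {n d m m₂ : ℕ} {A : Matrix (Fin n) (Fin d) ℝ}

/-- Turns a loop over the list of entries into a sum over the whole matrix: the omitted positions
contribute nothing. -/
theorem sum_nonzero (e : Fin (nnz A) ≃ Support A) (F : Fin n → Fin d → ℝ)
    (hF : ∀ i j, A i j = 0 → F i j = 0) :
    ∑ k, F (e k).1.1 (e k).1.2 = ∑ i, ∑ j, F i j := by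
  rw [← Fintype.sum_prod_type']
  refine Fintype.sum_of_injective (fun k => (e k).1) (Subtype.val_injective.comp e.injective) _ _
    ?_ fun _ => rfl
  intro q hq
  refine hF _ _ ?_
  by_contra h
  exact hq ⟨e.symm ⟨q, h⟩, by simp⟩

theorem countSketch_mul_apply (e : Fin (nnz A) ≃ Support A) (p : Fin n → Fin m) (v : Fin n → ℝ)
    (r : Fin m) (j : Fin d) :
    (countSketch p v * A) r j = ∑ k, if (r : ℕ) = p (e k).1.1 ∧ (j : ℕ) = (e k).1.2 then
      v (e k).1.1 * A (e k).1.1 (e k).1.2 else 0 := by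
  rw [sum_nonzero e fun i l => if (r : ℕ) = p i ∧ (j : ℕ) = l then v i * A i l else 0]
  · rw [mul_apply]
    refine Finset.sum_congr rfl fun i _ => ?_
    simp only [← Fin.ext_iff, countSketch, of_apply]
    by_cases h : p i = r
    · simp [h]
    · simp [h, Ne.symm h]
  · intro i l h
    simp [h]

theorem transpose_mulVec_apply (e : Fin (nnz A) ≃ Support A) (b : Fin n → ℝ) (j : Fin d) :
    (Aᵀ *ᵥ b) j = ∑ k, if (j : ℕ) = (e k).1.2 then
      A (e k).1.1 (e k).1.2 * b (e k).1.1 else 0 := by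
  rw [sum_nonzero e fun i l => if (j : ℕ) = l then A i l * b i else 0]
  · rw [mulVec, dotProduct]
    refine Finset.sum_congr rfl fun i _ => ?_
    simp [← Fin.ext_iff]
  · intro i l h
    simp [h]

/-- The state of the machine after drawing: the input is still there, and `D i` has been drawn for
row `i`. -/
structure Drawn (A : Matrix (Fin n) (Fin d) ℝ) (e : Fin (nnz A) ≃ Support A) (b : Fin n → ℝ)
    (p : Fin n → Fin m) (v : Fin n → ℝ) (ε : ℝ) (m₂ : ℕ) (D : Fin n → ℕ) (s : State) : Prop where
  nvar_one : s.nvar 1 = d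
  nvar_two : s.nvar 2 = nnz A
  nvar_three : s.nvar 3 = m
  nvar_four : s.nvar 4 = m₂
  rvar_zero : s.rvar 0 = ε
  row : ∀ k : Fin (nnz A), s.narr 0 k 0 = (e k).1.1
  col : ∀ k : Fin (nnz A), s.narr 0 k 1 = (e k).1.2
  pos : ∀ i : Fin n, s.narr 1 i 0 = p i
  draw : ∀ i : Fin n, s.narr 2 i 0 = D i
  val : ∀ k : Fin (nnz A), s.rarr 0 k 0 = A (e k).1.1 (e k).1.2
  vec : ∀ i : Fin n, s.rarr 1 i 0 = b i
  weight : ∀ i : Fin n, s.rarr 2 i 0 = v i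
  zero : ∀ a, 4 ≤ a → s.rarr a = fun _ _ => 0

theorem scatter_correct {e : Fin (nnz A) ≃ Support A} {b : Fin n → ℝ} {p : Fin n → Fin m}
    {v : Fin n → ℝ} {ε : ℝ} {D : Fin n → ℕ} {s : State} (hs : Drawn A e b p v ε m₂ D s)
    (O : Solver) (h : Fin n → Fin m₂) (hh : ∀ i, (h i : ℕ) = decode m₂ (D i)) :
    (∀ (r : Fin m) (j : Fin d), (run O scatter s).rarr 4 r j = (countSketch p v * A) r j) ∧
    (∀ (r : Fin m₂) (j : Fin d), (run O scatter s).rarr 5 r j =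
      (countSketch h (fun i => sign m₂ (D i)) * A) r j) ∧
    (∀ j : Fin d, (run O scatter s).rarr 6 j 0 = (Aᵀ *ᵥ b) j) := by
  obtain ⟨h4, h5, h6⟩ := scatter_spec O s
  refine ⟨fun r j => ?_, fun r j => ?_, fun j => ?_⟩
  · rw [h4, hs.zero 4 (by decide), zero_add, hs.nvar_two, Finset.sum_range,
      countSketch_mul_apply e]
    simp only [hs.row, hs.col, hs.pos, hs.val, hs.weight]
  · rw [h5, hs.zero 5 (by decide), zero_add, hs.nvar_two, Finset.sum_range,
      countSketch_mul_apply e]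
    simp only [hs.row, hs.col, hs.draw, hs.val, hs.nvar_four, hh]
  · rw [h6, hs.zero 6 (by decide), zero_add, hs.nvar_two, Finset.sum_range,
      transpose_mulVec_apply e]
    simp only [hs.row, hs.col, hs.val, hs.vec]

theorem posFrom_iff_forall (M : ℕ → ℕ → ℝ) :
    GaussJordan.PosFrom 0 d M ↔ ∀ x : Fin d → ℝ, x ≠ 0 →
      0 < ∑ i : Fin d, ∑ j : Fin d, M i j * (x i * x j) := by
  have hq : ∀ x : ℕ → ℝ, GaussJordan.quad 0 d M x =
      ∑ i : Fin d, ∑ j : Fin d, M i j * (x i * x j) := by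
    intro x
    simp only [GaussJordan.quad, Nat.Ico_zero_eq_range, Finset.sum_range]
  constructor
  · intro h x hx
    obtain ⟨i, hi⟩ := Function.ne_iff.1 hx
    have := h (fun l => if hl : l < d then x ⟨l, hl⟩ else 0)
      ⟨i, Nat.zero_le _, i.2, by simpa using hi⟩
    rw [hq] at this
    simpa using this
  · rintro h x ⟨i, -, hi, hxi⟩
    rw [hq]
    exact h (fun l => x l) (Function.ne_iff.2 ⟨⟨i, hi⟩, hxi⟩)

theorem l2_mulVec_sq (B : Matrix (Fin m) (Fin d) ℝ) (x : Fin d → ℝ) :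
    l2 (B *ᵥ x) ^ 2 = x ⬝ᵥ ((Bᵀ * B) *ᵥ x) := by
  rw [l2_sq, ← mulVec_mulVec, dotProduct_mulVec, ← mulVec_transpose, dotProduct_comm]

theorem sum_gram (B : Matrix (Fin m) (Fin d) ℝ) (x : Fin d → ℝ) :
    ∑ i, ∑ j, (Bᵀ * B) i j * (x i * x j) = l2 (B *ᵥ x) ^ 2 := by
  rw [l2_mulVec_sq, dotProduct]
  refine Finset.sum_congr rfl fun i _ => ?_
  rw [mulVec, dotProduct, Finset.mul_sum]
  exact Finset.sum_congr rfl fun j _ => by ring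

/-- The two flags decide the strict order between G₁ and the multiples (1 ± 3ε) G₂, read as
inequalities between the norms of SAx and TAx. -/
theorem core_correct {e : Fin (nnz A) ≃ Support A} {b : Fin n → ℝ} {p : Fin n → Fin m}
    {v : Fin n → ℝ} {ε : ℝ} {D : Fin n → ℕ} {s : State} (hs : Drawn A e b p v ε m₂ D s)
    (O : Solver) (h : Fin n → Fin m₂) (hh : ∀ i, (h i : ℕ) = decode m₂ (D i))
    {S : Matrix (Fin m) (Fin n) ℝ} (hS : S = countSketch p v)
    {T : Matrix (Fin m₂) (Fin n) ℝ} (hT : T = countSketch h fun i => sign m₂ (D i)) :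
    (run O core s).nvar 1 = d ∧
    (∀ i j : Fin d, (run O core s).rarr 7 i j = ((S * A)ᵀ * (S * A)) i j) ∧
    (∀ i j : Fin d, (run O core s).rarr 8 i j = ((T * A)ᵀ * (T * A)) i j) ∧
    (∀ i : Fin d, (run O core s).rarr 6 i 0 = (Aᵀ *ᵥ b) i) ∧
    (0 < (run O core s).nvar 12 ↔ ∀ x, x ≠ 0 →
      (1 - 3 * ε) * l2 ((T * A) *ᵥ x) ^ 2 < l2 ((S * A) *ᵥ x) ^ 2) ∧
    (0 < (run O core s).nvar 11 ↔ ∀ x, x ≠ 0 →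
      l2 ((S * A) *ᵥ x) ^ 2 < (1 + 3 * ε) * l2 ((T * A) *ᵥ x) ^ 2) := by
  obtain ⟨c1, c7, c8, c6, c12, c11⟩ := core_spec O s hs.zero
  obtain ⟨s4, s5, s6⟩ := scatter_correct hs O h hh
  rw [hs.nvar_one] at c1 c7 c8 c11 c12
  rw [hs.rvar_zero] at c11 c12
  rw [hs.nvar_three] at c7
  rw [hs.nvar_four] at c8
  have g7 : ∀ i j : Fin d, (run O core s).rarr 7 i j = ((S * A)ᵀ * (S * A)) i j := by
    intro i j
    rw [c7 i i.2 j j.2, Finset.sum_range, mul_apply]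
    simp only [s4, transpose_apply, hS]
  have g8 : ∀ i j : Fin d, (run O core s).rarr 8 i j = ((T * A)ᵀ * (T * A)) i j := by
    intro i j
    rw [c8 i i.2 j j.2, Finset.sum_range, mul_apply]
    simp only [s5, transpose_apply, hT]
  refine ⟨c1, g7, g8, fun i => (c6 i).trans (s6 i), ?_, ?_⟩
  · rw [c12, posFrom_iff_forall]
    refine forall₂_congr fun x _ => ?_
    simp only [g7, g8, sub_mul, mul_assoc,
      Finset.sum_sub_distrib, ← Finset.mul_sum, sum_gram]
    constructor <;> intro h <;> linarith
  · rw [c11, posFrom_iff_forall]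
    refine forall₂_congr fun x _ => ?_
    simp only [g7, g8, sub_mul, add_mul, mul_assoc, Finset.sum_add_distrib,
      Finset.sum_sub_distrib, ← Finset.mul_sum, sum_gram]
    constructor <;> intro h <;> linarith

end linking

end Sketch

/-! ### The final quadratic program: solver call or linear system. -/

namespace Sketch

open Matrix RealRAM

section finish

variable {d : ℕ}

/-- The program `c` solves the quadratic program over `C` whose matrix is in array `h` and whose
vector is in column `0` of array `6`; the solution goes to column `0` of array `3`. -/
def Solves (O : Solver) (C : Set (Fin d → ℝ)) (h : ℕ) (c : Cmd) : Prop :=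
  c.IsDet ∧ ∀ (s : State) (H : Matrix (Fin d) (Fin d) ℝ) (g : Fin d → ℝ), s.nvar 1 = d →
    (∀ i j : Fin d, s.rarr h i j = H i j) → (∀ i : Fin d, s.rarr 6 i 0 = g i) → H.PosDef →
    output d (run O c s) ∈ C ∧
      IsMinOn (fun z => 1 / 2 * (z ⬝ᵥ (H *ᵥ z)) - g ⬝ᵥ z) C (output d (run O c s))

theorem solves_solve {O : Solver} {C : Set (Fin d → ℝ)} (hO : SolvesQP C O) (h : ℕ) :
    Solves O C h (.solve h 6 3) := by
  refine ⟨trivial, fun s H g _ hH hg hpos => ?_⟩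
  have : output d (run O (.solve h 6 3) s) =
      fun i : Fin d => O (s.rarr h) (fun i => s.rarr 6 i 0) i := by
    funext i
    simp [output, run, State.ask]
  rw [this]
  exact hO H hpos g _ _ hH hg

/-- If Hx = g, the objective at z exceeds that at x by half the form of H at z - x. -/
theorem isMinOn_of_mulVec_eq {H : Matrix (Fin d) (Fin d) ℝ} (hH : H.PosDef) {g x : Fin d → ℝ}
    (hx : H *ᵥ x = g) (C : Set (Fin d → ℝ)) :
    IsMinOn (fun z => 1 / 2 * (z ⬝ᵥ (H *ᵥ z)) - g ⬝ᵥ z) C x := by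
  intro z _
  have hsym : Hᵀ = H := by simpa using hH.isHermitian.eq
  have h1 : 0 ≤ (z - x) ⬝ᵥ (H *ᵥ (z - x)) := by
    by_cases h0 : z - x = 0
    · simp [h0]
    · simpa using (hH.dotProduct_mulVec_pos h0).le
  have h2 : x ⬝ᵥ (H *ᵥ z) = g ⬝ᵥ z := by
    rw [dotProduct_mulVec, ← mulVec_transpose, hsym, hx]
  rw [mulVec_sub, dotProduct_sub, sub_dotProduct, sub_dotProduct, h2, hx,
    dotProduct_comm z g, dotProduct_comm x g] at h1
  simp only [Set.mem_ofPred_eq, hx]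
  rw [dotProduct_comm x g]
  linarith

/-- Solve the linear system whose matrix is in array `h` and whose right-hand side is in column `0`
of array `6`. -/
def solveLinear (h : ℕ) : Cmd := .seq (gaussJordan h 6) (divideDiag h 6)

/-- A positive definite matrix has positive pivots throughout, so elimination needs no row exchanges
and ends with a diagonal system. -/
theorem solves_solveLinear (O : Solver) (h : ℕ) (h3 : h ≠ 3) (h6 : h ≠ 6) :
    Solves O (Set.univ : Set (Fin d → ℝ)) h (solveLinear h) := by
  refine ⟨⟨gaussJordan_isDet h 6, trivial⟩, fun s H g hs hH hg hpos => ⟨Set.mem_univ _, ?_⟩⟩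
  refine isMinOn_of_mulVec_eq hpos ?_ _
  have hsym : ∀ i j, H i j = H j i := fun i j => by simpa using hpos.isHermitian.apply j i
  set x := H⁻¹ *ᵥ g with hx
  have hHx : H *ᵥ x = g := by
    rw [hx, mulVec_mulVec, mul_nonsing_inv _ ((isUnit_iff_isUnit_det _).1 hpos.isUnit),
      one_mulVec]
  have hpiv : ∀ k < d, 0 < GaussJordan.mat d (s.rarr h) k k k := by
    rw [← GaussJordan.posFrom_iff d (s.rarr h) fun i hi j hj => by
      have := hsym ⟨i, hi⟩ ⟨j, hj⟩
      rwa [← hH, ← hH] at this, posFrom_iff_forall]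
    intro y hy
    have := hpos.dotProduct_mulVec_pos hy
    simp only [star_trivial, dotProduct, mulVec, Finset.mul_sum] at this
    refine this.trans_eq (Finset.sum_congr rfl fun i _ => Finset.sum_congr rfl fun j _ => ?_)
    rw [hH]
    ring
  have hsol := GaussJordan.solve_eq d (s.rarr h) (fun k hk => (hpiv k hk).ne')
    (fun i => s.rarr 6 i 0) (fun i => if hi : i < d then x ⟨i, hi⟩ else 0) (by
      intro i hi
      rw [Finset.sum_range, hg ⟨i, hi⟩, ← hHx]
      refine Finset.sum_congr rfl fun j _ => ?_
      rw [hH ⟨i, hi⟩ j]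
      simp)
  obtain ⟨g1, g2, -⟩ := gaussJordan_spec O h 6 h6 s
  have hF := frame_run O (gaussJordan h 6) (gaussJordan_isDet h 6) s
  have hn : (run O (gaussJordan h 6) s).nvar 1 = d :=
    (hF.nvar 1 (by
      simp [Cmd.wN, gaussJordan, pivotTest, elimRound, elimRow, rowOp])).trans hs
  have : output d (run O (solveLinear h) s) = x := by
    funext i
    rw [output, solveLinear, run, divideDiag_spec O h 6 h3 (by decide) _ i (by rw [hn]; exact i.2),
      g1, g2, hs, hsol i i.2]
    simp
  rw [this, hHx]

end finish

/-! ### The whole algorithm and the correctness of its choice. -/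

section program

/-- The whole algorithm, where `fin h` solves the quadratic program with matrix in array `h`. -/
def program (fin : ℕ → Cmd) : Cmd :=
  -- The factor 100 gives failure probability 2d²/(m₂ε²) ≤ 1/50.
  .seq (.ceil 4 (.div (.mul (.lit 100) (.mul (.ofNat (.var 1)) (.ofNat (.var 1))))
      (.mul (.var 0) (.var 0))))
    (.seq drawHashes (.seq core
      (.ite (.and (.nlt (.lit 0) (.var 12)) (.nlt (.lit 0) (.var 11))) (fin 7) (fin 8))))

variable {n d m m₂ : ℕ} {A : Matrix (Fin n) (Fin d) ℝ}

theorem posDef_gram {B : Matrix (Fin m) (Fin d) ℝ} (h : ∀ x, x ≠ 0 → 0 < l2 (B *ᵥ x) ^ 2) :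
    (Bᵀ * B).PosDef := by
  refine PosDef.of_dotProduct_mulVec_pos ?_ fun x hx => ?_
  · simpa using isHermitian_conjTranspose_mul_self B
  · simpa [← l2_mulVec_sq] using h x hx

theorem isSketchedSolution_of_gram {b : Fin n → ℝ} {C : Set (Fin d → ℝ)}
    {S : Matrix (Fin m) (Fin n) ℝ} {x : Fin d → ℝ} (hx : x ∈ C ∧
      IsMinOn (fun z => 1 / 2 * (z ⬝ᵥ (((S * A)ᵀ * (S * A)) *ᵥ z)) - (Aᵀ *ᵥ b) ⬝ᵥ z) C x) :
    IsSketchedSolution A b C S x := by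
  simpa only [IsSketchedSolution, l2_mulVec_sq] using hx

/-- The choice of the sketch and the final call succeed if the random sketch is a subspace
embedding. -/
theorem choice_correct {e : Fin (nnz A) ≃ Support A} {b : Fin n → ℝ} {p : Fin n → Fin m}
    {v : Fin n → ℝ} {ε : ℝ} {D : Fin n → ℕ} {s : State} (hs : Drawn A e b p v ε m₂ D s)
    {O : Solver} {C : Set (Fin d → ℝ)} {fin : ℕ → Cmd} (h7 : Solves O C 7 (fin 7))
    (h8 : Solves O C 8 (fin 8)) (h : Fin n → Fin m₂) (hh : ∀ i, (h i : ℕ) = decode m₂ (D i))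
    (hd : 0 < d) (hA : A.rank = d) (hε : 0 < ε) (hε' : ε < 0.09) (hC : Convex ℝ C)
    (hT : ∀ u ∈ LinearMap.range A.mulVecLin, ∀ w ∈ LinearMap.range A.mulVecLin,
      |distortion (countSketch h fun i => sign m₂ (D i)) u w| ≤ ε * (l2 u * l2 w))
    {xs : Fin d → ℝ} (hxs : IsLeastSquares A b C xs) :
    let x := output d (run O (.ite (.and (.nlt (.lit 0) (.var 12)) (.nlt (.lit 0) (.var 11)))
      (fin 7) (fin 8)) (run O core s))
    l2 (A *ᵥ (x - xs)) ≤ 8 * rate A (countSketch p v) ε * l2 (A *ᵥ xs) ∧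
      (IsSketchedSolution A b C (countSketch p v) x ∨
        IsSketchedSolution A b C (countSketch h fun i => sign m₂ (D i)) x) := by
  intro x
  obtain ⟨c1, c7, c8, c6, c12, c11⟩ := core_correct hs O h hh rfl rfl
  set S := countSketch p v
  set T := countSketch h fun i => sign m₂ (D i) with hTdef
  have hTpos : ∀ y, y ≠ 0 → 0 < l2 ((T * A) *ᵥ y) ^ 2 := by
    intro y hy
    have hw := mulVec_ne_zero A hA hy
    have h1 := (abs_le.1 (hT _ ⟨y, rfl⟩ _ ⟨y, rfl⟩)).1
    rw [distortion_self, ← pow_two, mulVecLin_apply] at h1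
    have h2 : 0 < l2 (A *ᵥ y) ^ 2 :=
      pow_pos (lt_of_le_of_ne (l2_nonneg _) fun h => hw (l2_eq_zero.1 h.symm)) 2
    rw [← mulVec_mulVec]
    have h3 : 0 < (1 - ε) * l2 (A *ᵥ y) ^ 2 := mul_pos (by linarith) h2
    linarith
  by_cases htest : 0 < (run O core s).nvar 12 ∧ 0 < (run O core s).nvar 11
  · obtain ⟨k, hx⟩ : ∃ k, x = output d (run O (fin 7) ((run O core s).tick k)) := by
      simp only [x]
      rw [run, if_pos (by simpa [BExp.eval, NExp.eval] using htest)]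
      exact ⟨_, rfl⟩
    have t1 := c12.1 htest.1
    have t2 := c11.1 htest.2
    -- The strict lower test makes G₁ positive definite, as the solver requires.
    have hpos : ((S * A)ᵀ * (S * A)).PosDef := posDef_gram fun y hy =>
      lt_of_le_of_lt (mul_nonneg (by linarith) (sq_nonneg _)) (t1 y hy)
    have hsol : IsSketchedSolution A b C S x := by
      rw [hx]
      exact isSketchedSolution_of_gram (h7.2 ((run O core s).tick k) _ _ c1 c7 c6 hpos)
    refine ⟨error_of_pass hd hA hε hε' hC hT (fun y => ?_) (fun y => ?_) hxs hsol, Or.inl hsol⟩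
    · by_cases hy : y = 0
      · simp [hy, l2]
      · exact (t1 y hy).le
    · by_cases hy : y = 0
      · simp [hy, l2]
      · exact (t2 y hy).le
  · obtain ⟨k, hx⟩ : ∃ k, x = output d (run O (fin 8) ((run O core s).tick k)) := by
      simp only [x]
      rw [run, if_neg (by simpa [BExp.eval, NExp.eval] using htest)]
      exact ⟨_, rfl⟩
    have hsol : IsSketchedSolution A b C T x := by
      rw [hx]
      exact isSketchedSolution_of_gram
        (h8.2 ((run O core s).tick k) _ _ c1 c8 c6 (posDef_gram hTpos))
    refine ⟨error_of_fail hd hA hε hε' hC hT ?_ hxs hsol, Or.inr hsol⟩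
    -- The test is exact, so its failure provides a vector that violates one of the two
    -- inequalities.
    rw [c12, c11, not_and_or] at htest
    push Not at htest
    rcases htest with ⟨y, hy, h⟩ | ⟨y, hy, h⟩
    · exact ⟨y, hy, Or.inl h⟩
    · exact ⟨y, hy, Or.inr h⟩

end program

/-! ### A random sketch is a subspace embedding with probability 0.98. -/

section probability

variable {n d m N : ℕ}

theorem exists_last (row : ℕ → ℕ) (N i : ℕ) (h : ∃ l < N, row l = i) :
    ∃ l < N, row l = i ∧ ∀ l' < N, l < l' → row l' ≠ i := by
  induction N with
  | zero => obtain ⟨l, hl, -⟩ := h; omega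
  | succ N ih =>
    by_cases hN : row N = i
    · exact ⟨N, N.lt_succ_self, hN, fun l' h1 h2 => by omega⟩
    · obtain ⟨l, hl, hli⟩ := h
      have : l ≠ N := fun e => hN (e ▸ hli)
      obtain ⟨l, hl, hli, hlast⟩ := ih ⟨l, by omega, hli⟩
      refine ⟨l, by omega, hli, fun l' h1 h2 => ?_⟩
      rcases Nat.lt_succ_iff_lt_or_eq.1 h1 with h1 | rfl
      · exact hlast l' h1 h2
      · exact hN

open Classical in
/-- The restriction of a vector indexed by rows to the last entries of the rows. -/
noncomputable def lastEntries (row : Fin N → Fin n) (u : Fin n → ℝ) (k : Fin N) : ℝ :=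
  if ∀ l, k < l → row l ≠ row k then u (row k) else 0

/-- Sending a last entry to its row is a bijection onto the rows that have entries. Sums over rows
thereby become sums over the index set of the draws. -/
theorem sum_lastEntries (row : Fin N → Fin n) (F : Fin n → ℝ)
    (hF : ∀ i, (∀ k, row k ≠ i) → F i = 0) :
    ∑ k, lastEntries row F k = ∑ i, F i := by
  classical
  simp only [lastEntries]
  rw [← Finset.sum_filter]
  have h2 : ∑ i, F i = ∑ i with ∃ k, row k = i, F i := by
    rw [Finset.sum_filter]
    refine Finset.sum_congr rfl fun i _ => ?_
    split_ifs with h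
    · rfl
    · exact hF i (by simpa using h)
  rw [h2]
  refine Finset.sum_nbij row ?_ ?_ ?_ fun _ _ => rfl
  · intro k _
    simp
  · intro k hk l hl hkl
    simp only [Finset.coe_filter, Finset.mem_univ, true_and, Set.mem_ofPred_eq] at hk hl
    rcases lt_trichotomy k l with h | h | h
    · exact absurd hkl.symm (hk l h)
    · exact h
    · exact absurd hkl (hl k h)
  · intro i hi
    simp only [Finset.coe_filter, Finset.mem_univ, true_and, Set.mem_ofPred_eq] at hi
    obtain ⟨k, hk⟩ := hi
    obtain ⟨l, hl, hli, hlast⟩ := exists_last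
      (fun l => if h : l < N then (row ⟨l, h⟩ : ℕ) else n) N i ⟨k, k.2, by simp [hk]⟩
    simp only [hl, dite_true] at hli
    refine ⟨⟨l, hl⟩, ?_, Fin.ext hli⟩
    simp only [Finset.coe_filter, Finset.mem_univ, true_and, Set.mem_ofPred_eq]
    intro l' hl' h
    refine hlast l' l'.2 hl' ?_
    simp [h, hli]

/-- The distortion of a Count-Sketch whose positions and signs are those of the last entries of the
rows. -/
theorem distortion_countSketch {α : Type} (h₀ : α → Fin m) (s₀ : α → ℝ) (row : Fin N → Fin n)
    (w : Fin N → α) (h : Fin n → Fin m) (σ : Fin n → ℝ)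
    (hlast : ∀ k, (∀ l, k < l → row l ≠ row k) → h (row k) = h₀ (w k) ∧ σ (row k) = s₀ (w k))
    (x y : Fin n → ℝ) (hx : ∀ i, (∀ k, row k ≠ i) → x i = 0)
    (hy : ∀ i, (∀ k, row k ≠ i) → y i = 0) :
    distortion (countSketch h σ) x y =
      ∑ r, sk h₀ s₀ w (lastEntries row x) r * sk h₀ s₀ w (lastEntries row y) r -
        ∑ k, lastEntries row x k * lastEntries row y k := by
  classical
  have h1 : ∀ z : Fin n → ℝ, (∀ i, (∀ k, row k ≠ i) → z i = 0) → ∀ r,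
      (countSketch h σ *ᵥ z) r = sk h₀ s₀ w (lastEntries row z) r := by
    intro z hz r
    have : (countSketch h σ *ᵥ z) r = ∑ i, if h i = r then σ i * z i else 0 := by
      simp [mulVec, dotProduct, countSketch]
    rw [this, ← sum_lastEntries row, sk]
    · refine Finset.sum_congr rfl fun k _ => ?_
      rw [lastEntries, lastEntries]
      split_ifs with h1 h2 h3 h4 <;> simp_all
    · intro i hi
      rw [hz i hi]
      simp
  rw [distortion_eq, dotProduct, dotProduct, ← sum_lastEntries row fun i => x i * y i]
  · simp only [h1 x hx, h1 y hy]
    congr 1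
    refine Finset.sum_congr rfl fun k _ => ?_
    simp only [lastEntries]
    split_ifs <;> simp
  · intro i hi
    rw [hx i hi, zero_mul]

theorem sum_sq_lastEntries (row : Fin N → Fin n) (u : Fin n → ℝ)
    (hu : ∀ i, (∀ k, row k ≠ i) → u i = 0) :
    ∑ k, lastEntries row u k ^ 2 = l2 u ^ 2 := by
  rw [l2_sq, dotProduct, ← sum_lastEntries row fun i => u i * u i]
  · refine Finset.sum_congr rfl fun k _ => ?_
    simp only [lastEntries]
    split_ifs <;> ring
  · intro i hi
    rw [hu i hi, zero_mul]

/-- The draws below `2 m`, decoded. -/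
def hash (m : ℕ) (a : Fin (m + m - 1 + 1)) (hm : 0 < m) : Fin m :=
  ⟨decode m a, by have := a.2; unfold decode; split_ifs <;> omega⟩

theorem sum_draws (hm : 0 < m) (G : ℕ → ℝ) :
    ∑ a : Fin (m + m - 1 + 1), G a = ∑ r : Fin m, (G r + G (m + r)) := by
  rw [← Finset.sum_range (fun a => G a), Nat.sub_add_cancel (by omega), Finset.sum_range_add,
    Finset.sum_add_distrib, Finset.sum_range, Finset.sum_range]

/-- Bucket r is coded twice, by r with sign 1 and by m + r with sign -1, so the contributions cancel
in pairs. -/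
theorem sum_sign_mul (hm : 0 < m) (f : Fin m → ℝ) :
    ∑ a : Fin (m + m - 1 + 1), sign m a * f (hash m a hm) = 0 := by
  have := sum_draws hm fun a => sign m a * (if h : decode m a < m then f ⟨decode m a, h⟩ else 0)
  have e : ∀ a : Fin (m + m - 1 + 1),
      (if h : decode m a < m then f ⟨decode m a, h⟩ else 0) = f (hash m a hm) := fun a =>
    dif_pos (hash m a hm).2
  simp only [e] at this
  rw [this]
  refine Finset.sum_eq_zero fun r _ => ?_
  simp [decode, sign]

theorem sum_hash (hm : 0 < m) (f : Fin m → ℝ) :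
    m * ∑ a : Fin (m + m - 1 + 1), f (hash m a hm) =
      Fintype.card (Fin (m + m - 1 + 1)) * ∑ r, f r := by
  have := sum_draws hm fun a => if h : decode m a < m then f ⟨decode m a, h⟩ else 0
  have e : ∀ a : Fin (m + m - 1 + 1),
      (if h : decode m a < m then f ⟨decode m a, h⟩ else 0) = f (hash m a hm) := fun a =>
    dif_pos (hash m a hm).2
  simp only [e] at this
  rw [this, Fintype.card_fin, Nat.sub_add_cancel (by omega), Finset.sum_add_distrib]
  simp [decode]
  ring

/-- Most draws give a subspace embedding. -/
theorem exists_good_draws {A : Matrix (Fin n) (Fin d) ℝ} (hA : A.rank = d) (hm : 0 < m) {ε : ℝ}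
    (hε : 0 < ε) (hmε : 100 * (d : ℝ) ^ 2 ≤ m * ε ^ 2) (row : Fin N → Fin n)
    (hrow : ∀ i, (∀ k, row k ≠ i) → ∀ j, A i j = 0) :
    ∃ G : Finset (Fin N → Fin (m + m - 1 + 1)),
      98 * Fintype.card (Fin N → Fin (m + m - 1 + 1)) ≤ 100 * G.card ∧
      ∀ w ∈ G, ∀ (h : Fin n → Fin m) (σ : Fin n → ℝ),
        (∀ k, (∀ l, k < l → row l ≠ row k) →
          h (row k) = hash m (w k) hm ∧ σ (row k) = sign m (w k)) →
        ∀ x ∈ LinearMap.range A.mulVecLin, ∀ y ∈ LinearMap.range A.mulVecLin,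
          |distortion (countSketch h σ) x y| ≤ ε * (l2 x * l2 y) := by
  classical
  obtain ⟨u, hu, hu1, huspan⟩ := exists_orthonormal A hA
  have hzero : ∀ x ∈ LinearMap.range A.mulVecLin, ∀ i, (∀ k, row k ≠ i) → x i = 0 := by
    rintro _ ⟨z, rfl⟩ i hi
    rw [mulVecLin_apply, mulVec, dotProduct]
    exact Finset.sum_eq_zero fun j _ => by rw [hrow i hi j, zero_mul]
  let h₀ : Fin (m + m - 1 + 1) → Fin m := fun a => hash m a hm
  let s₀ : Fin (m + m - 1 + 1) → ℝ := fun a => sign m a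
  let D : (Fin N → Fin (m + m - 1 + 1)) → (Fin n → ℝ) → (Fin n → ℝ) → ℝ := fun w x y =>
    ∑ r, sk h₀ s₀ w (lastEntries row x) r * sk h₀ s₀ w (lastEntries row y) r -
        ∑ k, lastEntries row x k * lastEntries row y k
  let F : (Fin N → Fin (m + m - 1 + 1)) → ℝ := fun w =>
    ∑ q : Fin d × Fin d, D w (u q.1) (u q.2) ^ 2
  set c : ℝ := (Fintype.card (Fin N → Fin (m + m - 1 + 1)) : ℝ) with hc
  have hc' : c = (Fintype.card (Fin (m + m - 1 + 1)) : ℝ) ^ N := by simp [hc]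
  -- The moment bound, summed over the d² pairs of basis vectors; unit length makes the right-hand
  -- side the same for all of them.
  have hF : m * ∑ w, F w ≤ 2 * c * d ^ 2 := by
    simp only [F]
    rw [Finset.sum_comm, Finset.mul_sum]
    have : ∀ q ∈ (Finset.univ : Finset (Fin d × Fin d)),
        (m : ℝ) * ∑ w, D w (u q.1) (u q.2) ^ 2 ≤ 2 * c := by
      intro q _
      have := sum_sq_distortion h₀ s₀ (fun a => by simp only [s₀, sign]; split_ifs <;> norm_num)
        (sum_sign_mul hm) (sum_hash hm) N (lastEntries row (u q.1)) (lastEntries row (u q.2))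
      rw [sum_sq_lastEntries row _ (hzero _ (hu _)), sum_sq_lastEntries row _ (hzero _ (hu _)),
        hu1, hu1, ← hc'] at this
      simpa using this
    refine (Finset.sum_le_card_nsmul _ _ _ this).trans_eq ?_
    simp
    ring
  refine ⟨Finset.univ.filter fun w => F w ≤ ε ^ 2, ?_, ?_⟩
  · have h1 : ((Finset.univ.filter fun w => ¬ F w ≤ ε ^ 2).card : ℝ) * ε ^ 2 ≤ ∑ w, F w := by
      rw [← nsmul_eq_mul]
      refine (Finset.card_nsmul_le_sum _ F _ fun w hw => ?_).trans
        (Finset.sum_le_sum_of_subset_of_nonneg (Finset.filter_subset _ _) fun w _ _ =>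
          Finset.sum_nonneg fun _ _ => sq_nonneg _)
      exact (not_le.1 (Finset.mem_filter.1 hw).2).le
    have h2 := Finset.card_filter_add_card_filter_not (s := Finset.univ) fun w => F w ≤ ε ^ 2
    set B := (Finset.univ.filter fun w => ¬ F w ≤ ε ^ 2).card with hB
    rw [Finset.card_univ] at h2
    have hm' : (0 : ℝ) < m := Nat.cast_pos.2 hm
    have h3 : (50 * B : ℝ) * (m * ε ^ 2) ≤ c * (m * ε ^ 2) := by
      have h4 := mul_le_mul_of_nonneg_left h1 hm'.le
      have h5 : c * (100 * (d : ℝ) ^ 2) ≤ c * (m * ε ^ 2) :=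
        mul_le_mul_of_nonneg_left hmε (Nat.cast_nonneg _)
      linarith
    have h6 : (50 * B : ℝ) ≤ c := le_of_mul_le_mul_right h3 (by positivity)
    have h7 : 50 * B ≤ Fintype.card (Fin N → Fin (m + m - 1 + 1)) := by
      rw [hc] at h6
      exact_mod_cast h6
    omega
  · intro w hw h σ hlast x hx y hy
    have hw := (Finset.mem_filter.1 hw).2
    refine abs_distortion_le_of_sum_sq huspan _ hε.le ?_ hx hy
    refine le_trans (le_of_eq (Finset.sum_congr rfl fun q _ => ?_)) hw
    rw [distortion_countSketch h₀ s₀ row w h σ hlast _ _ (hzero _ (hu _)) (hzero _ (hu _))]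

end probability

end Sketch

/-! ### Accuracy of the program. -/

namespace Sketch

open Matrix RealRAM

/-- The number of rows of the random sketch. -/
noncomputable def numRows (d : ℕ) (ε : ℝ) : ℕ := ⌈100 * ((d : ℝ) * d) / (ε * ε)⌉₊

section accuracy

variable {n d m : ℕ} {A : Matrix (Fin n) (Fin d) ℝ} {e : Fin (nnz A) ≃ Support A} {b : Fin n → ℝ}
  {p : Fin n → Fin m} {v : Fin n → ℝ} {ε : ℝ}

theorem le_numRows (hε : 0 < ε) : 100 * (d : ℝ) ^ 2 ≤ numRows d ε * ε ^ 2 := by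
  have h := Nat.le_ceil (100 * ((d : ℝ) * d) / (ε * ε))
  rw [div_le_iff₀ (by positivity)] at h
  rw [pow_two, pow_two]
  exact h

theorem numRows_le (hd : 0 < d) (hε : 0 < ε) (hε' : ε < 0.09) :
    (numRows d ε : ℝ) ≤ 101 * ((d : ℝ) ^ 2 / ε ^ 2) := by
  have h := (Nat.ceil_lt_add_one (a := 100 * ((d : ℝ) * d) / (ε * ε)) (by positivity)).le
  have h1 : 1 ≤ (d : ℝ) ^ 2 / ε ^ 2 := by
    rw [le_div_iff₀ (by positivity), one_mul]
    have : (1 : ℝ) ≤ d := by exact_mod_cast hd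
    exact pow_le_pow_left₀ hε.le (by linarith) 2
  have h2 : 100 * ((d : ℝ) * d) / (ε * ε) = 100 * ((d : ℝ) ^ 2 / ε ^ 2) := by ring
  rw [h2] at h
  rw [numRows, h2]
  linarith

theorem numRows_pos (hd : 0 < d) (hε : 0 < ε) : 0 < numRows d ε := by
  have : (0 : ℝ) < d := Nat.cast_pos.2 hd
  exact Nat.ceil_pos.2 (by positivity)

/-- The program after the random draws. -/
def afterDraws (fin : ℕ → Cmd) : Cmd :=
  .seq core (.ite (.and (.nlt (.lit 0) (.var 12)) (.nlt (.lit 0) (.var 11))) (fin 7) (fin 8))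

/-- The state before the random draws. -/
noncomputable def beforeDraws (A : Matrix (Fin n) (Fin d) ℝ) (e : Fin (nnz A) ≃ Support A)
    (b : Fin n → ℝ) (p : Fin n → Fin m) (v : Fin n → ℝ) (ε : ℝ) : State :=
  ((input A e b p v ε).setN 4 (numRows d ε)).tick (12 + numRows d ε)

/-- The `ceil` command is split off, because its cost depends on its value and escapes the static
bound. Its cost enters explicitly as 12 plus the number of rows. -/
theorem exec_program (O : Solver) (fin : ℕ → Cmd) :
    exec O (program fin) (input A e b p v ε) =
      (exec O drawHashes (beforeDraws A e b p v ε)).bind (exec O (afterDraws fin)) := by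
  have h : RExp.eval (input A e b p v ε)
      (.div (.mul (.lit 100) (.mul (.ofNat (.var 1)) (.ofNat (.var 1)))) (.mul (.var 0) (.var 0))) =
        100 * ((d : ℝ) * d) / (ε * ε) := by
    simp [RExp.eval, NExp.eval, input]
  have h2 : RExp.cost (.div (.mul (.lit 100) (.mul (.ofNat (.var 1)) (.ofNat (.var 1))))
      (.mul (.var 0) (.var 0))) + numRows d ε + 1 = 12 + numRows d ε := by
    simp only [RExp.cost, NExp.cost]
    omega
  simp only [program, exec, PMF.pure_bind, h]
  rw [← numRows, h2]
  rfl

theorem drawn_of_frame {s : State} (hF : Frame drawHashes (beforeDraws A e b p v ε) s) :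
    Drawn A e b p v ε (numRows d ε) (fun i => s.narr 2 i 0) s where
  nvar_one := by rw [hF.nvar 1 (by simp [drawHashes, Cmd.wN])]; simp [beforeDraws, input]
  nvar_two := by rw [hF.nvar 2 (by simp [drawHashes, Cmd.wN])]; simp [beforeDraws, input]
  nvar_three := by rw [hF.nvar 3 (by simp [drawHashes, Cmd.wN])]; simp [beforeDraws, input]
  nvar_four := by rw [hF.nvar 4 (by simp [drawHashes, Cmd.wN])]; simp [beforeDraws]
  rvar_zero := by rw [hF.rvar 0 (by simp [drawHashes, Cmd.wV])]; simp [beforeDraws, input]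
  row k := by rw [hF.narr 0 (by simp [drawHashes, Cmd.wA])]; simp [beforeDraws, input, pad]
  col k := by rw [hF.narr 0 (by simp [drawHashes, Cmd.wA])]; simp [beforeDraws, input, pad]
  pos i := by rw [hF.narr 1 (by simp [drawHashes, Cmd.wA])]; simp [beforeDraws, input, pad]
  draw _ := rfl
  val k := by rw [hF.rarr 0 (by simp [drawHashes, Cmd.wR])]; simp [beforeDraws, input, pad]
  vec i := by rw [hF.rarr 1 (by simp [drawHashes, Cmd.wR])]; simp [beforeDraws, input, pad]
  weight i := by rw [hF.rarr 2 (by simp [drawHashes, Cmd.wR])]; simp [beforeDraws, input, pad]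
  zero a ha := by
    rw [hF.rarr a (by simp [drawHashes, Cmd.wR])]
    have : a ≠ 0 ∧ a ≠ 1 ∧ a ≠ 2 := by omega
    funext i j
    simp [beforeDraws, input, this]

/-- Every good sequence of draws leads to a correct output, so the probability is at least the
proportion of good sequences. The constant 200 covers both the error factor 8 and the factor 101 in
the number of rows. -/
theorem isAccurate_program {O : Solver} {C : Set (Fin d → ℝ)} {fin : ℕ → Cmd}
    (h7 : Solves O C 7 (fin 7)) (h8 : Solves O C 8 (fin 8)) (hd : 0 < d) (hA : A.rank = d)
    (hε : 0 < ε) (hε' : ε < 0.09) (hC : Convex ℝ C) :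
    IsAccurate (program fin) 200 A e b p v ε C O := by
  intro xs hxs
  set m₂ := numRows d ε with hm₂
  have hm₂pos : 0 < m₂ := numRows_pos hd hε
  obtain ⟨W, hW, hWs⟩ := drawHashes_spec O (beforeDraws A e b p v ε) (nnz A) (m₂ + m₂)
    (by simp [beforeDraws, input]) (by simp [beforeDraws, hm₂])
  have hdet : (afterDraws fin).IsDet := ⟨core_isDet, h7.1, h8.1⟩
  have hexec : exec O (program fin) (input A e b p v ε) =
      (PMF.uniformOfFintype _).map fun w => run O (afterDraws fin) (W w) := by
    rw [exec_program, hW, PMF.bind_map]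
    simp only [Function.comp_def, exec_eq_run O _ hdet]
    rfl
  have hn0 : ∀ k : Fin (nnz A), (beforeDraws A e b p v ε).narr 0 k 0 = (e k).1.1 := fun k => by
    simp [beforeDraws, input, pad]
  have hn2 : ∀ i, (beforeDraws A e b p v ε).narr 2 i 0 = 0 := fun i => by
    simp [beforeDraws, input]
  obtain ⟨G, hGcard, hG⟩ := exists_good_draws hA hm₂pos hε (le_numRows hε)
    (fun k => (e k).1.1) (by
      intro i hi j
      by_contra h
      exact hi (e.symm ⟨(i, j), h⟩) (by simp))
  rw [hexec, PMF.toOuterMeasure_map_apply]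
  refine le_trans ?_ (MeasureTheory.measure_mono (s := (G : Set _)) ?_)
  · have := PMF.toOuterMeasure_uniformOfFintype_apply
      (α := Fin (nnz A) → Fin (m₂ + m₂ - 1 + 1)) (G : Set _)
    have hcard : Fintype.card (G : Set (Fin (nnz A) → Fin (m₂ + m₂ - 1 + 1))) = G.card := by
      simp
    rw [this, hcard, ENNReal.le_div_iff_mul_le (Or.inl (by
        exact_mod_cast Fintype.card_ne_zero)) (Or.inl (ENNReal.natCast_ne_top _)),
      div_eq_mul_inv, mul_right_comm, ← div_eq_mul_inv]
    refine ENNReal.div_le_of_le_mul ?_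
    rw [mul_comm (G.card : ENNReal)]
    exact_mod_cast hGcard
  · intro w hw
    obtain ⟨hF, hD⟩ := hWs w
    have hdr := drawn_of_frame hF
    have hlt : ∀ i : Fin n, decode m₂ ((W w).narr 2 i 0) < m₂ := by
      intro i
      have : (W w).narr 2 i 0 < m₂ + m₂ := by
        by_cases hex : ∃ l < nnz A, (beforeDraws A e b p v ε).narr 0 l 0 = i
        · obtain ⟨l, hl, hli, hlast⟩ := exists_last _ _ _ hex
          rw [(hD i).1 l hl hli hlast]
          have := (w ⟨l, hl⟩).2
          omega
        -- A row without entries keeps the code 0. Such a row of A vanishes, so its hash does not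
        -- influence the sketch of A, but it must still be a valid position.
        · push Not at hex
          rw [(hD i).2 hex, hn2]
          omega
      unfold decode
      split_ifs <;> omega
    let h : Fin n → Fin m₂ := fun i => ⟨decode m₂ ((W w).narr 2 i 0), hlt i⟩
    have hemb := hG w hw h (fun i => sign m₂ ((W w).narr 2 i 0)) (by
      intro k hk
      have : (W w).narr 2 (e k).1.1 0 = w k := by
        refine (hD _).1 k k.2 (hn0 k) fun l hl hkl heq => ?_
        rw [hn0 ⟨l, hl⟩] at heq
        exact hk ⟨l, hl⟩ hkl (Fin.ext heq)
      refine ⟨Fin.ext ?_, ?_⟩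
      · simp only [h, this, hash]
      · simp only [this])
    obtain ⟨herr, hsol⟩ := choice_correct hdr h7 h8 h (fun _ => rfl) hd hA hε hε' hC hemb hxs
    have hrate : 0 ≤ rate A (countSketch p v) ε := by
      rw [rate]
      split_ifs
      · exact hε.le
      · exact le_min (div_nonneg (Z₂_nonneg A _ hd hA) (Z₁_nonneg A _ hd hA)) hε.le
    refine ⟨herr.trans ?_, hsol.imp id fun hsol => ?_⟩
    · have := mul_nonneg hrate (l2_nonneg (A *ᵥ xs))
      linarith
    · refine ⟨m₂, h, _, ?_, ?_, fun i => ?_, hsol⟩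
      · have := le_numRows (d := d) hε
        rw [div_le_iff₀ (by positivity)]
        have h2 : (0 : ℝ) ≤ m₂ * ε ^ 2 := by positivity
        have h3 : (0 : ℝ) ≤ (d : ℝ) ^ 2 := by positivity
        rw [← hm₂] at this
        linarith
      · refine (numRows_le hd hε hε').trans ?_
        have : 0 ≤ (d : ℝ) ^ 2 / ε ^ 2 := by positivity
        linarith
      · unfold sign
        split_ifs
        · exact Or.inl rfl
        · exact Or.inr rfl

end accuracy

/-! ### Running time. -/

section time

/-- The running time of the program after `ceil`, apart from the final call. -/
theorem bound_le (ρ : ℕ → ℕ) (fin : ℕ → Cmd)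
    (hfin : (fin 7).bound ρ + (fin 8).bound ρ ≤ 200 * (ρ 1 + 1) ^ 3) :
    ((Cmd.seq drawHashes (afterDraws fin)).bound ρ : ℝ) ≤
      1000 * (ρ 2 + (ρ 3 + ρ 4 + ρ 1 + 1) * (ρ 1 + 1) ^ 2) := by
  have hfin' : (((fin 7).bound ρ : ℕ) : ℝ) + ((fin 8).bound ρ : ℕ) ≤ 200 * ((ρ 1 : ℝ) + 1) ^ 3 := by
    exact_mod_cast hfin
  simp only [Cmd.bound, drawHashes, afterDraws, core, scatter, RealRAM.gram, gramRow, accumulate,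
    testMatrices, testRow, gaussJordan, pivotTest, elimRound, elimRow, rowOp, NExp.cost, RExp.cost,
    BExp.cost, NExp.static, rowE, colE, valE, drawE]
  push_cast
  have h1 : (0 : ℝ) ≤ ρ 1 := Nat.cast_nonneg _
  have h2 : (0 : ℝ) ≤ ρ 2 := Nat.cast_nonneg _
  have h3 : (0 : ℝ) ≤ ρ 3 := Nat.cast_nonneg _
  have h4 : (0 : ℝ) ≤ ρ 4 := Nat.cast_nonneg _
  generalize (ρ 1 : ℝ) = d at *
  generalize (ρ 2 : ℝ) = N at *
  generalize (ρ 3 : ℝ) = m at *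
  generalize (ρ 4 : ℝ) = m' at *
  have a1 : 0 ≤ d ^ 2 := by positivity
  have a2 : 0 ≤ d ^ 3 := by positivity
  have a3 : 0 ≤ m * d := by positivity
  have a4 : 0 ≤ m * d ^ 2 := by positivity
  have a5 : 0 ≤ m' * d := by positivity
  have a6 : 0 ≤ m' * d ^ 2 := by positivity
  linarith

variable {n d m : ℕ} {A : Matrix (Fin n) (Fin d) ℝ} {e : Fin (nnz A) ≃ Support A} {b : Fin n → ℝ}
  {p : Fin n → Fin m} {v : Fin n → ℝ} {ε : ℝ}

/-- Everything is measured in x = d/ε, which is at least d and at least 1, so all polynomial terms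
fit under one high power of x. One number serves as both factor and exponent, and 5000 (K + 200) is
large enough for both. -/
theorem runsInTime_program (O : Solver) (fin : ℕ → Cmd) (q K : ℕ)
    (hs : (Cmd.seq drawHashes (afterDraws fin)).Static 5)
    (hfin : ∀ ρ : ℕ → ℕ, (fin 7).bound ρ + (fin 8).bound ρ ≤ 200 * (ρ 1 + 1) ^ 3)
    (hq : (Cmd.seq drawHashes (afterDraws fin)).asks ≤ q)
    (hd : 0 < d) (hε : 0 < ε) (hε' : ε < 0.09) (hm : (m : ℝ) ≤ K * ((d : ℝ) / ε) ^ K) :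
    RunsInTime (program fin) q (5000 * (K + 200)) A e b p v ε O := by
  intro s hsupp
  rw [exec_program] at hsupp
  set ρ : ℕ → ℕ := (beforeDraws A e b p v ε).nvar with hρ
  obtain ⟨-, ht, hc⟩ := static_exec O 5 ρ _ hs (beforeDraws A e b p v ε) (fun _ _ => rfl) s hsupp
  refine ⟨?_, ?_⟩
  · have ht' : (s.time : ℝ) ≤ (12 + numRows d ε : ℕ) +
        ((Cmd.seq drawHashes (afterDraws fin)).bound ρ : ℕ) := by
      have : (beforeDraws A e b p v ε).time = 12 + numRows d ε := by
        simp [beforeDraws, State.tick, State.setN, input]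
      rw [this] at ht
      exact_mod_cast ht
    have hb := bound_le ρ fin (hfin ρ)
    have r1 : ρ 1 = d := by simp [hρ, beforeDraws, input]
    have r2 : ρ 2 = nnz A := by simp [hρ, beforeDraws, input]
    have r3 : ρ 3 = m := by simp [hρ, beforeDraws, input]
    have r4 : ρ 4 = numRows d ε := by simp [hρ, beforeDraws]
    rw [r1, r2, r3, r4] at hb
    have hd1 : (1 : ℝ) ≤ d := by exact_mod_cast hd
    set x := (d : ℝ) / ε with hx
    have hdx : (d : ℝ) ≤ x := by
      rw [hx, le_div_iff₀ hε]
      have := mul_le_mul_of_nonneg_left (show ε ≤ 1 by linarith) (show (0 : ℝ) ≤ d by linarith)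
      linarith
    have hx1 : 1 ≤ x := hd1.trans hdx
    have hm2 : (numRows d ε : ℝ) ≤ 101 * x ^ 2 := by
      rw [hx, div_pow]
      exact numRows_le hd hε hε'
    have hp : ∀ {i j : ℕ}, i ≤ j → x ^ i ≤ x ^ j := fun h => pow_le_pow_right₀ hx1 h
    have hKx : (m : ℝ) + numRows d ε + d + 1 ≤ (K + 103) * x ^ (K + 2) := by
      have b1 : (K : ℝ) * x ^ K ≤ K * x ^ (K + 2) :=
        mul_le_mul_of_nonneg_left (hp (by omega)) (Nat.cast_nonneg _)
      have b2 : x ^ 2 ≤ x ^ (K + 2) := hp (by omega)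
      have b3 : x ^ 1 ≤ x ^ (K + 2) := hp (by omega)
      have b4 : x ^ 0 ≤ x ^ (K + 2) := hp (by omega)
      rw [pow_one] at b3
      rw [pow_zero] at b4
      linarith
    have hdd : ((d : ℝ) + 1) ^ 2 ≤ 4 * x ^ 2 := by
      have : ((d : ℝ) + 1) ^ 2 ≤ (2 * x) ^ 2 :=
        pow_le_pow_left₀ (by linarith) (by linarith) 2
      rw [mul_pow] at this
      linarith
    have hprod : ((m : ℝ) + numRows d ε + d + 1) * ((d : ℝ) + 1) ^ 2 ≤
        4 * (K + 103) * x ^ (K + 4) := by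
      refine (mul_le_mul hKx hdd (by positivity) (by positivity)).trans_eq ?_
      rw [show K + 4 = (K + 2) + 2 from rfl, pow_add x (K + 2) 2]
      ring
    -- The program takes O(nnz(A)) steps plus a polynomial; the logarithm is gained from 1/ε ≥ 3 >
    -- e.
    have hlog : 1 ≤ Real.log (1 / ε) := by
      rw [Real.le_log_iff_exp_le (by positivity)]
      have h3 : (3 : ℝ) ≤ 1 / ε := by
        rw [le_div_iff₀ hε]
        linarith
      have := Real.exp_one_lt_d9
      linarith
    have hN : (nnz A : ℝ) ≤ nnz A * Real.log (1 / ε) :=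
      le_mul_of_one_le_right (Nat.cast_nonneg _) hlog
    have hpow : x ^ (K + 4) ≤ x ^ (5000 * (K + 200)) := hp (by omega)
    have hpow2 : x ^ 2 ≤ x ^ (5000 * (K + 200)) := hp (by omega)
    have hpow0 : x ^ 0 ≤ x ^ (5000 * (K + 200)) := hp (by omega)
    rw [pow_zero] at hpow0
    set Y := x ^ (5000 * (K + 200)) with hY
    have hK0 : (0 : ℝ) ≤ K := Nat.cast_nonneg _
    have hprod2 : 4 * ((K : ℝ) + 103) * x ^ (K + 4) ≤ 4 * (K + 103) * Y :=
      mul_le_mul_of_nonneg_left hpow (by positivity)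
    have hN0 : (0 : ℝ) ≤ nnz A * Real.log (1 / ε) := (Nat.cast_nonneg _).trans hN
    have hKN : 0 ≤ (K : ℝ) * (nnz A * Real.log (1 / ε)) := mul_nonneg hK0 hN0
    have hKY : 0 ≤ (K : ℝ) * Y := mul_nonneg hK0 (by linarith)
    push_cast at ht' ⊢
    linarith
  · have : (beforeDraws A e b p v ε).calls = 0 := rfl
    omega

end time

theorem static_afterDraws {fin : ℕ → Cmd} (h7 : (fin 7).Static 5) (h8 : (fin 8).Static 5) :
    (Cmd.seq drawHashes (afterDraws fin)).Static 5 := by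
  simp [Cmd.Static, Cmd.asks, drawHashes, afterDraws, core, scatter, RealRAM.gram, gramRow,
    accumulate, testMatrices, testRow, gaussJordan, pivotTest, elimRound, elimRow, rowOp, h7, h8]

theorem asks_afterDraws (fin : ℕ → Cmd) :
    (Cmd.seq drawHashes (afterDraws fin)).asks = max (fin 7).asks (fin 8).asks := by
  simp [Cmd.asks, drawHashes, afterDraws, core, scatter, RealRAM.gram, gramRow, accumulate,
    testMatrices, testRow, gaussJordan, pivotTest, elimRound, elimRow, rowOp]

theorem solveLinear_static (h : ℕ) : (solveLinear h).Static 5 := by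
  simp [Cmd.Static, Cmd.asks, solveLinear, divideDiag, gaussJordan, pivotTest, elimRound, elimRow,
    rowOp]

theorem solveLinear_asks (h : ℕ) : (solveLinear h).asks = 0 := by
  simp [Cmd.asks, solveLinear, divideDiag, gaussJordan, pivotTest, elimRound, elimRow, rowOp]

theorem solveLinear_bound (h : ℕ) (ρ : ℕ → ℕ) :
    (solveLinear h).bound ρ ≤ 100 * (ρ 1 + 1) ^ 3 := by
  simp only [Cmd.bound, solveLinear, divideDiag, gaussJordan, pivotTest, elimRound, elimRow, rowOp,
    NExp.cost, RExp.cost, BExp.cost, NExp.static]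
  generalize ρ 1 = d
  have h1 : 0 ≤ d ^ 2 := Nat.zero_le _
  have h2 : 0 ≤ d ^ 3 := Nat.zero_le _
  nlinarith

end Sketch

/-! ### The two programs differ only in their last command. -/

theorem mainTheorem4 :
    ∃ κ : ℝ, 0 < κ ∧
      (∃ P : RealRAM.Cmd, ∀ K : ℕ, ∃ k : ℕ,
        ∀ (n d m : ℕ) (A : Matrix (Fin n) (Fin d) ℝ) (e : Fin (Sketch.nnz A) ≃ Sketch.Support A)
          (b : Fin n → ℝ) (p : Fin n → Fin m) (v : Fin n → ℝ) (ε : ℝ)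
          (C : Set (Fin d → ℝ)) (O : RealRAM.Solver),
          0 < d → A.rank = d → 0 < ε → ε < 0.09 → (m : ℝ) ≤ K * ((d : ℝ) / ε) ^ K →
          C.Nonempty → IsClosed C → Convex ℝ C → Sketch.SolvesQP C O →
          Sketch.RunsInTime P 1 k A e b p v ε O ∧ Sketch.IsAccurate P κ A e b p v ε C O) ∧
      (∃ P : RealRAM.Cmd, ∀ K : ℕ, ∃ k : ℕ,
        ∀ (n d m : ℕ) (A : Matrix (Fin n) (Fin d) ℝ) (e : Fin (Sketch.nnz A) ≃ Sketch.Support A)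
          (b : Fin n → ℝ) (p : Fin n → Fin m) (v : Fin n → ℝ) (ε : ℝ) (O : RealRAM.Solver),
          0 < d → A.rank = d → 0 < ε → ε < 0.09 → (m : ℝ) ≤ K * ((d : ℝ) / ε) ^ K →
          Sketch.RunsInTime P 0 k A e b p v ε O ∧
            Sketch.IsAccurate P κ A e b p v ε Set.univ O) := by
  refine ⟨200, by norm_num, ⟨Sketch.program fun h => .solve h 6 3, fun K => ⟨5000 * (K + 200), ?_⟩⟩,
    Sketch.program Sketch.solveLinear, fun K => ⟨5000 * (K + 200), ?_⟩⟩
  · intro n d m A e b p v ε C O hd hA hε hε' hm _ _ hC hO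
    refine ⟨Sketch.runsInTime_program O _ 1 K (Sketch.static_afterDraws trivial trivial)
      (fun ρ => ?_) (Sketch.asks_afterDraws _).le hd hε hε' hm,
      Sketch.isAccurate_program (Sketch.solves_solve hO 7) (Sketch.solves_solve hO 8) hd hA hε hε'
        hC⟩
    have : 1 ≤ (ρ 1 + 1) ^ 3 := Nat.one_le_pow _ _ (Nat.succ_pos _)
    simp only [RealRAM.Cmd.bound]
    omega
  · intro n d m A e b p v ε O hd hA hε hε' hm
    refine ⟨Sketch.runsInTime_program O _ 0 K (Sketch.static_afterDraws
      (Sketch.solveLinear_static 7) (Sketch.solveLinear_static 8)) (fun ρ => ?_) ?_ hd hε hε' hm,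
      Sketch.isAccurate_program (Sketch.solves_solveLinear O 7 (by decide) (by decide))
        (Sketch.solves_solveLinear O 8 (by decide) (by decide)) hd hA hε hε' convex_univ⟩
    · have h7 := Sketch.solveLinear_bound 7 ρ
      have h8 := Sketch.solveLinear_bound 8 ρ
      omega
    · rw [Sketch.asks_afterDraws, Sketch.solveLinear_asks, Sketch.solveLinear_asks, max_self]
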